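/- **Conventions.** Let $\mathbb T=\mathbb R/2\pi\mathbb Z$, $\hat f(\xi)=\int_{\mathbb T}f(x)e^{-ix\xi}\,dx$ for $\xi\in\mathbb Z$, let $\mathcal F$ be the space-time Fourier transform on $\mathbb R\times\mathbb T$ (with variables $(\tau,\xi)\in\mathbb R\times\mathbb Z$), $\varphi_a(\xi)=\xi|\xi|^a$, and $H^\infty=\bigcap_\sigma H^\sigma(\mathbb T)$. Functions are complex-valued. Let $\rho:\mathbb R\to[0,\infty)$ be smooth, even, non-increasing on $[0,\infty)$, equal to $1$ on $[-1,1]$ and supported in $(-2,2)$. Let $P_k$, $k\ge0$, be the Fourier multipliers on $\mathbb T$ with symbols $\chi_0=1_{\{0\}}$, $\chi_1(\xi)=\rho(\xi/2)-1_{\{0\}}(\xi)$ and $\chi_k(\xi)=\rho(2^{-k}\xi)-\rho(2^{1-k}\xi)$ for $k\ge2$, so that $\sum_{k\ge0}\chi_k=1$ on $\mathbb Z$. Put $I_0=\{0\}$ and $I_k=\{\xi\in\mathbb Z:2^{k-1}\le|\xi|\le2^{k+1}\}$ for $k\ge1$. Let $\eta_0:\mathbb R\to[0,1]$ be smooth and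 even, equal to $1$ on $[-1,1]$ and supported in $[-5/4,5/4]$, and put $\eta_j(\tau)=\eta_0(\tau/2^j)-\eta_0(\tau/2^{j-1})$ for $j\ge1$. For $f:\mathbb R\times\mathbb Z\to\mathbb C$ supported in $\mathbb R\times I_k$ set $$\|f\|_{X_{a,k}}=\sum_{j\ge0}2^{j/2}\|\eta_j(\tau-\varphi_a(\xi))f(\tau,\xi)\|_{\ell^2_\xi L^2_\tau}.$$ Let $E_k=\{f\in L^2(\mathbb T):\operatorname{supp}\hat f\subseteq I_k\}$ and let $C_0(\mathbb R,E_k)$ be the continuous maps $\mathbb R\to E_k$ vanishing outside $[-4,4]$. For $w\in C_0(\mathbb R,E_k)$ and $\delta\ge0$ set $$\|w\|_{F^\delta_{a,k}}=\sup_{t_k\in\mathbb R}\big\|\mathcal F[w\,\eta_0(2^{(2-a+\delta)k}(t-t_k))]\big\|_{X_{a,k}},$$ $$\|w\|_{N^\delta_{a,k}}=\sup_{t_k\in\mathbb R}\big\|(\tau-\varphi_a(\xi)+i2^{(2-a+\delta)k})^{-1}\mathcal F[w\,\eta_0(2^{(2-a+\delta)k}(t-t_k))]\big\|_{X_{a,k}}.$$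 For $T\in(0,1]$, the norms of $F^\delta_{a,k}(T)$ and $N^\delta_{a,k}(T)$ are the infima of these norms over all extensions $w\in C_0(\mathbb R,E_k)$ of a function given on $[-T,T]$. For $u\in C([-T,T],H^\infty)$ and $s\in\mathbb R$ put $$\|u\|_{F^{s,\delta}_a(T)}^2=\sum_{k\ge0}2^{2ks}\|P_ku\|_{F^\delta_{a,k}(T)}^2,\qquad \|u\|_{N^{s,\delta}_a(T)}^2=\sum_{k\ge0}2^{2ks}\|P_ku\|_{N^\delta_{a,k}(T)}^2,$$ and let $F^{s,\delta}_a(T)$, $N^{s,\delta}_a(T)$ be the sets of $u\in C([-T,T],H^\infty)$ with finite norm. **Proposition.** (1) Let $1<a\le3/2$ and $s>3/2-a$. There are $\delta=\delta(a,s)>0$ and $\theta=\theta(a,s)>0$, and a constant $C<\infty$ depending only on $a$, $s$ and the cutoffs $\rho,\eta_0$, such that for all $T\in(0,1]$ and all $u,v\in F^{0,\delta}_a(T)$ with $\int_{\mathbb T}u(t,x)\,dx=\int_{\mathbb T}v(t,x)\,dx=0$ for $t\in[-T,T]$, one has $\partial_x(uv)\in N^{0,\delta}_a(T)$ and $$\|\partial_x(uv)\|_{N^{0,\delta}_a(T)}\le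 C\,T^\theta\|u\|_{F^{0,\delta}_a(T)}\|v\|_{F^{0,\delta}_a(T)},$$ $$\|\partial_x(uv)\|_{N^{-1/2,\delta}_a(T)}\le C\,T^\theta\|u\|_{F^{-1/2,\delta}_a(T)}\|v\|_{F^{s,\delta}_a(T)}$$ (the second estimate is read in $[0,\infty]$, with $0\cdot\infty=0$, if $v\notin F^{s,\delta}_a(T)$). (2) Let $3/2<a<2$. There are $\delta=\delta(a)>0$ and $\theta=\theta(a)>0$, and a constant $C<\infty$ depending only on $a$, $\rho,\eta_0$, such that for all $T\in(0,1]$ and all $u,v\in F^{0,\delta}_a(T)$ with vanishing mean for every $t\in[-T,T]$, one has $\partial_x(uv)\in N^{0,\delta}_a(T)$ and $$\|\partial_x(uv)\|_{N^{0,\delta}_a(T)}\le C\,T^\theta\|u\|_{F^{0,\delta}_a(T)}\|v\|_{F^{0,\delta}_a(T)},$$ $$\|\partial_x(uv)\|_{N^{-1/2,\delta}_a(T)}\le C\,T^\theta\|u\|_{F^{0,\delta}_a(T)}\|v\|_{F^{-1/2,\delta}_a(T)}.$$ -/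

import Mathlib

open scoped ENNReal ContDiff

namespace ShortTimeBO

/-! ## Fourier analysis on `𝕋 = ℝ / 2πℤ`

A function on the torus is a `2π`-periodic function `ℝ → ℂ`; a space-time function is
`u : ℝ → ℝ → ℂ`, written `u t x`. All norms take values in `[0, ∞]`. -/

/-- `f̂(ξ) = ∫_𝕋 f(x) e^{-ixξ} dx`. -/
noncomputable def fourierT (f : ℝ → ℂ) (ξ : ℤ) : ℂ :=
  ∫ x in (0 : ℝ)..(2 * Real.pi), f x * Complex.exp (-(Complex.I * (x : ℂ) * (ξ : ℂ)))

/-- `‖f‖_{H^σ} = ‖ ⟨ξ⟩^σ f̂(ξ) ‖_{ℓ²}`. -/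
noncomputable def sobolevNorm (σ : ℝ) (f : ℝ → ℂ) : ℝ≥0∞ :=
  (∑' ξ : ℤ, ENNReal.ofReal ((1 + (ξ : ℝ) ^ 2) ^ σ) * ‖fourierT f ξ‖ₑ ^ 2) ^ (1 / 2 : ℝ)

/-- `H^∞(𝕋) = ⋂_σ H^σ(𝕋)`, the smooth `2π`-periodic functions. -/
def IsHInfty (f : ℝ → ℂ) : Prop :=
  ContDiff ℝ ∞ f ∧ Function.Periodic f (2 * Real.pi)

/-- Continuity on the time set `J` with respect to the norm of `H^σ`. -/
def ContinuousInSobolev (σ : ℝ) (J : Set ℝ) (u : ℝ → ℝ → ℂ) : Prop :=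
  ∀ t₀ ∈ J, Filter.Tendsto (fun t => sobolevNorm σ (fun x => u t x - u t₀ x))
    (nhdsWithin t₀ J) (nhds 0)

/-- `u ∈ C([-T,T], H^∞)`. -/
def IsCHInfty (T : ℝ) (u : ℝ → ℝ → ℂ) : Prop :=
  (∀ t ∈ Set.Icc (-T) T, IsHInfty (u t)) ∧
    ∀ σ : ℝ, ContinuousInSobolev σ (Set.Icc (-T) T) u

/-- The spatial mean of `u(t)` vanishes for every `t ∈ [-T,T]`. -/
def HasVanishingMean (T : ℝ) (u : ℝ → ℝ → ℂ) : Prop :=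
  ∀ t ∈ Set.Icc (-T) T, ∫ x in (0 : ℝ)..(2 * Real.pi), u t x = 0

/-- `∂ₓ(uv)`. -/
noncomputable def dxMul (u v : ℝ → ℝ → ℂ) : ℝ → ℝ → ℂ :=
  fun t x => deriv (fun y => u t y * v t y) x

/-- The space-time Fourier transform `∫_ℝ ∫_𝕋 e^{-ixξ} e^{-itτ} v(t,x) dx dt`. -/
noncomputable def spaceTimeFourier (v : ℝ → ℝ → ℂ) (τ : ℝ) (ξ : ℤ) : ℂ :=
  ∫ t : ℝ, Complex.exp (-(Complex.I * (t : ℂ) * (τ : ℂ))) * fourierT (v t) ξ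

/-! ## Littlewood-Paley decomposition in space -/

/-- The bump function generating the Littlewood-Paley decomposition. -/
structure IsSpaceCutoff (ρ : ℝ → ℝ) : Prop where
  smooth : ContDiff ℝ ∞ ρ
  nonneg : ∀ x, 0 ≤ ρ x
  even : ∀ x, ρ (-x) = ρ x
  antitone : AntitoneOn ρ (Set.Ici 0)
  eq_one : ∀ x, |x| ≤ 1 → ρ x = 1
  support_subset : Function.support ρ ⊆ Metric.ball 0 2

/-- The Littlewood-Paley symbols: `χ₀` is the indicator of the frequency zero and
`χ_k(ξ) = ρ(2^{-k}ξ) - ρ(2^{1-k}ξ)` for `k ≥ 2`; the symbol `χ₁` carries all the remaining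
frequencies, including `ξ = ±1`, so that `∑_{k ≥ 0} χ_k = 1` on `ℤ`. -/
noncomputable def lpSymbol (ρ : ℝ → ℝ) : ℕ → ℤ → ℝ
  | 0, ξ => if ξ = 0 then 1 else 0
  | 1, ξ => if ξ = 0 then 0 else ρ ((ξ : ℝ) / 2)
  | (k + 2), ξ => ρ ((ξ : ℝ) / 2 ^ (k + 2)) - ρ ((ξ : ℝ) / 2 ^ (k + 1))

/-- The projector `P_k`, i.e. the Fourier multiplier `χ_k` (a finite sum). -/
noncomputable def lpProj (ρ : ℝ → ℝ) (k : ℕ) (f : ℝ → ℂ) : ℝ → ℂ :=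
  fun x => (1 / (2 * Real.pi) : ℂ) *
    ∑' ξ : ℤ, (lpSymbol ρ k ξ : ℂ) * fourierT f ξ * Complex.exp (Complex.I * (x : ℂ) * (ξ : ℂ))

/-- The frequency block `I_k`: `I₀ = {0}` and `I_k = {2^{k-1} ≤ |ξ| ≤ 2^{k+1}}` for `k ≥ 1`. -/
def freqBlock : ℕ → Set ℤ
  | 0 => {0}
  | (k + 1) => {ξ | 2 ^ k ≤ |ξ| ∧ |ξ| ≤ 2 ^ (k + 2)}

/-- `E_k`: the functions in `L²(𝕋)` with frequencies in `I_k`. These are trigonometric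
polynomials, and the continuous representative is used. -/
def IsEk (k : ℕ) (f : ℝ → ℂ) : Prop :=
  Continuous f ∧ Function.Periodic f (2 * Real.pi) ∧ ∀ ξ : ℤ, ξ ∉ freqBlock k → fourierT f ξ = 0

/-- `C₀(ℝ, E_k)`: continuous in time with values in `E_k ⊆ L² = H⁰`, vanishing for
`t ∉ [-4,4]`. -/
def IsC0Ek (k : ℕ) (w : ℝ → ℝ → ℂ) : Prop :=
  (∀ t, IsEk k (w t)) ∧ ContinuousInSobolev 0 Set.univ w ∧
    ∀ t, t ∉ Set.Icc (-4 : ℝ) 4 → w t = 0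

/-! ## Modulation and the short time spaces -/

/-- The bump function generating the modulation decomposition and the time localization. -/
structure IsModulationCutoff (η₀ : ℝ → ℝ) : Prop where
  smooth : ContDiff ℝ ∞ η₀
  mem_unit : ∀ x, η₀ x ∈ Set.Icc (0 : ℝ) 1
  even : ∀ x, η₀ (-x) = η₀ x
  eq_one : ∀ x, |x| ≤ 1 → η₀ x = 1
  support_subset : Function.support η₀ ⊆ Set.Icc (-(5 / 4)) (5 / 4)

/-- `η_j(τ) = η₀(τ/2^j) - η₀(τ/2^{j-1})` for `j ≥ 1`. -/
noncomputable def modCutoff (η₀ : ℝ → ℝ) : ℕ → ℝ → ℝ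
  | 0, τ => η₀ τ
  | (j + 1), τ => η₀ (τ / 2 ^ (j + 1)) - η₀ (τ / 2 ^ j)

/-- The dispersion relation `φ_a(ξ) = ξ|ξ|^a`. -/
noncomputable def dispersion (a : ℝ) (ξ : ℤ) : ℝ := (ξ : ℝ) * |(ξ : ℝ)| ^ a

/-- `∑_{j ≥ 0} 2^{j/2} ‖η_j(τ - φ_a(ξ)) g(τ,ξ)‖_{ℓ²_ξ L²_τ}`, the norm of `X_{a,k}`. It is only
applied to functions whose `ξ`-support is in `I_k`. -/
noncomputable def xNorm (η₀ : ℝ → ℝ) (a : ℝ) (g : ℝ → ℤ → ℂ) : ℝ≥0∞ :=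
  ∑' j : ℕ, (2 : ℝ≥0∞) ^ ((j : ℝ) / 2) *
    (∑' ξ : ℤ, ∫⁻ τ : ℝ,
      ‖(modCutoff η₀ j (τ - dispersion a ξ) : ℂ) * g τ ξ‖ₑ ^ 2) ^ (1 / 2 : ℝ)

/-- The inverse time scale `2^{(2-a+δ)k}` at frequency `2^k`. -/
noncomputable def invTimeScale (a δ : ℝ) (k : ℕ) : ℝ := (2 : ℝ) ^ ((2 - a + δ) * (k : ℝ))

/-- `ℱ[w · η₀(2^{(2-a+δ)k}(t - t_k))]`. -/
noncomputable def localizedFourier (η₀ : ℝ → ℝ) (a δ : ℝ) (k : ℕ) (tk : ℝ) (w : ℝ → ℝ → ℂ) :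
    ℝ → ℤ → ℂ :=
  spaceTimeFourier (fun t x => w t x * (η₀ (invTimeScale a δ k * (t - tk)) : ℂ))

/-- The norm of `F^δ_{a,k}`. -/
noncomputable def fkNorm (η₀ : ℝ → ℝ) (a δ : ℝ) (k : ℕ) (w : ℝ → ℝ → ℂ) : ℝ≥0∞ :=
  ⨆ tk : ℝ, xNorm η₀ a (localizedFourier η₀ a δ k tk w)

/-- The norm of `N^δ_{a,k}`. -/
noncomputable def nkNorm (η₀ : ℝ → ℝ) (a δ : ℝ) (k : ℕ) (w : ℝ → ℝ → ℂ) : ℝ≥0∞ :=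
  ⨆ tk : ℝ, xNorm η₀ a (fun τ ξ =>
    ((τ - dispersion a ξ : ℝ) + Complex.I * (invTimeScale a δ k : ℂ))⁻¹ *
      localizedFourier η₀ a δ k tk w τ ξ)

/-- The norm of `F^δ_{a,k}(T)`: infimum over the extensions in `C₀(ℝ, E_k)`. -/
noncomputable def fkNormT (η₀ : ℝ → ℝ) (a δ T : ℝ) (k : ℕ) (u : ℝ → ℝ → ℂ) : ℝ≥0∞ :=
  ⨅ (w : ℝ → ℝ → ℂ) (_ : IsC0Ek k w) (_ : ∀ t ∈ Set.Icc (-T) T, w t = u t), fkNorm η₀ a δ k w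

/-- The norm of `N^δ_{a,k}(T)`: infimum over the extensions in `C₀(ℝ, E_k)`. -/
noncomputable def nkNormT (η₀ : ℝ → ℝ) (a δ T : ℝ) (k : ℕ) (u : ℝ → ℝ → ℂ) : ℝ≥0∞ :=
  ⨅ (w : ℝ → ℝ → ℂ) (_ : IsC0Ek k w) (_ : ∀ t ∈ Set.Icc (-T) T, w t = u t), nkNorm η₀ a δ k w

/-- `‖u‖_{F^{s,δ}_a(T)} = (∑_{k ≥ 0} 2^{2ks} ‖P_k u‖²_{F^δ_{a,k}(T)})^{1/2}`. -/
noncomputable def fNorm (ρ η₀ : ℝ → ℝ) (a δ T s : ℝ) (u : ℝ → ℝ → ℂ) : ℝ≥0∞ :=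
  (∑' k : ℕ, (2 : ℝ≥0∞) ^ (2 * (k : ℝ) * s) *
    fkNormT η₀ a δ T k (fun t => lpProj ρ k (u t)) ^ 2) ^ (1 / 2 : ℝ)

/-- `‖u‖_{N^{s,δ}_a(T)} = (∑_{k ≥ 0} 2^{2ks} ‖P_k u‖²_{N^δ_{a,k}(T)})^{1/2}`. -/
noncomputable def nNorm (ρ η₀ : ℝ → ℝ) (a δ T s : ℝ) (u : ℝ → ℝ → ℂ) : ℝ≥0∞ :=
  (∑' k : ℕ, (2 : ℝ≥0∞) ^ (2 * (k : ℝ) * s) *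
    nkNormT η₀ a δ T k (fun t => lpProj ρ k (u t)) ^ 2) ^ (1 / 2 : ℝ)

/-- `u ∈ F^{s,δ}_a(T)`. -/
def MemF (ρ η₀ : ℝ → ℝ) (a δ T s : ℝ) (u : ℝ → ℝ → ℂ) : Prop :=
  IsCHInfty T u ∧ fNorm ρ η₀ a δ T s u < ⊤

/-- `u ∈ N^{s,δ}_a(T)`. -/
def MemN (ρ η₀ : ℝ → ℝ) (a δ T s : ℝ) (u : ℝ → ℝ → ℂ) : Prop :=
  IsCHInfty T u ∧ nNorm ρ η₀ a δ T s u < ⊤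

end ShortTimeBO

/-!
The estimate is reduced to a statement about nonnegative functions. A near-optimal extension of a
dyadic block of `u` or `v` is replaced by its family of Fourier coefficients
(`exists_isBlockFamily`), multiplied by a cutoff at time scale `T`. Of the norm of `X_{a,k}` only
the consequences collected in `ModBound` are kept: an `ℓ² L¹` bound, and decay of order `R^{-1/2}`
of the part of modulation at least `R`. These are stable under multiplication by a bump function of
time at any scale (`ModBound.smear`), and on a time window of length `Λ⁻¹` they yield a further
factor `Λ^{-1/2}` in `ℓ² L²` (`ModBound.mixedNorm_smear_le`).

The core is the interaction of two blocks `k₁, k₂` at the output block `k`, with `n` the smallest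
and `N` the largest of the three indices, on a window so short (at most the three time scales and
`T`) that the short-time cutoffs are all invisible. Since neither factor has a mean and the output
is differentiated, only blocks of positive index occur, and the resonance function
`φ(ξ₁) + φ(ξ₂) - φ(ξ₁ + ξ₂)` is at least a multiple of `2^n 2^{aN}` (`resonance_block`). One of the
three modulations is therefore at least a third of this number. If it is the modulation of the
output, the weight `(τ - φ(ξ) + iL)⁻¹` gains, and otherwise the high-modulation part of one of the
factors is small; this is `IsModulationCutoff.resolventNorm_biConv_le`. Young's inequality in
frequency costs the square root of the number of frequencies in the smallest block
(`l2Norm_conv_block_le`), so that the smallest frequency cancels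
(`blockCard_mul_resThreshold_le`).

The output at its own time scale is a sum over windows (`block_interaction`). Their number is
limited both by that time scale and by `T`, and interpolating between the two produces the power
`T^ϑ` (`scale_bound`). The resulting size of one interaction is `2^{kp - Nq}`
(`block_interaction_size`), with `p - q < 0`.

To return to the norms with infima over extensions, the interactions of all blocks are summed to an
extension of `P_k ∂ₓ(uv)` (`outExt`, `nkNormT_dxMul_le`). Only `O(k + 1)` diagonals of pairs of
blocks contribute at the output `k` (`tsum_interacts_le`), and the negative exponent `p - q` pays
for them and for the sum over `k` (`exists_nNorm_dxMul_le`). In the estimates with the weight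
`2^{-k/2}`, the decay `q` in the largest frequency, about `a - 1`, together with the weight on the
other factor has to make up for half a derivative; this is the condition `s > 3/2 - a`
(`kernel_neg_half_le`).
-/

namespace ShortTimeBO

open MeasureTheory Measure

/-! ### Square norms of nonnegative functions -/

/-- `(∫ g² dμ)^{1/2}` for a function with values in `[0, ∞]`. With the counting measure on `ℤ`
this is the `ℓ²` norm of a sequence, so that one set of inequalities serves both variables. -/
noncomputable def l2Norm {α : Type*} [MeasurableSpace α] (μ : Measure α) (g : α → ℝ≥0∞) : ℝ≥0∞ :=
  (∫⁻ x, g x ^ 2 ∂μ) ^ (1 / 2 : ℝ)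

section L2

variable {α : Type*} [MeasurableSpace α] {μ : Measure α}

lemma rpow_half_sq (x : ℝ≥0∞) : (x ^ (1 / 2 : ℝ)) ^ 2 = x := by
  rw [← ENNReal.rpow_natCast, ← ENNReal.rpow_mul]; norm_num

lemma sq_rpow_half (x : ℝ≥0∞) : (x ^ 2) ^ (1 / 2 : ℝ) = x := by
  rw [← ENNReal.rpow_natCast, ← ENNReal.rpow_mul]; norm_num

lemma l2Norm_sq (g : α → ℝ≥0∞) : l2Norm μ g ^ 2 = ∫⁻ x, g x ^ 2 ∂μ := rpow_half_sq _

lemma le_of_sq_le_sq {x y : ℝ≥0∞} (h : x ^ 2 ≤ y ^ 2) : x ≤ y := by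
  have := ENNReal.rpow_le_rpow h (by norm_num : (0 : ℝ) ≤ 1 / 2)
  rwa [sq_rpow_half, sq_rpow_half] at this

lemma l2Norm_le_iff {g : α → ℝ≥0∞} {b : ℝ≥0∞} :
    l2Norm μ g ≤ b ↔ ∫⁻ x, g x ^ 2 ∂μ ≤ b ^ 2 := by
  rw [← l2Norm_sq]
  exact ⟨fun h => by gcongr, le_of_sq_le_sq⟩

lemma l2Norm_mono {f g : α → ℝ≥0∞} (h : ∀ x, f x ≤ g x) : l2Norm μ f ≤ l2Norm μ g := by
  unfold l2Norm
  gcongr with x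
  exact h x

@[simp] lemma l2Norm_zero : l2Norm μ (fun _ => 0) = 0 := by simp [l2Norm]

lemma l2Norm_const_mul (c : ℝ≥0∞) {f : α → ℝ≥0∞} (hf : Measurable f) :
    l2Norm μ (fun x => c * f x) = c * l2Norm μ f := by
  unfold l2Norm
  simp_rw [mul_pow]
  rw [lintegral_const_mul _ (by fun_prop), ENNReal.mul_rpow_of_nonneg _ _ (by norm_num),
    sq_rpow_half]

lemma l2Norm_add_le {f g : α → ℝ≥0∞} (hf : Measurable f) (hg : Measurable g) :
    l2Norm μ (fun x => f x + g x) ≤ l2Norm μ f + l2Norm μ g := by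
  have := ENNReal.lintegral_Lp_add_le (μ := μ) (p := 2) hf.aemeasurable hg.aemeasurable
    (by norm_num)
  simpa [l2Norm] using this

lemma l2Norm_finsetSum_le {ι : Type*} (s : Finset ι) {f : ι → α → ℝ≥0∞}
    (hf : ∀ i, Measurable (f i)) :
    l2Norm μ (fun x => ∑ i ∈ s, f i x) ≤ ∑ i ∈ s, l2Norm μ (f i) := by
  classical
  induction s using Finset.induction_on with
  | empty => simp
  | insert i s hi ih =>
    simp_rw [Finset.sum_insert hi]
    refine (l2Norm_add_le (hf i) (by fun_prop)).trans ?_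
    gcongr

/-- Minkowski's inequality for countable sums. -/
lemma l2Norm_tsum_le {ι : Type*} [Countable ι] {f : ι → α → ℝ≥0∞} (hf : ∀ i, Measurable (f i)) :
    l2Norm μ (fun x => ∑' i, f i x) ≤ ∑' i, l2Norm μ (f i) := by
  classical
  rw [l2Norm_le_iff]
  have h1 : ∀ x, (∑' i, f i x) ^ 2 = ⨆ s : Finset ι, (∑ i ∈ s, f i x) ^ 2 := by
    intro x
    rw [ENNReal.tsum_eq_iSup_sum, ENNReal.iSup_pow_of_ne_zero two_ne_zero]
  simp_rw [h1]
  rw [lintegral_iSup_directed_of_measurable (fun s => by fun_prop)]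
  · refine iSup_le fun s => ?_
    rw [← l2Norm_le_iff]
    exact (l2Norm_finsetSum_le s hf).trans (ENNReal.sum_le_tsum s)
  · intro s t
    refine ⟨s ∪ t, fun x => ?_, fun x => ?_⟩
    · exact pow_le_pow_left' (Finset.sum_le_sum_of_subset Finset.subset_union_left) 2
    · exact pow_le_pow_left' (Finset.sum_le_sum_of_subset Finset.subset_union_right) 2

lemma lintegral_mul_le_l2Norm {f g : α → ℝ≥0∞} (hf : Measurable f) (hg : Measurable g) :
    ∫⁻ x, f x * g x ∂μ ≤ l2Norm μ f * l2Norm μ g := by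
  have := ENNReal.lintegral_mul_le_Lp_mul_Lq μ Real.HolderConjugate.two_two hf.aemeasurable
    hg.aemeasurable
  simpa [l2Norm] using this

/-- The Cauchy-Schwarz inequality on a set of finite measure. -/
lemma lintegral_le_measure_mul_l2Norm {f : α → ℝ≥0∞} (hf : Measurable f) {s : Set α}
    (hs : MeasurableSet s) (h : ∀ x, x ∉ s → f x = 0) :
    ∫⁻ x, f x ∂μ ≤ μ s ^ (1 / 2 : ℝ) * l2Norm μ f := by
  have h1 : ∀ x, f x = s.indicator (fun _ => 1) x * f x := by
    intro x
    by_cases hx : x ∈ s <;> simp [hx, h]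
  calc ∫⁻ x, f x ∂μ = ∫⁻ x, s.indicator (fun _ => 1) x * f x ∂μ := by simp_rw [← h1]
    _ ≤ l2Norm μ (s.indicator (fun _ => 1)) * l2Norm μ f :=
        lintegral_mul_le_l2Norm (measurable_const.indicator hs) hf
    _ = _ := by
        congr 1
        unfold l2Norm
        have : ∀ x, (s.indicator (fun _ => (1 : ℝ≥0∞)) x) ^ 2 = s.indicator (fun _ => 1) x := by
          intro x
          by_cases hx : x ∈ s <;> simp [hx]
        simp_rw [this]
        rw [lintegral_indicator hs]; simp

lemma l2Norm_le_measure_mul {f : α → ℝ≥0∞} {s : Set α} (hs : MeasurableSet s) {b : ℝ≥0∞}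
    (h : ∀ x, x ∉ s → f x = 0) (hb : ∀ x, f x ≤ b) :
    l2Norm μ f ≤ μ s ^ (1 / 2 : ℝ) * b := by
  rw [l2Norm_le_iff, mul_pow, rpow_half_sq]
  calc ∫⁻ x, f x ^ 2 ∂μ ≤ ∫⁻ x, s.indicator (fun _ => b ^ 2) x ∂μ := by
        refine lintegral_mono fun x => ?_
        by_cases hx : x ∈ s
        · simp only [hx, Set.indicator_of_mem]; gcongr; exact hb x
        · simp [hx, h]
    _ = _ := by rw [lintegral_indicator hs]; simp [mul_comm]

end L2

section Convolution

set_option linter.unusedSectionVars false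

variable {G : Type*} [AddCommGroup G] [MeasurableSpace G] [MeasurableAdd₂ G] [MeasurableNeg G]
  {μ : Measure G} [SFinite μ] [μ.IsAddLeftInvariant] [μ.IsNegInvariant]

/-- Young's inequality `‖f ∗ g‖₂ ≤ ‖f‖₁ ‖g‖₂`. -/
lemma l2Norm_conv_le {f g : G → ℝ≥0∞} (hf : Measurable f) (hg : Measurable g) :
    l2Norm μ (fun x => ∫⁻ y, f y * g (x - y) ∂μ) ≤ (∫⁻ y, f y ∂μ) * l2Norm μ g := by
  have hm : Measurable (fun p : G × G => g (p.1 - p.2)) :=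
    hg.comp (measurable_fst.sub measurable_snd)
  rw [l2Norm_le_iff]
  have key : ∀ x, (∫⁻ y, f y * g (x - y) ∂μ) ^ 2
      ≤ (∫⁻ y, f y ∂μ) * ∫⁻ y, f y * g (x - y) ^ 2 ∂μ := by
    intro x
    have hgx : Measurable (fun y => g (x - y)) := hg.comp (measurable_const.sub measurable_id)
    -- Cauchy-Schwarz for the measure `f dμ`
    have h1 : ∀ y, f y * g (x - y)
        = f y ^ (1 / 2 : ℝ) * (f y ^ (1 / 2 : ℝ) * g (x - y)) := by
      intro y
      rw [← mul_assoc, ← sq, rpow_half_sq]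
    calc (∫⁻ y, f y * g (x - y) ∂μ) ^ 2
        = (∫⁻ y, f y ^ (1 / 2 : ℝ) * (f y ^ (1 / 2 : ℝ) * g (x - y)) ∂μ) ^ 2 := by
          simp_rw [← h1]
      _ ≤ (l2Norm μ (fun y => f y ^ (1 / 2 : ℝ))
            * l2Norm μ (fun y => f y ^ (1 / 2 : ℝ) * g (x - y))) ^ 2 := by
          gcongr
          exact lintegral_mul_le_l2Norm (by fun_prop) (by fun_prop)
      _ = _ := by
          rw [mul_pow, l2Norm_sq, l2Norm_sq]
          simp_rw [mul_pow, rpow_half_sq]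
  calc ∫⁻ x, (∫⁻ y, f y * g (x - y) ∂μ) ^ 2 ∂μ
      ≤ ∫⁻ x, (∫⁻ y, f y ∂μ) * ∫⁻ y, f y * g (x - y) ^ 2 ∂μ ∂μ := lintegral_mono key
    _ = (∫⁻ y, f y ∂μ) * ∫⁻ x, ∫⁻ y, f y * g (x - y) ^ 2 ∂μ ∂μ :=
        lintegral_const_mul _ (Measurable.lintegral_prod_right' (f := fun p : G × G =>
          f p.2 * g (p.1 - p.2) ^ 2) (by fun_prop))
    _ = (∫⁻ y, f y ∂μ) * ∫⁻ y, ∫⁻ x, f y * g (x - y) ^ 2 ∂μ ∂μ := by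
        rw [lintegral_lintegral_swap]
        exact Measurable.aemeasurable (by fun_prop)
    _ = (∫⁻ y, f y ∂μ) * ∫⁻ y, f y * l2Norm μ g ^ 2 ∂μ := by
        congr 1
        refine lintegral_congr fun y => ?_
        rw [lintegral_const_mul _ (by fun_prop), l2Norm_sq]
        congr 1
        exact lintegral_sub_right_eq_self (fun x => g x ^ 2) y
    _ = ((∫⁻ y, f y ∂μ) * l2Norm μ g) ^ 2 := by
        rw [lintegral_mul_const _ hf]; ring

lemma conv_le_l2Norm {f g : G → ℝ≥0∞} (hf : Measurable f) (hg : Measurable g) (x : G) :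
    ∫⁻ y, f y * g (x - y) ∂μ ≤ l2Norm μ f * l2Norm μ g := by
  have hgx : Measurable (fun y => g (x - y)) := hg.comp (measurable_const.sub measurable_id)
  refine (lintegral_mul_le_l2Norm hf hgx).trans_eq ?_
  unfold l2Norm
  rw [lintegral_sub_left_eq_self (μ := μ) (fun y => g y ^ 2) x]

lemma conv_le_lintegral_mul {f g : G → ℝ≥0∞} {b : ℝ≥0∞} (hf : Measurable f)
    (hb : ∀ y, g y ≤ b) (x : G) : ∫⁻ y, f y * g (x - y) ∂μ ≤ (∫⁻ y, f y ∂μ) * b := by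
  rw [← lintegral_mul_const _ hf]
  gcongr
  exact hb _

lemma lintegral_conv {f g : G → ℝ≥0∞} (hf : Measurable f) (hg : Measurable g) :
    ∫⁻ x, ∫⁻ y, f y * g (x - y) ∂μ ∂μ = (∫⁻ y, f y ∂μ) * ∫⁻ y, g y ∂μ := by
  have hm : Measurable (fun p : G × G => g (p.1 - p.2)) :=
    hg.comp (measurable_fst.sub measurable_snd)
  rw [lintegral_lintegral_swap (Measurable.aemeasurable (by fun_prop)),
    ← lintegral_mul_const _ hf]
  refine lintegral_congr fun y => ?_
  have hgx : Measurable (fun x => g (x - y)) := hg.comp (measurable_id.sub measurable_const)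
  rw [lintegral_const_mul _ hgx]
  congr 1
  exact lintegral_sub_right_eq_self g y

lemma conv_comm (f g : G → ℝ≥0∞) (x : G) :
    ∫⁻ y, f y * g (x - y) ∂μ = ∫⁻ y, g y * f (x - y) ∂μ := by
  rw [← lintegral_sub_left_eq_self (fun y => f y * g (x - y)) x]
  refine lintegral_congr fun y => ?_
  rw [sub_sub_cancel, mul_comm]

end Convolution

section Blocks

lemma l2Norm_count {ι : Type*} [MeasurableSpace ι] [MeasurableSingletonClass ι] (p : ι → ℝ≥0∞) :
    l2Norm count p = (∑' ξ, p ξ ^ 2) ^ (1 / 2 : ℝ) := by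
  rw [l2Norm, lintegral_count]

lemma le_l2Norm_count {ι : Type*} [MeasurableSpace ι] [MeasurableSingletonClass ι] (p : ι → ℝ≥0∞)
    (ξ : ι) : p ξ ≤ l2Norm count p := by
  refine le_of_sq_le_sq ?_
  rw [l2Norm_sq, lintegral_count]
  exact ENNReal.le_tsum (f := fun ξ => p ξ ^ 2) ξ

lemma freqBlock_subset_Icc (k : ℕ) :
    freqBlock k ⊆ Finset.Icc (-2 ^ (k + 1) : ℤ) (2 ^ (k + 1)) := by
  intro ξ hξ
  cases k with
  | zero => simp only [freqBlock, Set.mem_singleton_iff] at hξ; simp [hξ]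
  | succ k =>
    simp only [freqBlock, Set.mem_ofPred_eq] at hξ
    simpa [abs_le] using hξ.2

lemma finite_freqBlock (k : ℕ) : (freqBlock k).Finite :=
  (Finset.finite_toSet _).subset (freqBlock_subset_Icc k)

lemma count_freqBlock_le (k : ℕ) : count (freqBlock k) ≤ 2 ^ (k + 3) := by
  refine (measure_mono (freqBlock_subset_Icc k)).trans ?_
  rw [count_apply_finset, Int.card_Icc]
  have : ((2 ^ (k + 1) + 1 - -2 ^ (k + 1) : ℤ)).toNat ≤ 2 ^ (k + 3) := by
    have h : (1 : ℤ) ≤ 2 ^ k := one_le_pow₀ (by norm_num)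
    rw [Int.toNat_le]
    push_cast
    rw [pow_succ, pow_add]
    linarith
  exact_mod_cast this

lemma conv_count_le_l2Norm (p q : ℤ → ℝ≥0∞) (ξ : ℤ) :
    ∑' ξ₁, p ξ₁ * q (ξ - ξ₁) ≤ l2Norm count p * l2Norm count q := by
  have := conv_le_l2Norm (μ := count) (measurable_of_countable p) (measurable_of_countable q) ξ
  rwa [lintegral_count] at this

/-- The convolution of two sequences supported in frequency blocks, restricted to a third block,
costs the square root of the size of the smallest of the three blocks. -/
lemma l2Norm_conv_block_le {k k₁ k₂ : ℕ} {p q : ℤ → ℝ≥0∞} (hp : ∀ ξ, ξ ∉ freqBlock k₁ → p ξ = 0)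
    (hq : ∀ ξ, ξ ∉ freqBlock k₂ → q ξ = 0) :
    l2Norm count ((freqBlock k).indicator fun ξ => ∑' ξ₁, p ξ₁ * q (ξ - ξ₁))
      ≤ (2 ^ (min k (min k₁ k₂) + 3)) ^ (1 / 2 : ℝ) * (l2Norm count p * l2Norm count q) := by
  have hp' := measurable_of_countable p
  have hq' := measurable_of_countable q
  have hind : ∀ ξ, (freqBlock k).indicator (fun ξ => ∑' ξ₁, p ξ₁ * q (ξ - ξ₁)) ξ
      ≤ ∑' ξ₁, p ξ₁ * q (ξ - ξ₁) := fun ξ => Set.indicator_le_self _ _ ξ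
  -- Young's inequality with the smaller input in `ℓ¹`, or Cauchy-Schwarz when the output is smallest
  rcases min_choice k (min k₁ k₂) with h | h
  · rw [h]
    refine (l2Norm_le_measure_mul (MeasurableSet.of_discrete (s := freqBlock k))
      (b := l2Norm count p * l2Norm count q) (fun ξ hξ => by simp [hξ])
      (fun ξ => (hind ξ).trans (conv_count_le_l2Norm p q ξ))).trans ?_
    gcongr
    exact count_freqBlock_le k
  rw [h]
  refine (l2Norm_mono hind).trans ?_
  rcases min_choice k₁ k₂ with h | h
  · rw [h]
    have h1 := l2Norm_conv_le (μ := count) hp' hq'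
    simp only [lintegral_count] at h1
    refine h1.trans ?_
    rw [← mul_assoc]
    gcongr
    have h2 := lintegral_le_measure_mul_l2Norm (μ := count) hp'
      (MeasurableSet.of_discrete (s := freqBlock k₁)) hp
    rw [lintegral_count] at h2
    exact h2.trans (by gcongr; exact count_freqBlock_le k₁)
  · rw [h]
    have h1 := l2Norm_conv_le (μ := count) hq' hp'
    simp only [lintegral_count] at h1
    have h3 : ∀ ξ, ∑' ξ₁, p ξ₁ * q (ξ - ξ₁) = ∑' ξ₁, q ξ₁ * p (ξ - ξ₁) := by
      intro ξ
      simpa only [lintegral_count] using conv_comm (μ := count) p q ξ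
    simp_rw [h3]
    refine h1.trans ?_
    rw [mul_comm (l2Norm count p), ← mul_assoc]
    gcongr
    have h2 := lintegral_le_measure_mul_l2Norm (μ := count) hq'
      (MeasurableSet.of_discrete (s := freqBlock k₂)) hq
    rw [lintegral_count] at h2
    exact h2.trans (by gcongr; exact count_freqBlock_le k₂)

end Blocks

/-! ### The Fourier transform in time -/

/-- The Fourier transform in time `∫ e^{-itτ} g(t) dt`. -/
noncomputable def timeFourier (g : ℝ → ℂ) (τ : ℝ) : ℂ :=
  ∫ t : ℝ, Complex.exp (-(Complex.I * (t : ℂ) * (τ : ℂ))) * g t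

open scoped FourierTransform in
lemma timeFourier_eq (g : ℝ → ℂ) (τ : ℝ) : timeFourier g τ = 𝓕 g (τ / (2 * Real.pi)) := by
  rw [Real.fourier_real_eq_integral_exp_smul, timeFourier]
  refine integral_congr_ae (Filter.Eventually.of_forall fun t => ?_)
  simp only [smul_eq_mul]
  congr 2
  push_cast
  field_simp

lemma norm_cexp_neg_I_mul (t τ : ℝ) :
    ‖Complex.exp (-(Complex.I * (t : ℂ) * (τ : ℂ)))‖ = 1 := by
  rw [Complex.norm_exp]; simp

lemma enorm_cexp_neg_I_mul (t τ : ℝ) :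
    ‖Complex.exp (-(Complex.I * (t : ℂ) * (τ : ℂ)))‖ₑ = 1 := by
  rw [← ofReal_norm, norm_cexp_neg_I_mul, ENNReal.ofReal_one]

lemma norm_cexp_I_mul (t τ : ℝ) : ‖Complex.exp (Complex.I * (t : ℂ) * (τ : ℂ))‖ = 1 := by
  rw [Complex.norm_exp]; simp

lemma integrable_cexp_mul {g : ℝ → ℂ} (hg : Integrable g) (τ : ℝ) :
    Integrable fun t : ℝ => Complex.exp (-(Complex.I * (t : ℂ) * (τ : ℂ))) * g t := by
  refine hg.bdd_mul (c := 1) (Continuous.aestronglyMeasurable (by fun_prop)) ?_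
  exact Filter.Eventually.of_forall fun t => (norm_cexp_neg_I_mul t τ).le

lemma continuous_timeFourier {g : ℝ → ℂ} (hg : Integrable g) : Continuous (timeFourier g) := by
  refine continuous_of_dominated (bound := fun t => ‖g t‖) ?_ ?_ hg.norm ?_
  · exact fun τ => (integrable_cexp_mul hg τ).aestronglyMeasurable
  · intro τ
    filter_upwards with t
    rw [norm_mul, norm_cexp_neg_I_mul, one_mul]
  · filter_upwards with t
    fun_prop

open scoped FourierTransform in
lemma timeFourier_inversion {g : ℝ → ℂ} (hc : Continuous g) (hg : Integrable g)
    (hg' : Integrable (timeFourier g)) (t : ℝ) :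
    g t = (1 / (2 * Real.pi) : ℂ) *
      ∫ τ : ℝ, Complex.exp (Complex.I * (t : ℂ) * (τ : ℂ)) * timeFourier g τ := by
  have hpi : (2 * Real.pi) ≠ 0 := by positivity
  have h1 : 𝓕 g = fun ξ => timeFourier g (ξ * (2 * Real.pi)) := by
    funext ξ
    rw [timeFourier_eq, mul_div_cancel_right₀ _ hpi]
  have h2 : Integrable (𝓕 g) := by
    rw [h1]; exact hg'.comp_mul_right' hpi
  have h3 := congrFun (hc.fourierInv_fourier_eq hg h2) t
  rw [Real.fourierInv_eq'] at h3
  rw [← h3, h1]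
  have h4 := Measure.integral_comp_mul_right (fun τ : ℝ =>
    Complex.exp (Complex.I * (t : ℂ) * (τ : ℂ)) * timeFourier g τ) (2 * Real.pi)
  rw [abs_of_pos (by positivity), Complex.real_smul] at h4
  calc _ = ∫ x : ℝ, Complex.exp (Complex.I * (t : ℂ) * ((x * (2 * Real.pi) : ℝ) : ℂ)) *
        timeFourier g (x * (2 * Real.pi)) := by
        refine integral_congr_ae (Filter.Eventually.of_forall fun x => ?_)
        simp only [smul_eq_mul, RCLike.inner_apply, conj_trivial]
        congr 2
        push_cast
        ring
    _ = _ := by rw [h4]; push_cast; rw [one_div]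

lemma enorm_inv_two_pi_le_one : ‖(1 / (2 * Real.pi) : ℂ)‖ₑ ≤ 1 := by
  rw [← ofReal_norm, ENNReal.ofReal_le_one]
  simp only [norm_div, norm_one, norm_mul, Complex.norm_ofNat, Complex.norm_real]
  rw [Real.norm_of_nonneg Real.pi_pos.le, div_le_one (by positivity)]
  linarith [Real.pi_gt_three]

/-- The inversion formula bounds a function by the `L¹` norm of its Fourier transform. -/
lemma enorm_le_lintegral_timeFourier {g : ℝ → ℂ} (hc : Continuous g) (hg : Integrable g) (t : ℝ) :
    ‖g t‖ₑ ≤ ∫⁻ τ, ‖timeFourier g τ‖ₑ := by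
  by_cases hfin : ∫⁻ τ, ‖timeFourier g τ‖ₑ = ⊤
  · rw [hfin]; exact le_top
  have hg' : Integrable (timeFourier g) :=
    ⟨(continuous_timeFourier hg).aestronglyMeasurable, lt_top_iff_ne_top.2 hfin⟩
  rw [timeFourier_inversion hc hg hg' t, enorm_mul]
  calc _ ≤ 1 * ∫⁻ τ : ℝ, ‖Complex.exp (Complex.I * (t : ℂ) * (τ : ℂ)) * timeFourier g τ‖ₑ := by
        gcongr
        · exact enorm_inv_two_pi_le_one
        exact enorm_integral_le_lintegral_enorm _
    _ = _ := by
        rw [one_mul]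
        refine lintegral_congr fun τ => ?_
        rw [enorm_mul, ← ofReal_norm, norm_cexp_I_mul]
        simp

/-- The Fourier transform of a product is dominated by the convolution of the transforms. -/
lemma enorm_timeFourier_mul_le {b g : ℝ → ℂ} (hbc : Continuous b) (hb : Integrable b)
    (hb' : Integrable (timeFourier b)) (hg : Integrable g) (τ : ℝ) :
    ‖timeFourier (fun t => b t * g t) τ‖ₑ
      ≤ ∫⁻ σ, ‖timeFourier b σ‖ₑ * ‖timeFourier g (τ - σ)‖ₑ := by
  have hexp : ∀ t σ : ℝ, Complex.exp (-(Complex.I * (t : ℂ) * (τ : ℂ))) *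
      Complex.exp (Complex.I * (t : ℂ) * (σ : ℂ))
      = Complex.exp (-(Complex.I * (t : ℂ) * ((τ - σ : ℝ) : ℂ))) := by
    intro t σ
    rw [← Complex.exp_add]
    congr 1
    push_cast
    ring
  have hint : Integrable (Function.uncurry fun t σ : ℝ =>
      timeFourier b σ * (Complex.exp (-(Complex.I * (t : ℂ) * ((τ - σ : ℝ) : ℂ))) * g t))
      (volume.prod volume) := by
    have h1 : Integrable (fun p : ℝ × ℝ => g p.1 * timeFourier b p.2) (volume.prod volume) :=
      hg.mul_prod hb'
    have h2 := h1.bdd_mul (c := 1) (f := fun p : ℝ × ℝ =>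
      Complex.exp (-(Complex.I * (p.1 : ℂ) * ((τ - p.2 : ℝ) : ℂ))))
      (Continuous.aestronglyMeasurable (by fun_prop))
      (Filter.Eventually.of_forall fun p => (norm_cexp_neg_I_mul _ _).le)
    refine h2.congr (Filter.Eventually.of_forall fun p => ?_)
    simp only [Function.uncurry]
    ring
  -- expand `b` by the inversion formula and exchange the two integrals
  have h1 : timeFourier (fun t => b t * g t) τ
      = (1 / (2 * Real.pi) : ℂ) * ∫ σ : ℝ, timeFourier b σ * timeFourier g (τ - σ) := by
    have step : ∀ t : ℝ, Complex.exp (-(Complex.I * (t : ℂ) * (τ : ℂ))) * (b t * g t)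
        = (1 / (2 * Real.pi) : ℂ) * ∫ σ : ℝ, timeFourier b σ *
          (Complex.exp (-(Complex.I * (t : ℂ) * ((τ - σ : ℝ) : ℂ))) * g t) := by
      intro t
      conv_lhs => rw [timeFourier_inversion hbc hb hb' t]
      rw [mul_comm, mul_assoc, mul_assoc, ← integral_mul_const]
      congr 1
      refine integral_congr_ae (Filter.Eventually.of_forall fun σ => ?_)
      simp only
      rw [← hexp]
      ring
    rw [timeFourier]
    simp_rw [step]
    rw [integral_const_mul, integral_integral_swap hint]
    simp_rw [integral_const_mul]
    rfl
  rw [h1, enorm_mul]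
  calc _ ≤ 1 * ∫⁻ σ : ℝ, ‖timeFourier b σ * timeFourier g (τ - σ)‖ₑ := by
        gcongr
        · exact enorm_inv_two_pi_le_one
        exact enorm_integral_le_lintegral_enorm _
    _ = _ := by simp_rw [one_mul, enorm_mul]

/-! ### Bump functions and their kernels -/

/-- The Poisson-type kernel `K Λ⁻¹ (1 + (τ/Λ)²)⁻¹` dominating the Fourier transform of a bump
function at time scale `Λ⁻¹`. -/
noncomputable def bumpKernel (K Λ τ : ℝ) : ℝ := K * (Λ⁻¹ * (1 + (τ / Λ) ^ 2)⁻¹)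

/-- A continuous compactly supported function whose Fourier transform decays quadratically beyond
the frequency `Λ`, with `L¹` norm `O(K)`. -/
structure IsBump (K Λ : ℝ) (b : ℝ → ℂ) : Prop where
  continuous : Continuous b
  compact : HasCompactSupport b
  decay : ∀ τ, ‖timeFourier b τ‖ ≤ bumpKernel K Λ τ

lemma integrable_bumpKernel (K : ℝ) {Λ : ℝ} (hΛ : 0 < Λ) : Integrable (bumpKernel K Λ) :=
  ((integrable_inv_one_add_sq.comp_div hΛ.ne').const_mul Λ⁻¹).const_mul K

lemma measurable_bumpKernel (K Λ : ℝ) : Measurable (bumpKernel K Λ) := by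
  unfold bumpKernel; fun_prop

lemma bumpKernel_nonneg {K Λ : ℝ} (hK : 0 ≤ K) (hΛ : 0 < Λ) (τ : ℝ) : 0 ≤ bumpKernel K Λ τ := by
  unfold bumpKernel; positivity

lemma bumpKernel_le {K Λ : ℝ} (hK : 0 ≤ K) (hΛ : 0 < Λ) (τ : ℝ) :
    bumpKernel K Λ τ ≤ K / Λ := by
  unfold bumpKernel
  rw [div_eq_mul_inv K Λ]
  have : (1 + (τ / Λ) ^ 2)⁻¹ ≤ 1 := inv_le_one_of_one_le₀ (by nlinarith [sq_nonneg (τ / Λ)])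
  gcongr
  exact mul_le_of_le_one_right (by positivity) this

lemma bumpKernel_le_div_abs {K Λ : ℝ} (hK : 0 ≤ K) (hΛ : 0 < Λ) {τ : ℝ} (hτ : τ ≠ 0) :
    bumpKernel K Λ τ ≤ K / (2 * |τ|) := by
  have h : Λ⁻¹ * (1 + (τ / Λ) ^ 2)⁻¹ ≤ (2 * |τ|)⁻¹ := by
    rw [← mul_inv]
    have hτ' : 0 < |τ| := abs_pos.2 hτ
    apply inv_anti₀ (by positivity)
    have : Λ * (1 + (τ / Λ) ^ 2) = Λ + |τ| ^ 2 / Λ := by rw [sq_abs]; field_simp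
    rw [this]
    -- the inequality between arithmetic and geometric means, `2 |τ| ≤ Λ + |τ|² / Λ`
    have h2 : Λ + |τ| ^ 2 / Λ - 2 * |τ| = (Λ - |τ|) ^ 2 / Λ := by field_simp; ring
    have : 0 ≤ (Λ - |τ|) ^ 2 / Λ := by positivity
    linarith
  unfold bumpKernel
  rw [div_eq_mul_inv K]
  gcongr

lemma lintegral_bumpKernel {K Λ : ℝ} (hK : 0 ≤ K) (hΛ : 0 < Λ) :
    ∫⁻ τ, ENNReal.ofReal (bumpKernel K Λ τ) = ENNReal.ofReal (K * Real.pi) := by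
  rw [← ofReal_integral_eq_lintegral_ofReal (integrable_bumpKernel K hΛ)
    (Filter.Eventually.of_forall (bumpKernel_nonneg hK hΛ))]
  congr 1
  unfold bumpKernel
  rw [integral_const_mul, integral_const_mul,
    Measure.integral_comp_div (fun x : ℝ => (1 + x ^ 2)⁻¹) Λ, integral_univ_inv_one_add_sq,
    abs_of_pos hΛ, smul_eq_mul]
  field_simp

/-- The part of the kernel at distance at least `r` from the origin has `L²` norm
`O(r^{-1/2})`, uniformly in the scale `Λ`. -/
lemma l2Norm_bumpKernel_tail_le {K Λ r : ℝ} (hK : 0 ≤ K) (hΛ : 0 < Λ) (hr : 0 < r) :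
    l2Norm volume ({σ | r ≤ |σ|}.indicator fun σ => ENNReal.ofReal (bumpKernel K Λ σ))
      ≤ ENNReal.ofReal (K * r ^ (-(1 / 2) : ℝ)) := by
  have hms : MeasurableSet {σ : ℝ | r ≤ |σ|} := measurableSet_le (by fun_prop) (by fun_prop)
  rw [l2Norm_le_iff, ← ENNReal.ofReal_pow (by positivity)]
  have hI : IntegrableOn (fun x : ℝ => x ^ (-2 : ℝ)) (Set.Ioi r) :=
    integrableOn_Ioi_rpow_of_lt (by norm_num) hr
  have hval : ∫⁻ x in Set.Ici r, ENNReal.ofReal (x ^ (-2 : ℝ)) = ENNReal.ofReal (r⁻¹) := by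
    rw [setLIntegral_congr Ioi_ae_eq_Ici.symm,
      ← ofReal_integral_eq_lintegral_ofReal hI ?_, integral_Ioi_rpow_of_lt (by norm_num) hr]
    · congr 1; norm_num [Real.rpow_neg_one]
    · filter_upwards [ae_restrict_mem measurableSet_Ioi] with x hx
      exact Real.rpow_nonneg (hr.le.trans (le_of_lt hx)) _
  -- the kernel is at most `K / (2 |σ|)`, whatever the scale; the two half-lines are treated alike
  have hpt : ∀ σ : ℝ, ({σ | r ≤ |σ|}.indicator
      (fun σ => ENNReal.ofReal (bumpKernel K Λ σ)) σ) ^ 2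
      ≤ ENNReal.ofReal (K ^ 2 / 4) * ((Set.Ici r).indicator
          (fun x => ENNReal.ofReal (x ^ (-2 : ℝ))) σ
        + (Set.Ici r).indicator (fun x => ENNReal.ofReal (x ^ (-2 : ℝ))) (-σ)) := by
    intro σ
    by_cases hσ : r ≤ |σ|
    · have hσ0 : σ ≠ 0 := by rintro rfl; simp at hσ; linarith
      have h1 : ENNReal.ofReal (bumpKernel K Λ σ) ^ 2
          ≤ ENNReal.ofReal (K ^ 2 / 4) * ENNReal.ofReal (|σ| ^ (-2 : ℝ)) := by
        rw [← ENNReal.ofReal_pow (bumpKernel_nonneg hK hΛ σ), ← ENNReal.ofReal_mul (by positivity)]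
        apply ENNReal.ofReal_le_ofReal
        calc bumpKernel K Λ σ ^ 2 ≤ (K / (2 * |σ|)) ^ 2 :=
              pow_le_pow_left₀ (bumpKernel_nonneg hK hΛ σ) (bumpKernel_le_div_abs hK hΛ hσ0) 2
          _ = _ := by
              rw [Real.rpow_neg (abs_nonneg _)]
              norm_cast
              field_simp
              norm_num
      rw [Set.indicator_of_mem (by exact hσ)]
      refine h1.trans ?_
      gcongr
      rcases abs_cases σ with ⟨h, h'⟩ | ⟨h, h'⟩
      · rw [h] at hσ ⊢
        rw [Set.indicator_of_mem (by exact hσ)]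
        exact le_self_add
      · rw [h] at hσ ⊢
        rw [Set.indicator_of_mem (a := -σ) (by exact hσ)]
        exact le_add_self
    · rw [Set.indicator_of_notMem (by exact hσ)]
      simp
  have hmi : Measurable ((Set.Ici r).indicator
      (fun x : ℝ => ENNReal.ofReal (x ^ (-2 : ℝ)))) :=
    Measurable.indicator (by fun_prop) measurableSet_Ici
  refine (lintegral_mono hpt).trans ?_
  rw [lintegral_const_mul _ (by fun_prop), lintegral_add_left hmi,
    lintegral_neg_eq_self (fun x => (Set.Ici r).indicator
      (fun x : ℝ => ENNReal.ofReal (x ^ (-2 : ℝ))) x),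
    lintegral_indicator measurableSet_Ici, hval, ← ENNReal.ofReal_add (by positivity)
    (by positivity), ← ENNReal.ofReal_mul (by positivity)]
  apply ENNReal.ofReal_le_ofReal
  have : (r ^ (-(1 / 2) : ℝ)) ^ 2 = r⁻¹ := by
    rw [← Real.rpow_natCast, ← Real.rpow_mul hr.le]
    norm_num [Real.rpow_neg_one]
  rw [mul_pow, this]
  have : 0 ≤ K ^ 2 * r⁻¹ := by positivity
  nlinarith

lemma IsBump.integrable {K Λ : ℝ} {b : ℝ → ℂ} (hb : IsBump K Λ b) : Integrable b :=
  hb.continuous.integrable_of_hasCompactSupport hb.compact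

lemma IsBump.integrable_timeFourier {K Λ : ℝ} {b : ℝ → ℂ} (hb : IsBump K Λ b) (hΛ : 0 < Λ) :
    Integrable (timeFourier b) :=
  (integrable_bumpKernel K hΛ).mono' (continuous_timeFourier hb.integrable).aestronglyMeasurable
    (Filter.Eventually.of_forall hb.decay)

/-- Multiplication by a bump function smears the Fourier transform by its kernel. -/
lemma IsBump.enorm_timeFourier_mul_le {K Λ : ℝ} {b g : ℝ → ℂ} (hb : IsBump K Λ b) (hΛ : 0 < Λ)
    (hg : Integrable g) (τ : ℝ) :
    ‖timeFourier (fun t => g t * b t) τ‖ₑ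
      ≤ ∫⁻ σ, ENNReal.ofReal (bumpKernel K Λ σ) * ‖timeFourier g (τ - σ)‖ₑ := by
  simp_rw [mul_comm (g _)]
  refine (ShortTimeBO.enorm_timeFourier_mul_le hb.continuous hb.integrable
    (hb.integrable_timeFourier hΛ) hg τ).trans (lintegral_mono fun σ => ?_)
  gcongr
  rw [← ofReal_norm]
  exact ENNReal.ofReal_le_ofReal (hb.decay σ)

/-- Smooth compactly supported functions are bumps at unit scale. -/
lemma exists_isBump {b : ℝ → ℂ} (hb : ContDiff ℝ ∞ b) (hs : HasCompactSupport b) :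
    ∃ K : ℝ, 0 ≤ K ∧ IsBump K 1 b := by
  set F := FourierTransform.fourier (hs.toSchwartzMap hb) with hF
  -- the Schwartz seminorms of orders `0` and `2` bound the two terms of `1 + τ²`
  obtain ⟨C0, hC0, h0⟩ := F.decay 0 0
  obtain ⟨C2, hC2, h2⟩ := F.decay 2 0
  refine ⟨C0 + C2 * (2 * Real.pi) ^ 2, by positivity, hb.continuous, hs, fun τ => ?_⟩
  have hval : timeFourier b τ = F (τ / (2 * Real.pi)) := by
    rw [timeFourier_eq, hF, SchwartzMap.fourier_coe]; rfl
  rw [hval]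
  have e0 := h0 (τ / (2 * Real.pi))
  have e2 := h2 (τ / (2 * Real.pi))
  simp only [pow_zero, one_mul, norm_iteratedFDeriv_zero] at e0 e2
  unfold bumpKernel
  rw [inv_one, one_mul, div_one, ← div_eq_mul_inv, le_div_iff₀ (by positivity)]
  rw [norm_div, Real.norm_of_nonneg (by positivity : 0 ≤ 2 * Real.pi), div_pow, Real.norm_eq_abs,
    sq_abs, div_mul_eq_mul_div, div_le_iff₀ (by positivity)] at e2
  nlinarith

lemma timeFourier_comp_affine (b : ℝ → ℂ) {Λ : ℝ} (hΛ : 0 < Λ) (t₀ τ : ℝ) :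
    timeFourier (fun t => b (Λ * (t - t₀))) τ
      = Complex.exp (-(Complex.I * (t₀ : ℂ) * (τ : ℂ))) * ((Λ⁻¹ : ℝ) * timeFourier b (τ / Λ)) := by
  unfold timeFourier
  have h1 := integral_sub_right_eq_self (μ := volume) (fun s : ℝ =>
    Complex.exp (-(Complex.I * ((s + t₀ : ℝ) : ℂ) * (τ : ℂ))) * b (Λ * s)) t₀
  simp only [sub_add_cancel] at h1
  rw [h1]
  have h2 := Measure.integral_comp_mul_left (fun r : ℝ =>
    Complex.exp (-(Complex.I * ((r / Λ + t₀ : ℝ) : ℂ) * (τ : ℂ))) * b r) Λ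
  simp only [mul_div_cancel_left₀ _ hΛ.ne'] at h2
  rw [h2, abs_of_pos (by positivity), Complex.real_smul, mul_left_comm]
  congr 1
  rw [← integral_const_mul]
  refine integral_congr_ae (Filter.Eventually.of_forall fun r => ?_)
  simp only
  rw [← mul_assoc, ← Complex.exp_add]
  congr 2
  push_cast
  have : (Λ : ℂ) ≠ 0 := by exact_mod_cast hΛ.ne'
  field_simp
  ring

lemma IsBump.comp_affine {K : ℝ} {b : ℝ → ℂ} (hb : IsBump K 1 b) {Λ : ℝ} (hΛ : 0 < Λ) (t₀ : ℝ) :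
    IsBump K Λ (fun t => b (Λ * (t - t₀))) where
  continuous := hb.continuous.comp (by fun_prop)
  compact := by
    have h := (hb.compact.comp_homeomorph (Homeomorph.mulLeft₀ Λ hΛ.ne')).comp_homeomorph
      (Homeomorph.subRight t₀)
    exact h
  decay τ := by
    rw [timeFourier_comp_affine b hΛ, norm_mul, norm_cexp_neg_I_mul, one_mul, norm_mul,
      Complex.norm_real, Real.norm_of_nonneg (by positivity)]
    have := hb.decay (τ / Λ)
    simp only [bumpKernel, inv_one, div_one, one_mul] at this ⊢
    calc Λ⁻¹ * ‖timeFourier b (τ / Λ)‖ ≤ Λ⁻¹ * (K * (1 + (τ / Λ) ^ 2)⁻¹) := by gcongr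
      _ = _ := by ring

/-! ### Modulation bounds -/

/-- The `ℓ²_ξ L²_τ` norm. -/
noncomputable def mixedNorm (f : ℤ → ℝ → ℝ≥0∞) : ℝ≥0∞ :=
  l2Norm count fun ξ => l2Norm volume (f ξ)

/-- The part of `f` with modulation `|τ - φ_a(ξ)|` at least `R`. -/
noncomputable def highMod (a R : ℝ) (f : ℤ → ℝ → ℝ≥0∞) (ξ : ℤ) : ℝ → ℝ≥0∞ :=
  {τ | R ≤ |τ - dispersion a ξ|}.indicator (f ξ)

/-- The information about the modulus `f` of a space-time Fourier transform that the bilinear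
estimate uses: the `ℓ²_ξ L¹_τ` norm, and the decay of the part with large modulation. It is weaker
than the Besov-type norm of `X_{a,k}` and is plainly stable under smearing in `τ`. -/
structure ModBound (a : ℝ) (A : ℝ≥0∞) (f : ℤ → ℝ → ℝ≥0∞) : Prop where
  measurable : ∀ ξ, Measurable (f ξ)
  l1 : l2Norm count (fun ξ => ∫⁻ τ, f ξ τ) ≤ A
  high : ∀ R : ℝ, 0 < R → mixedNorm (highMod a R f) ≤ ENNReal.ofReal (R ^ (-(1 / 2) : ℝ)) * A

lemma measurableSet_modulation (R b : ℝ) : MeasurableSet {τ : ℝ | R ≤ |τ - b|} :=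
  measurableSet_le (by fun_prop) (by fun_prop)

lemma measurable_highMod {a R : ℝ} {f : ℤ → ℝ → ℝ≥0∞} {ξ : ℤ} (hf : Measurable (f ξ)) :
    Measurable (highMod a R f ξ) := hf.indicator (measurableSet_modulation _ _)

lemma highMod_le (a R : ℝ) (f : ℤ → ℝ → ℝ≥0∞) (ξ : ℤ) (τ : ℝ) : highMod a R f ξ τ ≤ f ξ τ :=
  Set.indicator_le_self _ _ τ

lemma mixedNorm_mono {f g : ℤ → ℝ → ℝ≥0∞} (h : ∀ ξ τ, f ξ τ ≤ g ξ τ) :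
    mixedNorm f ≤ mixedNorm g := l2Norm_mono fun ξ => l2Norm_mono (h ξ)

lemma mixedNorm_const_mul (c : ℝ≥0∞) {f : ℤ → ℝ → ℝ≥0∞} (hf : ∀ ξ, Measurable (f ξ)) :
    mixedNorm (fun ξ τ => c * f ξ τ) = c * mixedNorm f := by
  unfold mixedNorm
  simp_rw [fun ξ => l2Norm_const_mul (μ := volume) c (hf ξ)]
  exact l2Norm_const_mul c (measurable_of_countable _)

lemma mixedNorm_add_le {f g : ℤ → ℝ → ℝ≥0∞} (hf : ∀ ξ, Measurable (f ξ))
    (hg : ∀ ξ, Measurable (g ξ)) :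
    mixedNorm (fun ξ τ => f ξ τ + g ξ τ) ≤ mixedNorm f + mixedNorm g :=
  (l2Norm_mono fun ξ => l2Norm_add_le (hf ξ) (hg ξ)).trans
    (l2Norm_add_le (measurable_of_countable _) (measurable_of_countable _))

lemma mixedNorm_tsum_le {ι : Type*} [Countable ι] {f : ι → ℤ → ℝ → ℝ≥0∞}
    (hf : ∀ i ξ, Measurable (f i ξ)) :
    mixedNorm (fun ξ τ => ∑' i, f i ξ τ) ≤ ∑' i, mixedNorm (f i) :=
  (l2Norm_mono fun ξ => l2Norm_tsum_le fun i => hf i ξ).trans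
    (l2Norm_tsum_le fun _ => measurable_of_countable _)

lemma ofReal_rpow_half {x : ℝ} (hx : 0 ≤ x) :
    ENNReal.ofReal x ^ (1 / 2 : ℝ) = ENNReal.ofReal (x ^ (1 / 2 : ℝ)) :=
  ENNReal.ofReal_rpow_of_nonneg hx (by norm_num)

lemma rpow_mul_self_half {x : ℝ} (hx : 0 < x) :
    x ^ (1 / 2 : ℝ) * x⁻¹ = x ^ (-(1 / 2) : ℝ) := by
  rw [← Real.rpow_neg_one x, ← Real.rpow_add hx]; norm_num

lemma half_rpow_neg_half_le {R : ℝ} (hR : 0 < R) :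
    (R / 2) ^ (-(1 / 2) : ℝ) ≤ 3 / 2 * R ^ (-(1 / 2) : ℝ) := by
  rw [Real.div_rpow hR.le (by norm_num), div_eq_mul_inv, mul_comm]
  gcongr
  rw [Real.rpow_neg (by norm_num), inv_inv, ← Real.sqrt_eq_rpow, Real.sqrt_le_left (by norm_num)]
  norm_num

section Smearing

variable {a K Λ : ℝ} {A : ℝ≥0∞} {f₀ f : ℤ → ℝ → ℝ≥0∞}

lemma measurable_ofReal_bumpKernel (K Λ : ℝ) :
    Measurable fun σ => ENNReal.ofReal (bumpKernel K Λ σ) :=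
  (measurable_bumpKernel K Λ).ennreal_ofReal

/-- Modulation bounds are stable under convolution with a bump kernel, uniformly in its scale:
large modulation of the output comes from large modulation of the input or from the tail of the
kernel. -/
lemma ModBound.smear (h : ModBound a A f₀) (hK : 0 ≤ K) (hΛ : 0 < Λ)
    (hf : ∀ ξ, Measurable (f ξ))
    (hle : ∀ ξ τ, f ξ τ ≤ ∫⁻ σ, ENNReal.ofReal (bumpKernel K Λ σ) * f₀ ξ (τ - σ)) :
    ModBound a (ENNReal.ofReal (8 * K) * A) f where
  measurable := hf
  l1 := by
    have hk := measurable_ofReal_bumpKernel K Λ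
    have h1 : ∀ ξ, ∫⁻ τ, f ξ τ ≤ ENNReal.ofReal (K * Real.pi) * ∫⁻ τ, f₀ ξ τ := by
      intro ξ
      refine (lintegral_mono (hle ξ)).trans_eq ?_
      rw [lintegral_conv hk (h.measurable ξ), lintegral_bumpKernel hK hΛ]
    refine (l2Norm_mono h1).trans ?_
    rw [l2Norm_const_mul _ (measurable_of_countable _)]
    refine mul_le_mul' (ENNReal.ofReal_le_ofReal ?_) h.l1
    nlinarith [Real.pi_le_four]
  high := by
    intro R hR
    have hk := measurable_ofReal_bumpKernel K Λ
    have hms : MeasurableSet {σ : ℝ | R / 2 ≤ |σ|} :=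
      measurableSet_le (by fun_prop) (by fun_prop)
    set κ : ℝ → ℝ≥0∞ := fun σ => ENNReal.ofReal (bumpKernel K Λ σ)
    set κ' : ℝ → ℝ≥0∞ := {σ : ℝ | R / 2 ≤ |σ|}.indicator κ with hκ'
    have hk' : Measurable κ' := hk.indicator hms
    have hh : ∀ ξ, Measurable (highMod a (R / 2) f₀ ξ) := fun ξ =>
      measurable_highMod (h.measurable ξ)
    -- if `|τ - φ| ≥ R` then either `|σ| ≥ R / 2`, or `τ - σ` has modulation at least `R / 2`
    have hpt : ∀ ξ τ, highMod a R f ξ τ ≤ (∫⁻ σ, κ σ * highMod a (R / 2) f₀ ξ (τ - σ))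
        + ∫⁻ σ, f₀ ξ σ * κ' (τ - σ) := by
      intro ξ τ
      by_cases hτ : R ≤ |τ - dispersion a ξ|
      swap
      · rw [highMod, Set.indicator_of_notMem (by exact hτ)]; exact zero_le
      refine (highMod_le _ _ _ _ _).trans ((hle ξ τ).trans ?_)
      rw [conv_comm (f₀ ξ) κ' τ, ← lintegral_add_left]
      swap
      · exact hk.mul ((hh ξ).comp (measurable_const.sub measurable_id))
      refine lintegral_mono fun σ => ?_
      by_cases hσ : R / 2 ≤ |σ|
      · have : κ' σ = κ σ := Set.indicator_of_mem (by exact hσ) _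
        rw [this]; exact le_add_self
      · have hmem : τ - σ ∈ {τ | R / 2 ≤ |τ - dispersion a ξ|} := by
          simp only [Set.mem_ofPred_eq]
          push Not at hσ
          have h3 := abs_sub_abs_le_abs_sub (τ - dispersion a ξ) σ
          have h4 : τ - dispersion a ξ - σ = τ - σ - dispersion a ξ := by ring
          rw [h4] at h3
          linarith
        rw [highMod, Set.indicator_of_mem hmem]
        exact le_self_add
    have m1 : ∀ ξ, Measurable fun τ => ∫⁻ σ, κ σ * highMod a (R / 2) f₀ ξ (τ - σ) := fun ξ =>
      Measurable.lintegral_prod_right' (f := fun p : ℝ × ℝ =>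
        κ p.2 * highMod a (R / 2) f₀ ξ (p.1 - p.2))
        ((hk.comp measurable_snd).mul ((hh ξ).comp (measurable_fst.sub measurable_snd)))
    have m2 : ∀ ξ, Measurable fun τ => ∫⁻ σ, f₀ ξ σ * κ' (τ - σ) := fun ξ =>
      Measurable.lintegral_prod_right' (f := fun p : ℝ × ℝ => f₀ ξ p.2 * κ' (p.1 - p.2))
        (((h.measurable ξ).comp measurable_snd).mul
          (hk'.comp (measurable_fst.sub measurable_snd)))
    refine (mixedNorm_mono hpt).trans ((mixedNorm_add_le m1 m2).trans ?_)
    -- Young with the kernel in `L¹` and the high-modulation part in `L²`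
    have b1 : mixedNorm (fun ξ τ => ∫⁻ σ, κ σ * highMod a (R / 2) f₀ ξ (τ - σ))
        ≤ ENNReal.ofReal (6 * K * R ^ (-(1 / 2) : ℝ)) * A := by
      calc _ ≤ l2Norm count (fun ξ => ENNReal.ofReal (K * Real.pi)
            * l2Norm volume (highMod a (R / 2) f₀ ξ)) := by
            refine l2Norm_mono fun ξ => ?_
            rw [← lintegral_bumpKernel hK hΛ]
            exact l2Norm_conv_le hk (hh ξ)
        _ = ENNReal.ofReal (K * Real.pi) * mixedNorm (highMod a (R / 2) f₀) :=
            l2Norm_const_mul _ (measurable_of_countable _)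
        _ ≤ ENNReal.ofReal (K * Real.pi) * (ENNReal.ofReal ((R / 2) ^ (-(1 / 2) : ℝ)) * A) := by
            gcongr; exact h.high _ (by positivity)
        _ ≤ _ := by
            rw [← mul_assoc, ← ENNReal.ofReal_mul (by positivity)]
            refine mul_le_mul' (ENNReal.ofReal_le_ofReal ?_) le_rfl
            have h6 : (0 : ℝ) ≤ R ^ (-(1 / 2) : ℝ) := by positivity
            calc K * Real.pi * (R / 2) ^ (-(1 / 2) : ℝ)
                ≤ K * 4 * (3 / 2 * R ^ (-(1 / 2) : ℝ)) := by
                  gcongr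
                  · exact Real.pi_le_four
                  · exact half_rpow_neg_half_le hR
              _ = _ := by ring
    -- Young with `f₀` in `L¹` and the tail of the kernel in `L²`
    have b2 : mixedNorm (fun ξ τ => ∫⁻ σ, f₀ ξ σ * κ' (τ - σ))
        ≤ ENNReal.ofReal (2 * K * R ^ (-(1 / 2) : ℝ)) * A := by
      calc _ ≤ l2Norm count (fun ξ => l2Norm volume κ' * ∫⁻ σ, f₀ ξ σ) := by
            refine l2Norm_mono fun ξ => ?_
            rw [mul_comm]
            exact l2Norm_conv_le (h.measurable ξ) hk'
        _ = l2Norm volume κ' * l2Norm count (fun ξ => ∫⁻ σ, f₀ ξ σ) :=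
            l2Norm_const_mul _ (measurable_of_countable _)
        _ ≤ ENNReal.ofReal (K * (R / 2) ^ (-(1 / 2) : ℝ)) * A := by
            gcongr
            · exact l2Norm_bumpKernel_tail_le hK hΛ (by positivity)
            · exact h.l1
        _ ≤ _ := by
            refine mul_le_mul' (ENNReal.ofReal_le_ofReal ?_) le_rfl
            have h6 : (0 : ℝ) ≤ R ^ (-(1 / 2) : ℝ) := by positivity
            calc K * (R / 2) ^ (-(1 / 2) : ℝ) ≤ K * (3 / 2 * R ^ (-(1 / 2) : ℝ)) := by
                  gcongr; exact half_rpow_neg_half_le hR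
              _ ≤ 2 * K * R ^ (-(1 / 2) : ℝ) := by nlinarith [mul_nonneg hK h6]
    refine (add_le_add b1 b2).trans_eq ?_
    rw [← add_mul, ← ENNReal.ofReal_add (by positivity) (by positivity), ← mul_assoc,
      ← ENNReal.ofReal_mul (by positivity)]
    congr 2; ring

/-- Localization in time to a window of length `Λ⁻¹` gains `Λ^{-1/2}` in `ℓ² L²`. -/
lemma ModBound.mixedNorm_smear_le (h : ModBound a A f₀) (hK : 0 ≤ K) (hΛ : 0 < Λ)
    (hf : ∀ ξ, Measurable (f ξ))
    (hle : ∀ ξ τ, f ξ τ ≤ ∫⁻ σ, ENNReal.ofReal (bumpKernel K Λ σ) * f₀ ξ (τ - σ)) :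
    mixedNorm f ≤ ENNReal.ofReal (10 * K * Λ ^ (-(1 / 2) : ℝ)) * A := by
  have hs := h.smear hK hΛ hf hle
  -- split at modulation `Λ`: the high part is covered by the modulation bound
  set S : ℤ → Set ℝ := fun ξ => {τ | Λ ≤ |τ - dispersion a ξ|}
  have hS : ∀ ξ, MeasurableSet (S ξ) := fun ξ => measurableSet_modulation _ _
  have hsplit : ∀ ξ τ, f ξ τ ≤ highMod a Λ f ξ τ + (S ξ)ᶜ.indicator (f ξ) τ := by
    intro ξ τ
    rw [highMod, Set.indicator_self_add_compl_apply]
  refine (mixedNorm_mono hsplit).trans ((mixedNorm_add_le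
    (fun ξ => measurable_highMod (hf ξ)) (fun ξ => (hf ξ).indicator (hS ξ).compl)).trans ?_)
  -- the low part lives on an interval of length `2Λ`, where it is bounded by `K Λ⁻¹ ‖f₀‖₁`
  have b2 : mixedNorm (fun ξ => (S ξ)ᶜ.indicator (f ξ))
      ≤ ENNReal.ofReal (2 * K * Λ ^ (-(1 / 2) : ℝ)) * A := by
    have hpt : ∀ ξ τ, f ξ τ ≤ ENNReal.ofReal (K / Λ) * ∫⁻ τ, f₀ ξ τ := by
      intro ξ τ
      refine (hle ξ τ).trans ?_
      rw [conv_comm, mul_comm]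
      exact conv_le_lintegral_mul (h.measurable ξ)
        (fun y => ENNReal.ofReal_le_ofReal (bumpKernel_le hK hΛ y)) τ
    have hvol : ∀ ξ, volume (S ξ)ᶜ ≤ ENNReal.ofReal (2 * Λ) := by
      intro ξ
      have : (S ξ)ᶜ = Metric.ball (dispersion a ξ) Λ := by
        ext τ; simp [S, Real.dist_eq]
      rw [this, Real.volume_ball]
    calc _ ≤ l2Norm count (fun ξ => ENNReal.ofReal (2 * Λ) ^ (1 / 2 : ℝ)
          * ENNReal.ofReal (K / Λ) * ∫⁻ τ, f₀ ξ τ) := by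
          refine l2Norm_mono fun ξ => ?_
          rw [mul_assoc]
          refine (l2Norm_le_measure_mul (hS ξ).compl (b := ENNReal.ofReal (K / Λ) * ∫⁻ τ, f₀ ξ τ)
            (fun τ hτ => Set.indicator_of_notMem hτ _)
            (fun τ => (Set.indicator_le_self _ _ τ).trans (hpt ξ τ))).trans ?_
          gcongr
          exact hvol ξ
      _ = ENNReal.ofReal (2 * Λ) ^ (1 / 2 : ℝ) * ENNReal.ofReal (K / Λ)
            * l2Norm count (fun ξ => ∫⁻ τ, f₀ ξ τ) :=
          l2Norm_const_mul _ (measurable_of_countable _)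
      _ ≤ _ := by
          rw [ofReal_rpow_half (by positivity), ← ENNReal.ofReal_mul (by positivity)]
          refine mul_le_mul' (ENNReal.ofReal_le_ofReal ?_) h.l1
          · have h2 : (2 : ℝ) ^ (1 / 2 : ℝ) ≤ 2 := by
              rw [← Real.sqrt_eq_rpow, Real.sqrt_le_left (by norm_num)]; norm_num
            have h3 := rpow_mul_self_half hΛ
            rw [Real.mul_rpow (by norm_num) hΛ.le, div_eq_mul_inv K, ← h3]
            have : 0 ≤ K * (Λ ^ (1 / 2 : ℝ) * Λ⁻¹) := by positivity
            nlinarith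
  refine (add_le_add (hs.high Λ hΛ) b2).trans_eq ?_
  rw [← mul_assoc, ← ENNReal.ofReal_mul (by positivity), ← add_mul,
    ← ENNReal.ofReal_add (by positivity) (by positivity)]
  congr 2; ring

end Smearing

/-! ### The Besov-type modulation norm -/

/-- The dyadic modulation piece `|η_j(τ - φ_a(ξ))| f(τ,ξ)`. -/
noncomputable def modPiece (η₀ : ℝ → ℝ) (a : ℝ) (j : ℕ) (f : ℤ → ℝ → ℝ≥0∞) (ξ : ℤ) (τ : ℝ) :
    ℝ≥0∞ :=
  ‖(modCutoff η₀ j (τ - dispersion a ξ) : ℂ)‖ₑ * f ξ τ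

/-- The norm of `X_{a,k}` as a functional of the modulus of its argument. -/
noncomputable def modNorm (η₀ : ℝ → ℝ) (a : ℝ) (f : ℤ → ℝ → ℝ≥0∞) : ℝ≥0∞ :=
  ∑' j : ℕ, (2 : ℝ≥0∞) ^ ((j : ℝ) / 2) * mixedNorm (modPiece η₀ a j f)

lemma xNorm_eq_modNorm (η₀ : ℝ → ℝ) (a : ℝ) (g : ℝ → ℤ → ℂ) :
    xNorm η₀ a g = modNorm η₀ a fun ξ τ => ‖g τ ξ‖ₑ := by
  unfold xNorm modNorm mixedNorm
  refine tsum_congr fun j => ?_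
  rw [l2Norm_count]
  simp_rw [l2Norm_sq, modPiece, enorm_mul]

lemma modNorm_mono {η₀ : ℝ → ℝ} {a : ℝ} {f g : ℤ → ℝ → ℝ≥0∞} (h : ∀ ξ τ, f ξ τ ≤ g ξ τ) :
    modNorm η₀ a f ≤ modNorm η₀ a g := by
  unfold modNorm
  gcongr with j
  refine mixedNorm_mono fun ξ τ => ?_
  unfold modPiece
  gcongr
  exact h ξ τ

lemma rpow_two_half (j : ℕ) :
    (2 : ℝ≥0∞) ^ ((j : ℝ) / 2) = ENNReal.ofReal (((2 : ℝ) ^ j) ^ (1 / 2 : ℝ)) := by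
  rw [← Real.rpow_natCast, ← Real.rpow_mul (by norm_num), mul_one_div,
    ← ENNReal.ofReal_rpow_of_pos (by norm_num), ENNReal.ofReal_ofNat]

lemma volume_modulation_ball (j : ℕ) (b : ℝ) :
    volume (Metric.closedBall b (5 / 4 * 2 ^ j)) ^ (1 / 2 : ℝ)
      ≤ 2 * (2 : ℝ≥0∞) ^ ((j : ℝ) / 2) := by
  have h4 : (2 * (2 : ℝ≥0∞) ^ ((j : ℝ) / 2)) = ENNReal.ofReal (4 * 2 ^ j) ^ (1 / 2 : ℝ) := by
    rw [ENNReal.ofReal_mul (by norm_num), ENNReal.mul_rpow_of_nonneg _ _ (by norm_num),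
      ENNReal.ofReal_pow (by norm_num), ENNReal.ofReal_ofNat, ENNReal.ofReal_ofNat,
      ← ENNReal.rpow_natCast, ← ENNReal.rpow_mul, mul_one_div]
    congr 1
    rw [show (4 : ℝ≥0∞) = 2 ^ 2 by norm_num, sq_rpow_half]
  rw [h4, Real.volume_closedBall]
  refine ENNReal.rpow_le_rpow (ENNReal.ofReal_le_ofReal ?_) (by norm_num)
  have : (0 : ℝ) < 2 ^ j := by positivity
  linarith

namespace IsModulationCutoff

variable {η₀ : ℝ → ℝ} (hη : IsModulationCutoff η₀)

include hη

lemma eq_zero {x : ℝ} (hx : 5 / 4 < |x|) : η₀ x = 0 := by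
  by_contra h
  have := hη.support_subset h
  rw [Set.mem_Icc, ← abs_le] at this
  linarith

lemma continuous : Continuous η₀ := hη.smooth.continuous

lemma continuous_modCutoff (j : ℕ) : Continuous (modCutoff η₀ j) := by
  have := hη.continuous
  cases j with
  | zero => exact this
  | succ j => unfold modCutoff; fun_prop

lemma modCutoff_eq_zero {j : ℕ} {x : ℝ} (hx : 5 / 4 * 2 ^ j < |x|) : modCutoff η₀ j x = 0 := by
  have key : ∀ i : ℕ, i ≤ j → η₀ (x / 2 ^ i) = 0 := by
    intro i hi
    apply hη.eq_zero
    rw [abs_div, abs_of_pos (by positivity : (0 : ℝ) < 2 ^ i), lt_div_iff₀ (by positivity)]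
    have : (2 : ℝ) ^ i ≤ 2 ^ j := pow_le_pow_right₀ (by norm_num) hi
    linarith
  cases j with
  | zero => simpa [modCutoff] using key 0 le_rfl
  | succ j => simp [modCutoff, key (j + 1) le_rfl, key j (Nat.le_succ j)]

lemma abs_modCutoff_le_one (j : ℕ) (x : ℝ) : |modCutoff η₀ j x| ≤ 1 := by
  have h := hη.mem_unit
  cases j with
  | zero => rw [modCutoff, abs_le]; constructor <;> linarith [(h x).1, (h x).2]
  | succ j =>
    rw [modCutoff, abs_le]
    constructor <;> linarith [(h (x / 2 ^ (j + 1))).1, (h (x / 2 ^ (j + 1))).2,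
      (h (x / 2 ^ j)).1, (h (x / 2 ^ j)).2]

/-- On the support of `η_j` the multiplier `(x + iL)⁻¹` is of size at most `2 · 2^{-j}`. -/
lemma abs_modCutoff_mul_inv_le {L : ℝ} (hL : 1 ≤ L) (j : ℕ) (x : ℝ) :
    ‖(modCutoff η₀ j x : ℂ)‖ * ‖((x : ℝ) + Complex.I * (L : ℂ))⁻¹‖ ≤ 2 * (2 ^ j)⁻¹ := by
  have h1 : ‖(modCutoff η₀ j x : ℂ)‖ ≤ 1 := by
    rw [Complex.norm_real]; exact hη.abs_modCutoff_le_one j x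
  have hre : |x| ≤ ‖(x : ℂ) + Complex.I * (L : ℂ)‖ := by
    simpa using Complex.abs_re_le_norm ((x : ℂ) + Complex.I * (L : ℂ))
  have him : L ≤ ‖(x : ℂ) + Complex.I * (L : ℂ)‖ := by
    have := Complex.abs_im_le_norm ((x : ℂ) + Complex.I * (L : ℂ))
    simp only [Complex.add_im, Complex.ofReal_im, Complex.mul_im, Complex.I_re, Complex.I_im,
      Complex.ofReal_re, zero_mul, one_mul, zero_add] at this
    exact (le_abs_self L).trans this
  rw [norm_inv]
  cases j with
  | zero =>
    have : ‖(x : ℂ) + Complex.I * (L : ℂ)‖⁻¹ ≤ 1 := inv_le_one_of_one_le₀ (hL.trans him)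
    have h0 : 0 ≤ ‖(x : ℂ) + Complex.I * (L : ℂ)‖⁻¹ := by positivity
    rw [pow_zero, inv_one, mul_one]
    nlinarith [norm_nonneg (modCutoff η₀ 0 x : ℂ)]
  | succ j =>
    -- for `j ≥ 1` the support of `η_j` avoids `|x| ≤ 2^{j-1}`
    by_cases hx : |x| ≤ 2 ^ j
    · have hz : modCutoff η₀ (j + 1) x = 0 := by
        rw [modCutoff, hη.eq_one, hη.eq_one, sub_self]
        · rw [abs_div, abs_of_pos (by positivity : (0 : ℝ) < 2 ^ j), div_le_one (by positivity)]
          exact hx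
        · rw [abs_div, abs_of_pos (by positivity : (0 : ℝ) < 2 ^ (j + 1)),
            div_le_one (by positivity)]
          exact hx.trans (pow_le_pow_right₀ (by norm_num) (Nat.le_succ j))
      rw [hz]; simp
    · push Not at hx
      have : ‖(x : ℂ) + Complex.I * (L : ℂ)‖⁻¹ ≤ 2 * (2 ^ (j + 1))⁻¹ := by
        rw [pow_succ, mul_inv, mul_comm ((2 : ℝ) ^ j)⁻¹, ← mul_assoc, mul_inv_cancel₀ two_ne_zero,
          one_mul]
        exact inv_anti₀ (by positivity) (hx.le.trans hre)
      calc _ ≤ 1 * ‖(x : ℂ) + Complex.I * (L : ℂ)‖⁻¹ := by gcongr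
        _ ≤ _ := by rw [one_mul]; exact this

lemma one_le_tsum_modCutoff (x : ℝ) : 1 ≤ ∑' j, ‖(modCutoff η₀ j x : ℂ)‖ₑ := by
  obtain ⟨J, hJ⟩ := pow_unbounded_of_one_lt |x| (one_lt_two (α := ℝ))
  have hsum : ∀ n : ℕ, ∑ j ∈ Finset.range (n + 1), modCutoff η₀ j x = η₀ (x / 2 ^ n) := by
    intro n
    induction n with
    | zero => simp [modCutoff]
    | succ n ih => rw [Finset.sum_range_succ, ih, modCutoff]; ring
  have h1 : η₀ (x / 2 ^ J) = 1 := by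
    apply hη.eq_one
    rw [abs_div, abs_of_pos (by positivity : (0 : ℝ) < 2 ^ J), div_le_one (by positivity)]
    exact hJ.le
  calc (1 : ℝ≥0∞) = ‖((∑ j ∈ Finset.range (J + 1), modCutoff η₀ j x : ℝ) : ℂ)‖ₑ := by
        rw [hsum, h1]; simp
    _ ≤ ∑ j ∈ Finset.range (J + 1), ‖(modCutoff η₀ j x : ℂ)‖ₑ := by
        rw [Complex.ofReal_sum]; exact enorm_sum_le _ _
    _ ≤ _ := ENNReal.sum_le_tsum _

variable {a : ℝ}

lemma measurable_modPiece (j : ℕ) {f : ℤ → ℝ → ℝ≥0∞} {ξ : ℤ} (hf : Measurable (f ξ)) :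
    Measurable (modPiece η₀ a j f ξ) := by
  have h := (hη.continuous_modCutoff j).measurable
  unfold modPiece
  exact Measurable.mul (by fun_prop) hf

lemma le_tsum_modPiece (f : ℤ → ℝ → ℝ≥0∞) (ξ : ℤ) (τ : ℝ) :
    f ξ τ ≤ ∑' j, modPiece η₀ a j f ξ τ := by
  unfold modPiece
  rw [ENNReal.tsum_mul_right]
  exact le_mul_of_one_le_left' (hη.one_le_tsum_modCutoff _)

lemma modNorm_tsum_le {ι : Type*} [Countable ι] {f : ι → ℤ → ℝ → ℝ≥0∞}
    (hf : ∀ i ξ, Measurable (f i ξ)) :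
    modNorm η₀ a (fun ξ τ => ∑' i, f i ξ τ) ≤ ∑' i, modNorm η₀ a (f i) := by
  unfold modNorm
  rw [ENNReal.tsum_comm]
  gcongr with j
  rw [ENNReal.tsum_mul_left]
  gcongr
  have : modPiece η₀ a j (fun ξ τ => ∑' i, f i ξ τ)
      = fun ξ τ => ∑' i, modPiece η₀ a j (f i) ξ τ := by
    funext ξ τ
    simp only [modPiece, ENNReal.tsum_mul_left]
  rw [this]
  exact mixedNorm_tsum_le fun i ξ => hη.measurable_modPiece j (hf i ξ)

lemma modNorm_add_le {f g : ℤ → ℝ → ℝ≥0∞} (hf : ∀ ξ, Measurable (f ξ))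
    (hg : ∀ ξ, Measurable (g ξ)) :
    modNorm η₀ a (fun ξ τ => f ξ τ + g ξ τ) ≤ modNorm η₀ a f + modNorm η₀ a g := by
  have := hη.modNorm_tsum_le (a := a) (f := fun b : Bool => if b then f else g)
    (by intro b; cases b <;> simpa)
  simpa [add_comm] using this

lemma modNorm_const_mul (c : ℝ≥0∞) {f : ℤ → ℝ → ℝ≥0∞} (hf : ∀ ξ, Measurable (f ξ)) :
    modNorm η₀ a (fun ξ τ => c * f ξ τ) = c * modNorm η₀ a f := by
  unfold modNorm
  rw [← ENNReal.tsum_mul_left]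
  refine tsum_congr fun j => ?_
  rw [mul_left_comm, ← mixedNorm_const_mul c fun ξ => hη.measurable_modPiece j (hf ξ)]
  congr 2
  funext ξ τ
  simp only [modPiece]; ring

lemma modPiece_support (j : ℕ) (f : ℤ → ℝ → ℝ≥0∞) (ξ : ℤ) (τ : ℝ)
    (hτ : τ ∉ Metric.closedBall (dispersion a ξ) (5 / 4 * 2 ^ j)) :
    modPiece η₀ a j f ξ τ = 0 := by
  rw [modPiece, hη.modCutoff_eq_zero, Complex.ofReal_zero, enorm_zero, zero_mul]
  rw [Metric.mem_closedBall, Real.dist_eq, not_le] at hτ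
  exact hτ

/-- The norm of `X_{a,k}` controls the modulation bounds: a piece of modulation `2^j` lives on
intervals of length `O(2^j)`, so that its `ℓ² L¹` norm is at most `O(2^{j/2})` times its `ℓ² L²`
norm. -/
lemma modBound_modNorm {f : ℤ → ℝ → ℝ≥0∞} (hf : ∀ ξ, Measurable (f ξ)) :
    ModBound a (2 * modNorm η₀ a f) f where
  measurable := hf
  l1 := by
    have hm := fun j ξ => hη.measurable_modPiece (a := a) j (hf ξ)
    calc l2Norm count (fun ξ => ∫⁻ τ, f ξ τ)
        ≤ l2Norm count (fun ξ => ∑' j, ∫⁻ τ, modPiece η₀ a j f ξ τ) := by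
          refine l2Norm_mono fun ξ => ?_
          rw [← lintegral_tsum fun j => (hm j ξ).aemeasurable]
          exact lintegral_mono fun τ => hη.le_tsum_modPiece f ξ τ
      _ ≤ ∑' j, l2Norm count (fun ξ => ∫⁻ τ, modPiece η₀ a j f ξ τ) :=
          l2Norm_tsum_le fun _ => measurable_of_countable _
      _ ≤ ∑' j : ℕ, 2 * ((2 : ℝ≥0∞) ^ ((j : ℝ) / 2) * mixedNorm (modPiece η₀ a j f)) := by
          gcongr with j
          rw [mixedNorm, ← mul_assoc, ← l2Norm_const_mul _ (measurable_of_countable _)]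
          refine l2Norm_mono fun ξ => ?_
          refine (lintegral_le_measure_mul_l2Norm (hm j ξ) Metric.isClosed_closedBall.measurableSet
            (hη.modPiece_support j f ξ)).trans ?_
          gcongr
          exact volume_modulation_ball j _
      _ = _ := by rw [ENNReal.tsum_mul_left]; rfl
  high := by
    intro R hR
    have hm := fun j ξ => hη.measurable_modPiece (a := a) j (hf ξ)
    calc mixedNorm (highMod a R f)
        ≤ mixedNorm (fun ξ τ => ∑' j, highMod a R (modPiece η₀ a j f) ξ τ) := by
          refine mixedNorm_mono fun ξ τ => ?_
          by_cases hτ : τ ∈ {τ | R ≤ |τ - dispersion a ξ|}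
          · simp only [highMod, Set.indicator_of_mem hτ]
            exact hη.le_tsum_modPiece f ξ τ
          · simp [highMod, Set.indicator_of_notMem hτ]
      _ ≤ ∑' j, mixedNorm (highMod a R (modPiece η₀ a j f)) :=
          mixedNorm_tsum_le fun j ξ => measurable_highMod (hm j ξ)
      _ ≤ ∑' j : ℕ, (ENNReal.ofReal (R ^ (-(1 / 2) : ℝ)) * 2)
            * ((2 : ℝ≥0∞) ^ ((j : ℝ) / 2) * mixedNorm (modPiece η₀ a j f)) := by
          gcongr with j
          -- only pieces with `2^j` at least of order `R` contribute, and for these `R^{-1/2} 2^{j/2}`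
          -- is bounded from below
          by_cases hj : R ≤ 5 / 4 * 2 ^ j
          · refine (mixedNorm_mono (highMod_le a R _)).trans ?_
            rw [← mul_assoc]
            refine le_mul_of_one_le_left' ?_
            rw [rpow_two_half, ← ENNReal.ofReal_ofNat, ← ENNReal.ofReal_mul (by positivity),
              ← ENNReal.ofReal_mul (by positivity), ENNReal.one_le_ofReal]
            have h2 : R ^ (1 / 2 : ℝ) ≤ 2 * (2 ^ j : ℝ) ^ (1 / 2 : ℝ) := by
              calc R ^ (1 / 2 : ℝ) ≤ (4 * 2 ^ j) ^ (1 / 2 : ℝ) := by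
                    gcongr
                    have : (0 : ℝ) < 2 ^ j := by positivity
                    linarith
                _ = _ := by
                    rw [Real.mul_rpow (by norm_num) (by positivity)]
                    congr 1
                    rw [← Real.sqrt_eq_rpow, show (4 : ℝ) = 2 ^ 2 by norm_num,
                      Real.sqrt_sq (by norm_num)]
            rw [Real.rpow_neg hR.le, mul_assoc, ← div_eq_inv_mul, le_div_iff₀ (by positivity),
              one_mul]
            exact h2
          · have : highMod a R (modPiece η₀ a j f) = fun _ _ => 0 := by
              funext ξ τ
              by_cases hτ : τ ∈ {τ | R ≤ |τ - dispersion a ξ|}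
              · rw [highMod, Set.indicator_of_mem hτ]
                apply hη.modPiece_support
                rw [Metric.mem_closedBall, Real.dist_eq, not_le]
                exact (not_le.1 hj).trans_le hτ
              · rw [highMod, Set.indicator_of_notMem hτ]
            rw [this]
            simp [mixedNorm]
      _ = _ := by rw [ENNReal.tsum_mul_left, modNorm, mul_assoc]

end IsModulationCutoff

/-! ### The norm with the resolvent weight -/

/-- The norm `‖(τ - φ_a(ξ) + iL)⁻¹ f‖` of `N_{a,k}` type, for the modulus `f` of a space-time
Fourier transform. -/
noncomputable def resolventNorm (η₀ : ℝ → ℝ) (a L : ℝ) (f : ℤ → ℝ → ℝ≥0∞) : ℝ≥0∞ :=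
  modNorm η₀ a fun ξ τ =>
    ‖(((τ - dispersion a ξ : ℝ) : ℂ) + Complex.I * (L : ℂ))⁻¹‖ₑ * f ξ τ

/-- The sum `∑_{j ≥ 0} 2^{-jε}`. -/
noncomputable def geomConst (ε : ℝ) : ℝ := (1 - (2 : ℝ) ^ (-ε))⁻¹

lemma two_rpow_neg_lt_one {ε : ℝ} (hε : 0 < ε) : (2 : ℝ) ^ (-ε) < 1 :=
  Real.rpow_lt_one_of_one_lt_of_neg (by norm_num) (by linarith)

lemma geomConst_pos {ε : ℝ} (hε : 0 < ε) : 0 < geomConst ε :=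
  inv_pos.2 (by linarith [two_rpow_neg_lt_one hε])

lemma tsum_geom {ε : ℝ} (hε : 0 < ε) :
    ∑' j : ℕ, ENNReal.ofReal (((2 : ℝ) ^ j) ^ (-ε)) = ENNReal.ofReal (geomConst ε) := by
  have h1 : ∀ j : ℕ, ((2 : ℝ) ^ j) ^ (-ε) = ((2 : ℝ) ^ (-ε)) ^ j := by
    intro j
    rw [← Real.rpow_natCast, ← Real.rpow_natCast, ← Real.rpow_mul (by norm_num),
      ← Real.rpow_mul (by norm_num), mul_comm]
  have h0 : (0 : ℝ) ≤ (2 : ℝ) ^ (-ε) := by positivity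
  simp_rw [h1]
  rw [← ENNReal.ofReal_tsum_of_nonneg (fun j => by positivity)
    (summable_geometric_of_lt_one h0 (two_rpow_neg_lt_one hε)),
    tsum_geometric_of_lt_one h0 (two_rpow_neg_lt_one hε), geomConst]

/-- The tail of the geometric series with ratio `2^{-1/2}`. -/
lemma tsum_geom_tail_le {R : ℝ} (hR : 0 < R) :
    ∑' j : ℕ, (if R ≤ 5 / 4 * 2 ^ j then ENNReal.ofReal (((2 : ℝ) ^ j) ^ (-(1 / 2) : ℝ)) else 0)
      ≤ ENNReal.ofReal (2 * geomConst (1 / 2) * R ^ (-(1 / 2) : ℝ)) := by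
  classical
  have hex : ∃ j : ℕ, R ≤ 5 / 4 * 2 ^ j := by
    obtain ⟨j, hj⟩ := pow_unbounded_of_one_lt R (one_lt_two (α := ℝ))
    exact ⟨j, by linarith [pow_pos (two_pos (α := ℝ)) j]⟩
  set J := Nat.find hex
  have hJ : R ≤ 5 / 4 * 2 ^ J := Nat.find_spec hex
  have hlt : ∀ j < J, ¬ R ≤ 5 / 4 * 2 ^ j := fun j hj => Nat.find_min hex hj
  have hsum := (ENNReal.summable (f := fun j : ℕ =>
    if R ≤ 5 / 4 * 2 ^ (j + J) then ENNReal.ofReal (((2 : ℝ) ^ (j + J)) ^ (-(1 / 2) : ℝ))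
    else 0)).sum_add_tsum_nat_add' (f := fun j : ℕ =>
    if R ≤ 5 / 4 * 2 ^ j then ENNReal.ofReal (((2 : ℝ) ^ j) ^ (-(1 / 2) : ℝ)) else 0)
  rw [← hsum, Finset.sum_eq_zero fun j hj => if_neg (hlt j (Finset.mem_range.1 hj)), zero_add]
  have hfac : ((2 : ℝ) ^ J) ^ (-(1 / 2) : ℝ) ≤ 2 * R ^ (-(1 / 2) : ℝ) := by
    calc ((2 : ℝ) ^ J) ^ (-(1 / 2) : ℝ) ≤ (R / 2) ^ (-(1 / 2) : ℝ) := by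
          apply Real.rpow_le_rpow_of_nonpos (by positivity) _ (by norm_num)
          have : (0 : ℝ) < 2 ^ J := by positivity
          linarith
      _ ≤ 3 / 2 * R ^ (-(1 / 2) : ℝ) := half_rpow_neg_half_le hR
      _ ≤ _ := by gcongr; norm_num
  calc _ ≤ ∑' j : ℕ, ENNReal.ofReal (2 * R ^ (-(1 / 2) : ℝ))
        * ENNReal.ofReal (((2 : ℝ) ^ j) ^ (-(1 / 2) : ℝ)) := by
        gcongr with j
        split_ifs
        · rw [← ENNReal.ofReal_mul (by positivity)]
          apply ENNReal.ofReal_le_ofReal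
          rw [pow_add, Real.mul_rpow (by positivity) (by positivity), mul_comm]
          gcongr
        · exact zero_le
    _ = _ := by
        rw [ENNReal.tsum_mul_left, tsum_geom (by norm_num), ← ENNReal.ofReal_mul (by positivity)]
        congr 1; ring

lemma two_pow_half_mul (j : ℕ) :
    ((2 : ℝ) ^ j) ^ (1 / 2 : ℝ) * (2 * (2 ^ j)⁻¹) = 2 * ((2 : ℝ) ^ j) ^ (-(1 / 2) : ℝ) := by
  rw [mul_left_comm, rpow_mul_self_half (by positivity)]

lemma measurable_resolvent {a L : ℝ} {f : ℤ → ℝ → ℝ≥0∞} {ξ : ℤ} (hf : Measurable (f ξ)) :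
    Measurable fun τ : ℝ =>
      ‖(((τ - dispersion a ξ : ℝ) : ℂ) + Complex.I * (L : ℂ))⁻¹‖ₑ * f ξ τ := by
  fun_prop

lemma resolventNorm_mono {η₀ : ℝ → ℝ} {a L : ℝ} {f g : ℤ → ℝ → ℝ≥0∞} (h : ∀ ξ τ, f ξ τ ≤ g ξ τ) :
    resolventNorm η₀ a L f ≤ resolventNorm η₀ a L g :=
  modNorm_mono fun ξ τ => mul_le_mul' le_rfl (h ξ τ)

namespace IsModulationCutoff

variable {η₀ : ℝ → ℝ} (hη : IsModulationCutoff η₀) {a L : ℝ}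

include hη

lemma modPiece_resolvent_le (hL : 1 ≤ L) (j : ℕ) (f : ℤ → ℝ → ℝ≥0∞) (ξ : ℤ) (τ : ℝ) :
    modPiece η₀ a j (fun ξ τ =>
      ‖(((τ - dispersion a ξ : ℝ) : ℂ) + Complex.I * (L : ℂ))⁻¹‖ₑ * f ξ τ) ξ τ
      ≤ ENNReal.ofReal (2 * (2 ^ j)⁻¹) * f ξ τ := by
  rw [modPiece, ← mul_assoc]
  gcongr
  rw [← ofReal_norm, ← ofReal_norm, ← ENNReal.ofReal_mul (norm_nonneg _)]
  exact ENNReal.ofReal_le_ofReal (hη.abs_modCutoff_mul_inv_le hL j _)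

/-- At modulation at least `R` the resolvent weight gains `R^{-1/2}`. -/
lemma resolventNorm_high_le (hL : 1 ≤ L) {R : ℝ} (hR : 0 < R) {f : ℤ → ℝ → ℝ≥0∞}
    (hf : ∀ ξ, Measurable (f ξ)) :
    resolventNorm η₀ a L (highMod a R f)
      ≤ ENNReal.ofReal (4 * geomConst (1 / 2) * R ^ (-(1 / 2) : ℝ)) * mixedNorm f := by
  unfold resolventNorm modNorm
  calc _ ≤ ∑' j : ℕ, (ENNReal.ofReal 2 * mixedNorm f) *
        (if R ≤ 5 / 4 * 2 ^ j then ENNReal.ofReal (((2 : ℝ) ^ j) ^ (-(1 / 2) : ℝ)) else 0) := by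
        refine ENNReal.tsum_le_tsum fun j => ?_
        -- pieces with `5/4 · 2^j < R` do not meet the modulations above `R`
        split_ifs with hj
        · rw [rpow_two_half]
          calc _ ≤ ENNReal.ofReal (((2 : ℝ) ^ j) ^ (1 / 2 : ℝ))
                * (ENNReal.ofReal (2 * (2 ^ j)⁻¹) * mixedNorm f) := by
                gcongr
                rw [← mixedNorm_const_mul _ hf]
                refine mixedNorm_mono fun ξ τ =>
                  (hη.modPiece_resolvent_le hL j _ ξ τ).trans ?_
                gcongr
                exact highMod_le _ _ _ _ _
            _ = _ := by
                rw [← mul_assoc, ← ENNReal.ofReal_mul (by positivity), two_pow_half_mul,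
                  ENNReal.ofReal_mul (by norm_num)]
                ring
        · refine le_of_eq_of_le ?_ zero_le
          have : modPiece η₀ a j (fun ξ τ =>
              ‖(((τ - dispersion a ξ : ℝ) : ℂ) + Complex.I * (L : ℂ))⁻¹‖ₑ
                * highMod a R f ξ τ) = fun _ _ => 0 := by
            funext ξ τ
            by_cases hτ : τ ∈ {τ | R ≤ |τ - dispersion a ξ|}
            · apply hη.modPiece_support
              rw [Metric.mem_closedBall, Real.dist_eq, not_le]
              exact (not_le.1 hj).trans_le hτ
            · rw [modPiece, highMod, Set.indicator_of_notMem hτ, mul_zero, mul_zero]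
          rw [this]
          simp [mixedNorm]
    _ ≤ _ := by
        rw [ENNReal.tsum_mul_left]
        refine (mul_le_mul_right (tsum_geom_tail_le hR) _).trans_eq ?_
        rw [mul_right_comm, ← ENNReal.ofReal_mul (by norm_num)]
        congr 2; ring

/-- A function whose `L²_τ` norm is controlled by `D`, and whose size in `L^∞_τ` is that of a
function living on a time window of length `Λ⁻¹`: then the resolvent weight gains `Λ^{-1/2+ε}`. -/
lemma resolventNorm_low_le (hL : 1 ≤ L) {Λ ε : ℝ} (hΛ : 0 < Λ) (hε : 0 < ε) (hε' : ε ≤ 1 / 2)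
    {f : ℤ → ℝ → ℝ≥0∞} (hf : ∀ ξ, Measurable (f ξ)) {D : ℝ≥0∞} {b : ℤ → ℝ≥0∞}
    (hD : mixedNorm f ≤ D) (hb : ∀ ξ τ, f ξ τ ≤ b ξ)
    (hbD : l2Norm count b ≤ ENNReal.ofReal (Λ ^ (-(1 / 2) : ℝ)) * D) :
    resolventNorm η₀ a L f ≤ ENNReal.ofReal (4 * geomConst ε * Λ ^ (-(1 / 2) + ε)) * D := by
  unfold resolventNorm modNorm
  calc _ ≤ ∑' j : ℕ, (ENNReal.ofReal (4 * Λ ^ (-(1 / 2) + ε)) * D)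
        * ENNReal.ofReal (((2 : ℝ) ^ j) ^ (-ε)) := by
        refine ENNReal.tsum_le_tsum fun j => ?_
        set x : ℝ := 2 ^ j with hx
        have hx0 : 0 < x := by positivity
        set F : ℤ → ℝ → ℝ≥0∞ := fun ξ τ =>
          ‖(((τ - dispersion a ξ : ℝ) : ℂ) + Complex.I * (L : ℂ))⁻¹‖ₑ * f ξ τ
        -- the bound in `L²`
        have h1 : mixedNorm (modPiece η₀ a j F) ≤ ENNReal.ofReal (2 * x⁻¹) * D := by
          calc _ ≤ ENNReal.ofReal (2 * x⁻¹) * mixedNorm f := by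
                rw [← mixedNorm_const_mul _ hf]
                exact mixedNorm_mono fun ξ τ => hη.modPiece_resolvent_le hL j _ ξ τ
            _ ≤ _ := by gcongr
        -- the bound in `L^∞`, on an interval of length `O(2^j)`
        have h2 : mixedNorm (modPiece η₀ a j F) ≤ ENNReal.ofReal (2 * x⁻¹) *
            (ENNReal.ofReal (2 * x ^ (1 / 2 : ℝ) * Λ ^ (-(1 / 2) : ℝ)) * D) := by
          calc _ ≤ l2Norm count (fun ξ => (2 * (2 : ℝ≥0∞) ^ ((j : ℝ) / 2))
                * ENNReal.ofReal (2 * x⁻¹) * b ξ) := by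
                refine l2Norm_mono fun ξ => ?_
                refine (l2Norm_le_measure_mul Metric.isClosed_closedBall.measurableSet
                  (b := ENNReal.ofReal (2 * x⁻¹) * b ξ)
                  (hη.modPiece_support j F ξ) (fun τ =>
                  (hη.modPiece_resolvent_le hL j _ ξ τ).trans ?_)).trans ?_
                · gcongr; exact hb ξ τ
                · rw [mul_assoc]; gcongr; exact volume_modulation_ball j _
            _ = (2 * (2 : ℝ≥0∞) ^ ((j : ℝ) / 2)) * ENNReal.ofReal (2 * x⁻¹)
                * l2Norm count b := l2Norm_const_mul _ (measurable_of_countable _)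
            _ ≤ (2 * (2 : ℝ≥0∞) ^ ((j : ℝ) / 2)) * ENNReal.ofReal (2 * x⁻¹)
                * (ENNReal.ofReal (Λ ^ (-(1 / 2) : ℝ)) * D) := by gcongr
            _ = _ := by
                rw [rpow_two_half, ENNReal.ofReal_mul (p := 2 * x ^ (1 / 2 : ℝ)) (by positivity),
                  ENNReal.ofReal_mul (p := 2) (q := x ^ (1 / 2 : ℝ)) (by norm_num),
                  ENNReal.ofReal_ofNat]
                ring
        -- the smaller of the two bounds is at most their geometric mean with exponent `1 - 2ε`
        have h3 : mixedNorm (modPiece η₀ a j F) ≤ ENNReal.ofReal (2 * x⁻¹) *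
            (ENNReal.ofReal (2 * (x / Λ) ^ (1 / 2 - ε)) * D) := by
          have hy : 0 < x / Λ := by positivity
          rcases le_total 1 (x / Λ) with h | h
          · refine h1.trans ?_
            gcongr
            refine le_mul_of_one_le_left' ?_
            rw [ENNReal.one_le_ofReal]
            have := Real.one_le_rpow h (by linarith : 0 ≤ 1 / 2 - ε)
            linarith
          · refine h2.trans ?_
            refine mul_le_mul' le_rfl (mul_le_mul' (ENNReal.ofReal_le_ofReal ?_) le_rfl)
            have e1 : x ^ (1 / 2 : ℝ) * Λ ^ (-(1 / 2) : ℝ) = (x / Λ) ^ (1 / 2 : ℝ) := by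
              rw [Real.div_rpow hx0.le hΛ.le, Real.rpow_neg hΛ.le, ← div_eq_mul_inv]
            rw [mul_assoc, e1]
            have := Real.rpow_le_rpow_of_exponent_ge hy h (by linarith : 1 / 2 - ε ≤ 1 / 2)
            linarith
        refine (mul_le_mul' le_rfl h3).trans_eq ?_
        rw [rpow_two_half, mul_right_comm (ENNReal.ofReal (4 * Λ ^ (-(1 / 2) + ε))) D,
          ← ENNReal.ofReal_mul (by positivity), ← mul_assoc, ← mul_assoc,
          ← ENNReal.ofReal_mul (by positivity), ← ENNReal.ofReal_mul (by positivity)]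
        congr 2
        rw [two_pow_half_mul, Real.div_rpow hx0.le hΛ.le, ← hx]
        have e2 : x ^ (-(1 / 2) : ℝ) * x ^ (1 / 2 - ε) = x ^ (-ε) := by
          rw [← Real.rpow_add hx0]; congr 1; ring
        have e3 : (Λ ^ (1 / 2 - ε))⁻¹ = Λ ^ (-(1 / 2) + ε) := by
          rw [← Real.rpow_neg hΛ.le]; congr 1; ring
        rw [div_eq_mul_inv (x ^ (1 / 2 - ε)), e3, ← e2]
        ring
    _ ≤ _ := by
        rw [ENNReal.tsum_mul_left, tsum_geom hε, mul_right_comm,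
          ← ENNReal.ofReal_mul (by positivity)]
        apply le_of_eq
        congr 2; ring

lemma resolventNorm_tsum_le {ι : Type*} [Countable ι] {f : ι → ℤ → ℝ → ℝ≥0∞}
    (hf : ∀ i ξ, Measurable (f i ξ)) :
    resolventNorm η₀ a L (fun ξ τ => ∑' i, f i ξ τ) ≤ ∑' i, resolventNorm η₀ a L (f i) := by
  unfold resolventNorm
  simp_rw [← ENNReal.tsum_mul_left]
  exact hη.modNorm_tsum_le fun i ξ => measurable_resolvent (hf i ξ)

lemma resolventNorm_add_le {f g : ℤ → ℝ → ℝ≥0∞} (hf : ∀ ξ, Measurable (f ξ))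
    (hg : ∀ ξ, Measurable (g ξ)) :
    resolventNorm η₀ a L (fun ξ τ => f ξ τ + g ξ τ)
      ≤ resolventNorm η₀ a L f + resolventNorm η₀ a L g := by
  unfold resolventNorm
  simp_rw [mul_add]
  exact hη.modNorm_add_le (fun ξ => measurable_resolvent (hf ξ))
    (fun ξ => measurable_resolvent (hg ξ))

lemma resolventNorm_const_mul (c : ℝ≥0∞) {f : ℤ → ℝ → ℝ≥0∞} (hf : ∀ ξ, Measurable (f ξ)) :
    resolventNorm η₀ a L (fun ξ τ => c * f ξ τ) = c * resolventNorm η₀ a L f := by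
  unfold resolventNorm
  rw [← hη.modNorm_const_mul c fun ξ => measurable_resolvent (hf ξ)]
  congr 1
  funext ξ τ
  ring

end IsModulationCutoff

/-! ### The resonance function -/

/-- Superadditivity of `x ↦ x^{1+a}`, quantitatively: the smaller of the two summands contributes
`x ((x + y)^a - x^a)` with `x^a ≤ (x + y)^a / 2`. -/
lemma resonance_pos {a x y m N : ℝ} (ha : 1 ≤ a) (hm : 0 < m) (hx : m ≤ x) (hy : m ≤ y)
    (hN : 0 ≤ N) (hNxy : N ≤ x + y) :
    m * N ^ a / 2 ≤ (x + y) * (x + y) ^ a - x * x ^ a - y * y ^ a := by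
  wlog h : x ≤ y generalizing x y
  · have := this hy hx (by linarith) (by linarith)
    rw [add_comm y x] at this
    linarith
  have hx0 : 0 < x := by linarith
  have hy0 : 0 < y := by linarith
  have h1 : x ^ a ≤ (x + y) ^ a / 2 := by
    calc x ^ a ≤ ((x + y) / 2) ^ a := by gcongr; linarith
      _ = (x + y) ^ a / 2 ^ a := Real.div_rpow (by linarith) (by norm_num) a
      _ ≤ (x + y) ^ a / 2 := by
        gcongr
        simpa using Real.rpow_le_rpow_of_exponent_le (by norm_num : (1 : ℝ) ≤ 2) ha
  have h2 : y ^ a ≤ (x + y) ^ a := by gcongr; linarith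
  have h3 : m * N ^ a ≤ x * (x + y) ^ a := by gcongr
  nlinarith

/-- The resonance function of the dispersion relation `x |x|^a` is at least a multiple of
`min |x| · max |x|^a`: if three numbers sum to zero, the largest is minus the sum of two numbers of
the same sign. -/
lemma resonance {a x y z m N : ℝ} (ha : 1 ≤ a) (hm : 0 < m) (hN : 0 ≤ N) (hxyz : x + y = z)
    (hx : m ≤ |x|) (hy : m ≤ |y|) (hz : m ≤ |z|) (hmax : N ≤ |x| ∨ N ≤ |y| ∨ N ≤ |z|) :
    m * N ^ a / 2 ≤ |x * |x| ^ a + y * |y| ^ a - z * |z| ^ a| := by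
  have core : ∀ p q : ℝ, m ≤ p → m ≤ q → N ≤ p + q →
      m * N ^ a / 2 ≤ (p + q) * (p + q) ^ a - p * p ^ a - q * q ^ a := fun p q hp hq h =>
    resonance_pos ha hm hp hq hN h
  -- in each of the six possible sign patterns, one of the numbers is the sum of two numbers with the
  -- same sign, up to a reflection
  rcases abs_cases x with ⟨ex, sx⟩ | ⟨ex, sx⟩ <;> rcases abs_cases y with ⟨ey, sy⟩ | ⟨ey, sy⟩ <;>
    rcases abs_cases z with ⟨ez, sz⟩ | ⟨ez, sz⟩ <;> rw [ex] at hx hmax ⊢ <;>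
    rw [ey] at hy hmax ⊢ <;> rw [ez] at hz hmax ⊢
  · have h := core x y hx hy (by rcases hmax with h | h | h <;> linarith)
    rw [hxyz] at h
    rw [abs_sub_comm]
    exact (by linarith : _ ≤ z * z ^ a - (x * x ^ a + y * y ^ a)).trans (le_abs_self _)
  · linarith
  · have h := core z (-y) hz hy (by rcases hmax with h | h | h <;> linarith)
    rw [show z + -y = x by linarith] at h
    exact (by linarith : _ ≤ x * x ^ a + y * (-y) ^ a - z * z ^ a).trans (le_abs_self _)
  · have h := core x (-z) hx hz (by rcases hmax with h | h | h <;> linarith)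
    rw [show x + -z = -y by linarith] at h
    rw [← abs_neg]
    exact (by linarith : _ ≤ -(x * x ^ a + y * (-y) ^ a - z * (-z) ^ a)).trans (le_abs_self _)
  · have h := core z (-x) hz hx (by rcases hmax with h | h | h <;> linarith)
    rw [show z + -x = y by linarith] at h
    exact (by linarith : _ ≤ x * (-x) ^ a + y * y ^ a - z * z ^ a).trans (le_abs_self _)
  · have h := core y (-z) hy hz (by rcases hmax with h | h | h <;> linarith)
    rw [show y + -z = -x by linarith] at h
    rw [← abs_neg]
    exact (by linarith : _ ≤ -(x * (-x) ^ a + y * y ^ a - z * (-z) ^ a)).trans (le_abs_self _)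
  · linarith
  · have h := core (-x) (-y) hx hy (by rcases hmax with h | h | h <;> linarith)
    rw [show -x + -y = -z by linarith] at h
    exact (by linarith : _ ≤ x * (-x) ^ a + y * (-y) ^ a - z * (-z) ^ a).trans (le_abs_self _)

lemma le_abs_of_mem_freqBlock {k : ℕ} (hk : 1 ≤ k) {ξ : ℤ} (h : ξ ∈ freqBlock k) :
    (2 : ℝ) ^ k / 2 ≤ |(ξ : ℝ)| := by
  obtain ⟨j, rfl⟩ : ∃ j, k = j + 1 := ⟨k - 1, by omega⟩
  simp only [freqBlock, Set.mem_ofPred_eq] at h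
  have h1 : ((2 ^ j : ℤ) : ℝ) ≤ ((|ξ| : ℤ) : ℝ) := by exact_mod_cast h.1
  push_cast at h1
  rw [pow_succ]
  linarith

/-- A third of the lower bound for the resonance function on three frequency blocks, the smallest
being `n` and the largest `N`. -/
noncomputable def resThreshold (a : ℝ) (n N : ℕ) : ℝ := 2 ^ n * ((2 : ℝ) ^ N) ^ a / 48

lemma resThreshold_pos (a : ℝ) (n N : ℕ) : 0 < resThreshold a n N := by
  unfold resThreshold; positivity

/-- The lower bound for the resonance function in terms of the indices of the blocks. -/
lemma resonance_block {a : ℝ} (ha : 1 ≤ a) (ha2 : a ≤ 2) {k k₁ k₂ : ℕ} (hk : 1 ≤ k) (hk₁ : 1 ≤ k₁)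
    (hk₂ : 1 ≤ k₂) {ξ ξ₁ : ℤ} (h : ξ ∈ freqBlock k) (h₁ : ξ₁ ∈ freqBlock k₁)
    (h₂ : ξ - ξ₁ ∈ freqBlock k₂) :
    3 * resThreshold a (min k (min k₁ k₂)) (max k (max k₁ k₂))
      ≤ |dispersion a ξ₁ + dispersion a (ξ - ξ₁) - dispersion a ξ| := by
  have e := le_abs_of_mem_freqBlock hk h
  have e₁ := le_abs_of_mem_freqBlock hk₁ h₁
  have e₂ := le_abs_of_mem_freqBlock hk₂ h₂
  set n := min k (min k₁ k₂)
  set N := max k (max k₁ k₂) with hN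
  have mono : ∀ i j : ℕ, i ≤ j → (2 : ℝ) ^ i / 2 ≤ 2 ^ j / 2 := fun i j hij => by
    gcongr; norm_num
  have key := resonance (a := a) (x := ξ₁) (y := ((ξ - ξ₁ : ℤ) : ℝ)) (z := ξ)
    (m := 2 ^ n / 2) (N := 2 ^ N / 2) ha (by positivity) (by positivity) (by push_cast; ring)
    ((mono _ _ (by omega)).trans e₁) ((mono _ _ (by omega)).trans e₂)
    ((mono _ _ (by omega)).trans e) (by
      rcases max_choice k (max k₁ k₂) with h | h
      · right; right; rw [hN, h]; exact e
      · rcases max_choice k₁ k₂ with h' | h'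
        · left; rw [hN, h, h']; exact e₁
        · right; left; rw [hN, h, h']; exact e₂)
  refine le_trans ?_ key
  unfold resThreshold
  rw [Real.div_rpow (by positivity) (by norm_num)]
  have h4 : (2 : ℝ) ^ a ≤ 4 := by
    calc (2 : ℝ) ^ a ≤ 2 ^ (2 : ℝ) := Real.rpow_le_rpow_of_exponent_le (by norm_num) ha2
      _ = 4 := by norm_num
  have h5 : ((2 : ℝ) ^ N) ^ a / 4 ≤ ((2 : ℝ) ^ N) ^ a / 2 ^ a := by gcongr
  have h6 : (0 : ℝ) < 2 ^ n := by positivity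
  nlinarith

/-! ### The bilinear estimate on one time window -/

/-- The space-time convolution of two nonnegative functions on `ℤ × ℝ`. -/
noncomputable def biConv (f₁ f₂ : ℤ → ℝ → ℝ≥0∞) (ξ : ℤ) (τ : ℝ) : ℝ≥0∞ :=
  ∑' ξ₁, ∫⁻ σ, f₁ ξ₁ σ * f₂ (ξ - ξ₁) (τ - σ)

lemma measurable_conv {f g : ℝ → ℝ≥0∞} (hf : Measurable f) (hg : Measurable g) :
    Measurable fun τ => ∫⁻ σ, f σ * g (τ - σ) :=
  Measurable.lintegral_prod_right' (f := fun p : ℝ × ℝ => f p.2 * g (p.1 - p.2))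
    ((hf.comp measurable_snd).mul (hg.comp (measurable_fst.sub measurable_snd)))

lemma measurable_biConv {f₁ f₂ : ℤ → ℝ → ℝ≥0∞} (h₁ : ∀ ξ, Measurable (f₁ ξ))
    (h₂ : ∀ ξ, Measurable (f₂ ξ)) (ξ : ℤ) : Measurable (biConv f₁ f₂ ξ) :=
  Measurable.tsum fun ξ₁ => measurable_conv (h₁ ξ₁) (h₂ _)

lemma measurable_block {k : ℕ} {F : ℤ → ℝ → ℝ≥0∞} (hF : ∀ ξ, Measurable (F ξ)) (ξ : ℤ) :
    Measurable ((freqBlock k).indicator F ξ) := by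
  by_cases h : ξ ∈ freqBlock k
  · rw [Set.indicator_of_mem h]; exact hF ξ
  · rw [Set.indicator_of_notMem h]; exact measurable_const

/-- The square root of the number of frequencies of the smallest block, up to a constant. -/
noncomputable def blockCard (k k₁ k₂ : ℕ) : ℝ≥0∞ := (2 ^ (min k (min k₁ k₂) + 3)) ^ (1 / 2 : ℝ)

section Bilinear

variable {k k₁ k₂ : ℕ} {f₁ f₂ : ℤ → ℝ → ℝ≥0∞} (m₁ : ∀ ξ, Measurable (f₁ ξ))
  (m₂ : ∀ ξ, Measurable (f₂ ξ)) (s₁ : ∀ ξ, ξ ∉ freqBlock k₁ → f₁ ξ = 0)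
  (s₂ : ∀ ξ, ξ ∉ freqBlock k₂ → f₂ ξ = 0)

include m₁ m₂ s₁ s₂

/-- The convolution in `ℓ² L²`, with the first factor in `L²` and the second in `L¹` in time. -/
lemma mixedNorm_biConv_le :
    mixedNorm ((freqBlock k).indicator (biConv f₁ f₂))
      ≤ blockCard k k₁ k₂ * (mixedNorm f₁ * l2Norm count (fun ξ => ∫⁻ τ, f₂ ξ τ)) := by
  refine le_trans ?_ (l2Norm_conv_block_le (k := k) (k₁ := k₁) (k₂ := k₂)
    (p := fun ξ => l2Norm volume (f₁ ξ)) (q := fun ξ => ∫⁻ τ, f₂ ξ τ)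
    (fun ξ hξ => by simp [s₁ ξ hξ, l2Norm]) (fun ξ hξ => by simp [s₂ ξ hξ]))
  refine l2Norm_mono fun ξ => ?_
  by_cases hξ : ξ ∈ freqBlock k
  · rw [Set.indicator_of_mem hξ, Set.indicator_of_mem hξ]
    refine (l2Norm_tsum_le fun ξ₁ => measurable_conv (m₁ ξ₁) (m₂ _)).trans ?_
    gcongr with ξ₁
    simp_rw [conv_comm (f₁ ξ₁)]
    rw [mul_comm]
    exact l2Norm_conv_le (m₂ _) (m₁ _)
  · rw [Set.indicator_of_notMem hξ, Set.indicator_of_notMem hξ]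
    simp [l2Norm]

/-- The convolution is bounded in `τ` by a sequence in `ℓ²`. -/
lemma exists_bound_biConv :
    ∃ b : ℤ → ℝ≥0∞, (∀ ξ τ, (freqBlock k).indicator (biConv f₁ f₂) ξ τ ≤ b ξ) ∧
      l2Norm count b ≤ blockCard k k₁ k₂ * (mixedNorm f₁ * mixedNorm f₂) := by
  refine ⟨_, fun ξ τ => ?_, l2Norm_conv_block_le (k := k) (k₁ := k₁) (k₂ := k₂)
    (p := fun ξ => l2Norm volume (f₁ ξ)) (q := fun ξ => l2Norm volume (f₂ ξ))
    (fun ξ hξ => by simp [s₁ ξ hξ, l2Norm]) (fun ξ hξ => by simp [s₂ ξ hξ, l2Norm])⟩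
  by_cases hξ : ξ ∈ freqBlock k
  · rw [Set.indicator_of_mem hξ, Set.indicator_of_mem hξ]
    unfold biConv
    gcongr with ξ₁
    exact conv_le_l2Norm (m₁ _) (m₂ _) τ
  · rw [Set.indicator_of_notMem hξ, Set.indicator_of_notMem hξ]
    simp

end Bilinear

/-- The resonance identity for moduli: an output of small modulation forces one of the inputs to
have large modulation. -/
lemma biConv_le_of_low {a : ℝ} (ha : 1 ≤ a) (ha2 : a ≤ 2) {k k₁ k₂ : ℕ} (hk : 1 ≤ k)
    (hk₁ : 1 ≤ k₁) (hk₂ : 1 ≤ k₂) {f₁ f₂ : ℤ → ℝ → ℝ≥0∞} (m₁ : ∀ ξ, Measurable (f₁ ξ))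
    (m₂ : ∀ ξ, Measurable (f₂ ξ)) (s₁ : ∀ ξ, ξ ∉ freqBlock k₁ → f₁ ξ = 0)
    (s₂ : ∀ ξ, ξ ∉ freqBlock k₂ → f₂ ξ = 0) {R : ℝ}
    (hR : R = resThreshold a (min k (min k₁ k₂)) (max k (max k₁ k₂))) {ξ : ℤ}
    (hξ : ξ ∈ freqBlock k) {τ : ℝ} (hτ : |τ - dispersion a ξ| < R) :
    biConv f₁ f₂ ξ τ ≤ biConv (highMod a R f₁) f₂ ξ τ + biConv f₁ (highMod a R f₂) ξ τ := by
  unfold biConv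
  rw [← ENNReal.tsum_add]
  refine ENNReal.tsum_le_tsum fun ξ₁ => ?_
  rw [← lintegral_add_left]
  swap
  · exact (measurable_highMod (m₁ ξ₁)).mul ((m₂ _).comp (measurable_const.sub measurable_id))
  refine lintegral_mono fun σ => ?_
  by_cases h₁ : ξ₁ ∈ freqBlock k₁
  swap
  · simp [s₁ _ h₁]
  by_cases h₂ : ξ - ξ₁ ∈ freqBlock k₂
  swap
  · simp [s₂ _ h₂]
  by_cases c₁ : R ≤ |σ - dispersion a ξ₁|
  · have : highMod a R f₁ ξ₁ σ = f₁ ξ₁ σ := Set.indicator_of_mem (by exact c₁) _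
    rw [this]; exact le_self_add
  by_cases c₂ : R ≤ |τ - σ - dispersion a (ξ - ξ₁)|
  · have : highMod a R f₂ (ξ - ξ₁) (τ - σ) = f₂ (ξ - ξ₁) (τ - σ) :=
      Set.indicator_of_mem (by exact c₂) _
    rw [this]; exact le_add_self
  -- three modulations below `R` would add up to a resonance function below `3R`
  exfalso
  have key := resonance_block ha ha2 hk hk₁ hk₂ hξ h₁ h₂
  rw [← hR] at key
  rw [not_le, abs_lt] at c₁ c₂
  rw [abs_lt] at hτ
  rcases abs_cases (dispersion a ξ₁ + dispersion a (ξ - ξ₁) - dispersion a ξ) with h | h <;>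
    linarith [h.1, c₁.1, c₁.2, c₂.1, c₂.2, hτ.1, hτ.2]

/-- The interaction of two frequency-localized functions living on a time window of length
`Λ⁻¹`. Large output modulation is gained from the resolvent weight; otherwise one of the inputs has
large modulation. -/
lemma IsModulationCutoff.resolventNorm_biConv_le {η₀ : ℝ → ℝ} (hη : IsModulationCutoff η₀)
    {a : ℝ} (ha : 1 ≤ a) (ha2 : a ≤ 2) {k k₁ k₂ : ℕ} (hk : 1 ≤ k) (hk₁ : 1 ≤ k₁)
    (hk₂ : 1 ≤ k₂) {L Λ ε : ℝ} (hL : 1 ≤ L) (hΛ : 1 ≤ Λ) (hε : 0 < ε) (hε' : ε ≤ 1 / 2)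
    {f₁ f₂ : ℤ → ℝ → ℝ≥0∞} {A₁ A₂ : ℝ≥0∞} (h₁ : ModBound a A₁ f₁) (h₂ : ModBound a A₂ f₂)
    (s₁ : ∀ ξ, ξ ∉ freqBlock k₁ → f₁ ξ = 0) (s₂ : ∀ ξ, ξ ∉ freqBlock k₂ → f₂ ξ = 0)
    (w₁ : mixedNorm f₁ ≤ ENNReal.ofReal (Λ ^ (-(1 / 2) : ℝ)) * A₁)
    (w₂ : mixedNorm f₂ ≤ ENNReal.ofReal (Λ ^ (-(1 / 2) : ℝ)) * A₂) :
    resolventNorm η₀ a L ((freqBlock k).indicator (biConv f₁ f₂))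
      ≤ ENNReal.ofReal ((4 * geomConst (1 / 2) + 8 * geomConst ε) * Λ ^ (-(1 / 2) + ε) *
          resThreshold a (min k (min k₁ k₂)) (max k (max k₁ k₂)) ^ (-(1 / 2) : ℝ))
        * (blockCard k k₁ k₂ * (A₁ * A₂)) := by
  set R := resThreshold a (min k (min k₁ k₂)) (max k (max k₁ k₂)) with hR
  have hR0 : 0 < R := resThreshold_pos _ _ _
  have m₁ := h₁.measurable
  have m₂ := h₂.measurable
  have mh₁ : ∀ ξ, Measurable (highMod a R f₁ ξ) := fun ξ => measurable_highMod (m₁ ξ)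
  have mh₂ : ∀ ξ, Measurable (highMod a R f₂ ξ) := fun ξ => measurable_highMod (m₂ ξ)
  have sh₁ : ∀ ξ, ξ ∉ freqBlock k₁ → highMod a R f₁ ξ = 0 := fun ξ hξ => by
    rw [highMod, s₁ ξ hξ, Set.indicator_zero']
  have sh₂ : ∀ ξ, ξ ∉ freqBlock k₂ → highMod a R f₂ ξ = 0 := fun ξ hξ => by
    rw [highMod, s₂ ξ hξ, Set.indicator_zero']
  set F := (freqBlock k).indicator (biConv f₁ f₂)
  set G₁ := (freqBlock k).indicator (biConv (highMod a R f₁) f₂)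
  set G₂ := (freqBlock k).indicator (biConv f₁ (highMod a R f₂))
  have mF : ∀ ξ, Measurable (F ξ) := measurable_block (measurable_biConv m₁ m₂)
  have mG₁ : ∀ ξ, Measurable (G₁ ξ) := measurable_block (measurable_biConv mh₁ m₂)
  have mG₂ : ∀ ξ, Measurable (G₂ ξ) := measurable_block (measurable_biConv m₁ mh₂)
  have hsplit : ∀ ξ τ, F ξ τ ≤ highMod a R F ξ τ + (G₁ ξ τ + G₂ ξ τ) := by
    intro ξ τ
    by_cases hτ : R ≤ |τ - dispersion a ξ|
    · have : highMod a R F ξ τ = F ξ τ := Set.indicator_of_mem (by exact hτ) _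
      rw [this]; exact le_self_add
    · refine le_trans ?_ le_add_self
      by_cases hξ : ξ ∈ freqBlock k
      · simp only [F, G₁, G₂, Set.indicator_of_mem hξ]
        exact biConv_le_of_low ha ha2 hk hk₁ hk₂ m₁ m₂ s₁ s₂ hR hξ (not_le.1 hτ)
      · simp [F, Set.indicator_of_notMem hξ]
  set B := blockCard k k₁ k₂
  set rR := ENNReal.ofReal (R ^ (-(1 / 2) : ℝ))
  set rΛ := ENNReal.ofReal (Λ ^ (-(1 / 2) : ℝ))
  -- large modulation of the output
  have bF : resolventNorm η₀ a L (highMod a R F)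
      ≤ ENNReal.ofReal (4 * geomConst (1 / 2) * R ^ (-(1 / 2) : ℝ))
        * (B * (rΛ * A₁ * A₂)) := by
    refine (hη.resolventNorm_high_le hL hR0 mF).trans ?_
    gcongr
    refine (mixedNorm_biConv_le m₁ m₂ s₁ s₂).trans ?_
    gcongr
    exact h₂.l1
  -- large modulation of the first or of the second factor
  have bG₁ : resolventNorm η₀ a L G₁
      ≤ ENNReal.ofReal (4 * geomConst ε * Λ ^ (-(1 / 2) + ε)) * (B * (rR * A₁ * A₂)) := by
    obtain ⟨b, hb, hb'⟩ := exists_bound_biConv (k := k) mh₁ m₂ sh₁ s₂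
    refine hη.resolventNorm_low_le hL (by linarith) hε hε' mG₁ ?_ hb ?_
    · refine (mixedNorm_biConv_le mh₁ m₂ sh₁ s₂).trans ?_
      gcongr
      · exact h₁.high R hR0
      · exact h₂.l1
    · refine hb'.trans ?_
      calc _ ≤ B * ((rR * A₁) * (rΛ * A₂)) := by
            gcongr
            exact h₁.high R hR0
        _ = _ := by ring
  have bG₂ : resolventNorm η₀ a L G₂
      ≤ ENNReal.ofReal (4 * geomConst ε * Λ ^ (-(1 / 2) + ε)) * (B * (rR * A₁ * A₂)) := by
    obtain ⟨b, hb, hb'⟩ := exists_bound_biConv (k := k) m₁ mh₂ s₁ sh₂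
    refine hη.resolventNorm_low_le hL (by linarith) hε hε' mG₂ ?_ hb ?_
    · have hc : biConv f₁ (highMod a R f₂) = biConv (highMod a R f₂) f₁ := by
        funext ξ τ
        unfold biConv
        rw [← (Equiv.subLeft ξ).tsum_eq]
        refine tsum_congr fun ξ₁ => ?_
        rw [conv_comm, Equiv.subLeft_apply, sub_sub_cancel]
      have h3 := mixedNorm_biConv_le (k := k) mh₂ m₁ sh₂ s₁
      rw [← hc] at h3
      refine h3.trans ?_
      have hB : blockCard k k₂ k₁ = B := by simp only [B, blockCard, min_comm k₁ k₂]
      rw [hB]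
      calc _ ≤ B * ((rR * A₂) * A₁) := by
            gcongr
            · exact h₂.high R hR0
            · exact h₁.l1
        _ = _ := by ring
    · refine hb'.trans ?_
      calc _ ≤ B * ((rΛ * A₁) * (rR * A₂)) := by
            gcongr
            exact h₂.high R hR0
        _ = _ := by ring
  refine (resolventNorm_mono hsplit).trans ((hη.resolventNorm_add_le
    (fun ξ => measurable_highMod (mF ξ)) (fun ξ => (mG₁ ξ).add (mG₂ ξ))).trans ?_)
  refine (add_le_add bF ((hη.resolventNorm_add_le mG₁ mG₂).trans (add_le_add bG₁ bG₂))).trans ?_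
  have g0 := (geomConst_pos (ε := 1 / 2) (by norm_num)).le
  have gε := (geomConst_pos hε).le
  have hΛ0 : 0 < Λ := by linarith
  have e1 : ENNReal.ofReal (4 * geomConst (1 / 2) * R ^ (-(1 / 2) : ℝ)) * (B * (rΛ * A₁ * A₂))
      ≤ ENNReal.ofReal (4 * geomConst (1 / 2) * Λ ^ (-(1 / 2) + ε) * R ^ (-(1 / 2) : ℝ))
        * (B * (A₁ * A₂)) := by
    calc _ = (ENNReal.ofReal (4 * geomConst (1 / 2) * R ^ (-(1 / 2) : ℝ)) * rΛ)
          * (B * (A₁ * A₂)) := by ring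
      _ ≤ _ := by
        rw [← ENNReal.ofReal_mul (by positivity)]
        refine mul_le_mul' (ENNReal.ofReal_le_ofReal ?_) le_rfl
        rw [mul_right_comm]
        have := Real.rpow_le_rpow_of_exponent_le hΛ (by linarith : -(1 / 2 : ℝ) ≤ -(1 / 2) + ε)
        gcongr
  have e2 : ENNReal.ofReal (4 * geomConst ε * Λ ^ (-(1 / 2) + ε)) * (B * (rR * A₁ * A₂))
      = ENNReal.ofReal (4 * geomConst ε * Λ ^ (-(1 / 2) + ε) * R ^ (-(1 / 2) : ℝ))
        * (B * (A₁ * A₂)) := by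
    rw [ENNReal.ofReal_mul (q := R ^ (-(1 / 2) : ℝ)) (by positivity)]
    ring
  rw [e2]
  refine (add_le_add e1 le_rfl).trans_eq ?_
  rw [← add_mul, ← add_mul, ← ENNReal.ofReal_add (by positivity) (by positivity),
    ← ENNReal.ofReal_add (by positivity) (by positivity)]
  congr 2; ring

/-! ### Smooth partitions of time -/

/-- A smooth bump supported in `[0, 2]` whose integer translates sum to one. -/
noncomputable def unitWindow (x : ℝ) : ℝ := Real.smoothTransition x - Real.smoothTransition (x - 1)

lemma unitWindow_eq_zero {x : ℝ} (hx : x ∉ Set.Icc (0 : ℝ) 2) : unitWindow x = 0 := by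
  rw [Set.mem_Icc, not_and_or, not_le, not_le] at hx
  unfold unitWindow
  rcases hx with h | h
  · rw [Real.smoothTransition.zero_of_nonpos h.le,
      Real.smoothTransition.zero_of_nonpos (by linarith), sub_zero]
  · rw [Real.smoothTransition.one_of_one_le (by linarith),
      Real.smoothTransition.one_of_one_le (by linarith), sub_self]

lemma sum_unitWindow {x : ℝ} {u v : ℤ} (hu : u + 1 ≤ x) (hv : x ≤ v + 1) :
    ∑ m ∈ Finset.Icc u v, unitWindow (x - m) = 1 := by
  have huv : u ≤ v := by exact_mod_cast (by linarith : (u : ℝ) ≤ v)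
  have tele : ∀ n : ℕ, ∑ m ∈ Finset.Icc u (u + n), unitWindow (x - m)
      = Real.smoothTransition (x - u) - Real.smoothTransition (x - (u + n + 1)) := by
    intro n
    induction n with
    | zero =>
      simp only [Nat.cast_zero, add_zero, Finset.Icc_self, Finset.sum_singleton, unitWindow]
      congr 2; ring
    | succ n ih =>
      have : Finset.Icc u (u + (n + 1 : ℕ)) = insert (u + n + 1) (Finset.Icc u (u + n)) := by
        ext m; simp only [Finset.mem_Icc, Finset.mem_insert]; push_cast; omega
      rw [this, Finset.sum_insert (by simp), ih, unitWindow]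
      push_cast
      rw [show x - (u + n + 1 : ℝ) - 1 = x - (u + (n + 1) + 1) by ring]
      ring
  obtain ⟨n, hn⟩ : ∃ n : ℕ, v = u + n := ⟨(v - u).toNat, by omega⟩
  subst hn
  rw [tele, Real.smoothTransition.one_of_one_le (by linarith),
    Real.smoothTransition.zero_of_nonpos (by push_cast at hv; linarith), sub_zero]

lemma IsBump.mono {K K' Λ : ℝ} {b : ℝ → ℂ} (h : IsBump K Λ b) (hK : K ≤ K') (hΛ : 0 < Λ) :
    IsBump K' Λ b where
  continuous := h.continuous
  compact := h.compact
  decay τ := (h.decay τ).trans (by unfold bumpKernel; gcongr)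

/-- The two bumps used for localization in time: the cutoff `η₀` and the window of the partition,
with a common constant. -/
lemma IsModulationCutoff.exists_bumps {η₀ : ℝ → ℝ} (hη : IsModulationCutoff η₀) :
    ∃ K : ℝ, 0 ≤ K ∧ IsBump K 1 (fun t => (η₀ t : ℂ)) ∧
      IsBump K 1 (fun t => (unitWindow t : ℂ)) := by
  obtain ⟨K₁, h₁, b₁⟩ := exists_isBump (b := fun t => (η₀ t : ℂ))
    (Complex.ofRealCLM.contDiff.comp hη.smooth)
    (HasCompactSupport.intro (isCompact_Icc (a := (-(5 / 4) : ℝ)) (b := 5 / 4)) fun x hx => by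
      have : η₀ x = 0 := by by_contra h; exact hx (hη.support_subset h)
      simp [this])
  have hw : ContDiff ℝ ∞ unitWindow :=
    Real.smoothTransition.contDiff.sub (Real.smoothTransition.contDiff.comp (by fun_prop))
  obtain ⟨K₂, h₂, b₂⟩ := exists_isBump (b := fun t => (unitWindow t : ℂ))
    (Complex.ofRealCLM.contDiff.comp hw)
    (HasCompactSupport.intro (isCompact_Icc (a := (0 : ℝ)) (b := 2)) fun x hx => by
      simp [unitWindow_eq_zero hx])
  exact ⟨max K₁ K₂, h₁.trans (le_max_left _ _), b₁.mono (le_max_left _ _) one_pos,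
    b₂.mono (le_max_right _ _) one_pos⟩

/-! ### Frequency-localized families of coefficients -/

/-- The Fourier coefficients `c(t,ξ)`, `ξ ∈ I_k`, of a function whose localizations to time windows
of length `2^{-(2-a+δ)k}` satisfy modulation bounds with constant `A`. -/
structure IsBlockFamily (η₀ : ℝ → ℝ) (a δ : ℝ) (k : ℕ) (A : ℝ≥0∞) (c : ℝ → ℤ → ℂ) : Prop where
  continuous : ∀ ξ, Continuous fun t => c t ξ
  compact : ∀ ξ, HasCompactSupport fun t => c t ξ
  support : ∀ ξ, ξ ∉ freqBlock k → ∀ t, c t ξ = 0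
  bound : ∀ t', ModBound a A fun ξ τ =>
    ‖timeFourier (fun t => c t ξ * (η₀ (invTimeScale a δ k * (t - t')) : ℂ)) τ‖ₑ

lemma ModBound.mono {a : ℝ} {A A' : ℝ≥0∞} {f : ℤ → ℝ → ℝ≥0∞} (h : ModBound a A f) (hA : A ≤ A') :
    ModBound a A' f where
  measurable := h.measurable
  l1 := h.l1.trans hA
  high R hR := (h.high R hR).trans (by gcongr)

lemma measurable_enorm_timeFourier {g : ℝ → ℂ} (hg : Integrable g) :
    Measurable fun τ => ‖timeFourier g τ‖ₑ :=
  (continuous_timeFourier hg).enorm.measurable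

lemma one_le_invTimeScale {a δ : ℝ} (h : 0 ≤ 2 - a + δ) (k : ℕ) : 1 ≤ invTimeScale a δ k :=
  Real.one_le_rpow (by norm_num) (by positivity)

lemma invTimeScale_pos (a δ : ℝ) (k : ℕ) : 0 < invTimeScale a δ k := by
  unfold invTimeScale; positivity

namespace IsBlockFamily

variable {η₀ : ℝ → ℝ} {a δ : ℝ} {k : ℕ} {A : ℝ≥0∞} {c : ℝ → ℤ → ℂ}

lemma integrable_mul (h : IsBlockFamily η₀ a δ k A c) {b : ℝ → ℂ} (hb : Continuous b) (ξ : ℤ) :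
    Integrable fun t => c t ξ * b t :=
  ((h.continuous ξ).mul hb).integrable_of_hasCompactSupport ((h.compact ξ).mul_right)

/-- Multiplication by a smooth function of time at any scale. -/
lemma mul_bump (hη : IsModulationCutoff η₀) (h : IsBlockFamily η₀ a δ k A c) {K Λ : ℝ} (hK : 0 ≤ K)
    (hΛ : 0 < Λ) {b : ℝ → ℂ} (hb : IsBump K Λ b) :
    IsBlockFamily η₀ a δ k (ENNReal.ofReal (8 * K) * A) fun t ξ => c t ξ * b t where
  continuous ξ := (h.continuous ξ).mul hb.continuous
  compact ξ := (h.compact ξ).mul_right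
  support ξ hξ t := by rw [h.support ξ hξ t, zero_mul]
  bound t' := by
    have hc := hη.continuous
    have hi : ∀ ξ, Integrable fun t =>
        c t ξ * (η₀ (invTimeScale a δ k * (t - t')) : ℂ) := fun ξ =>
      h.integrable_mul (by fun_prop) ξ
    have e : ∀ ξ, (fun t => c t ξ * b t * (η₀ (invTimeScale a δ k * (t - t')) : ℂ))
        = fun t => c t ξ * (η₀ (invTimeScale a δ k * (t - t')) : ℂ) * b t := by
      intro ξ; funext t; ring
    simp_rw [e]
    refine (h.bound t').smear hK hΛ (fun ξ => ?_) fun ξ τ => hb.enorm_timeFourier_mul_le hΛ (hi ξ) τ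
    refine measurable_enorm_timeFourier ?_
    rw [← e]
    exact (((h.continuous ξ).mul hb.continuous).mul (by fun_prop)).integrable_of_hasCompactSupport
      ((h.compact ξ).mul_right).mul_right

/-- The coefficients are bounded in `ℓ²`, uniformly in time. -/
lemma l2Norm_le (hη : IsModulationCutoff η₀) (h : IsBlockFamily η₀ a δ k A c) (t : ℝ) :
    l2Norm count (fun ξ => ‖c t ξ‖ₑ) ≤ A := by
  refine le_trans (l2Norm_mono fun ξ => ?_) (h.bound t).l1
  have hc := hη.continuous
  have h1 := enorm_le_lintegral_timeFourier
    (g := fun s => c s ξ * (η₀ (invTimeScale a δ k * (s - t)) : ℂ))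
    ((h.continuous ξ).mul (by fun_prop)) (h.integrable_mul (by fun_prop) ξ) t
  simp only [sub_self, mul_zero, hη.eq_one 0 (by simp), Complex.ofReal_one, mul_one] at h1
  exact h1

end IsBlockFamily

/-- The frequency block `I_k` as a finite set. -/
noncomputable def blockFinset (k : ℕ) : Finset ℤ := (finite_freqBlock k).toFinset

lemma mem_blockFinset {k : ℕ} {ξ : ℤ} : ξ ∈ blockFinset k ↔ ξ ∈ freqBlock k :=
  Set.Finite.mem_toFinset _

/-- The Fourier coefficients of a product, up to a factor `2π`, the first factor having its
frequencies in `I_k`. -/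
noncomputable def coefConv (k : ℕ) (c₁ c₂ : ℝ → ℤ → ℂ) (t : ℝ) (ξ : ℤ) : ℂ :=
  ∑ ξ₁ ∈ blockFinset k, c₁ t ξ₁ * c₂ t (ξ - ξ₁)

section Window

variable {η₀ : ℝ → ℝ} {a δ : ℝ} {k k₁ k₂ : ℕ} {A₁ A₂ : ℝ≥0∞} {c₁ c₂ : ℝ → ℤ → ℂ}

/-- The Fourier transform of a product of families, for factors already localized in time. -/
lemma enorm_timeFourier_sum_le {f₁ f₂ : ℝ → ℤ → ℂ} (hc₁ : ∀ ξ, Continuous fun t => f₁ t ξ)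
    (hi₁ : ∀ ξ, Integrable fun t => f₁ t ξ) (hi₁' : ∀ ξ, Integrable (timeFourier fun t => f₁ t ξ))
    (hc₂ : ∀ ξ, Continuous fun t => f₂ t ξ) (hi₂ : ∀ ξ, Integrable fun t => f₂ t ξ)
    (hs : ∀ ξ, HasCompactSupport fun t => f₁ t ξ) (ξ : ℤ) (τ : ℝ) :
    ‖timeFourier (fun t => coefConv k₁ f₁ f₂ t ξ) τ‖ₑ
      ≤ biConv (fun ξ τ => ‖timeFourier (fun t => f₁ t ξ) τ‖ₑ)
          (fun ξ τ => ‖timeFourier (fun t => f₂ t ξ) τ‖ₑ) ξ τ := by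
  have h1 : timeFourier (fun t => coefConv k₁ f₁ f₂ t ξ) τ
      = ∑ ξ₁ ∈ blockFinset k₁, timeFourier (fun t => f₁ t ξ₁ * f₂ t (ξ - ξ₁)) τ := by
    unfold timeFourier coefConv
    simp_rw [Finset.mul_sum]
    rw [integral_finsetSum]
    intro ξ₁ _
    apply integrable_cexp_mul
    exact ((hc₁ ξ₁).mul (hc₂ _)).integrable_of_hasCompactSupport ((hs ξ₁).mul_right)
  rw [h1]
  refine (enorm_sum_le _ _).trans (le_trans ?_ (ENNReal.sum_le_tsum (blockFinset k₁)))
  gcongr with ξ₁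
  exact enorm_timeFourier_mul_le (hc₁ _) (hi₁ _) (hi₁' _) (hi₂ _) τ

/-- A finite modulation bound makes the Fourier transforms integrable, as needed for inversion. -/
lemma norm_modBound_integrable {g : ℤ → ℝ → ℂ} (hg : ∀ ξ, Integrable (g ξ)) {A : ℝ≥0∞}
    (hA : A ≠ ⊤) (h : ModBound a A fun ξ τ => ‖timeFourier (g ξ) τ‖ₑ) (ξ : ℤ) :
    Integrable (timeFourier (g ξ)) := by
  refine ⟨(continuous_timeFourier (hg ξ)).aestronglyMeasurable, lt_of_le_of_lt ?_ hA.lt_top⟩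
  exact (le_l2Norm_count (fun ξ => ∫⁻ τ, ‖timeFourier (g ξ) τ‖ₑ) ξ).trans h.l1

/-- The interaction on one window: `γ` is the output localization, `θ` a window of length `Λ⁻¹`
around `t'`. The cutoffs at the time scales of the inputs may be inserted, since these scales are
longer than the window. -/
lemma window_interaction (hη : IsModulationCutoff η₀) (ha : 1 ≤ a) (ha2 : a ≤ 2) (hk : 1 ≤ k)
    (hk₁ : 1 ≤ k₁) (hk₂ : 1 ≤ k₂) {L Λ ε K Λ' : ℝ} (hL : 1 ≤ L) (hΛ : 1 ≤ Λ) (hε : 0 < ε)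
    (hε' : ε ≤ 1 / 2) (hK : 0 ≤ K) (hηb : IsBump K 1 fun t => (η₀ t : ℂ))
    (h₁ : IsBlockFamily η₀ a δ k₁ A₁ c₁) (h₂ : IsBlockFamily η₀ a δ k₂ A₂ c₂) (hA₁ : A₁ ≠ ⊤)
    (hΛ₁ : invTimeScale a δ k₁ ≤ Λ) (hΛ₂ : invTimeScale a δ k₂ ≤ Λ) {γ θ : ℝ → ℂ} (hΛ' : 0 < Λ')
    (hγ : IsBump K Λ' γ) (hθ : IsBump K Λ θ) {t' : ℝ} (hθs : ∀ t, 1 / Λ < |t - t'| → θ t = 0) :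
    resolventNorm η₀ a L ((freqBlock k).indicator fun ξ τ =>
        ‖timeFourier (fun t => coefConv k₁ c₁ c₂ t ξ * γ t * θ t) τ‖ₑ)
      ≤ ENNReal.ofReal ((4 * geomConst (1 / 2) + 8 * geomConst ε) * Λ ^ (-(1 / 2) + ε) *
          resThreshold a (min k (min k₁ k₂)) (max k (max k₁ k₂)) ^ (-(1 / 2) : ℝ))
        * (blockCard k k₁ k₂ * (ENNReal.ofReal (80 * K ^ 2) * A₁ *
          (ENNReal.ofReal (10 * K) * A₂))) := by
  have hc := hη.continuous
  have hΛ0 : 0 < Λ := by linarith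
  have hone : ∀ {j : ℕ} {t : ℝ}, invTimeScale a δ j ≤ Λ → |t - t'| ≤ 1 / Λ →
      η₀ (invTimeScale a δ j * (t - t')) = 1 := by
    intro j t hj ht
    apply hη.eq_one
    rw [abs_mul, abs_of_pos (invTimeScale_pos a δ j)]
    calc invTimeScale a δ j * |t - t'| ≤ Λ * (1 / Λ) :=
          mul_le_mul hj ht (abs_nonneg _) hΛ0.le
      _ = 1 := by field_simp
  -- the localized factors: `θ` is kept with the first one, and the second is localized by a cutoff
  -- which equals one on the window
  set g₁ : ℝ → ℤ → ℂ := fun t ξ =>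
    c₁ t ξ * (η₀ (invTimeScale a δ k₁ * (t - t')) : ℂ) * γ t * θ t with hg₁
  set g₂ : ℝ → ℤ → ℂ := fun t ξ =>
    c₂ t ξ * (η₀ (invTimeScale a δ k₂ * (t - t')) : ℂ) * (η₀ (Λ * (t - t')) : ℂ) with hg₂
  have hγc := hγ.continuous
  have hθc := hθ.continuous
  have hη' := hηb.comp_affine hΛ0 t'
  have cg₁ : ∀ ξ, Continuous fun t => g₁ t ξ := fun ξ =>
    (((h₁.continuous ξ).mul (by fun_prop)).mul hγc).mul hθc
  have cg₂ : ∀ ξ, Continuous fun t => g₂ t ξ := fun ξ =>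
    ((h₂.continuous ξ).mul (by fun_prop)).mul (by fun_prop)
  have sg₁ : ∀ ξ, HasCompactSupport fun t => g₁ t ξ := fun ξ =>
    (((h₁.compact ξ).mul_right).mul_right).mul_right
  have sg₂ : ∀ ξ, HasCompactSupport fun t => g₂ t ξ := fun ξ =>
    ((h₂.compact ξ).mul_right).mul_right
  have ig₁ : ∀ ξ, Integrable fun t => g₁ t ξ := fun ξ =>
    (cg₁ ξ).integrable_of_hasCompactSupport (sg₁ ξ)
  have ig₂ : ∀ ξ, Integrable fun t => g₂ t ξ := fun ξ =>
    (cg₂ ξ).integrable_of_hasCompactSupport (sg₂ ξ)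
  have i₁ : ∀ ξ, Integrable fun t => c₁ t ξ * (η₀ (invTimeScale a δ k₁ * (t - t')) : ℂ) :=
    fun ξ => h₁.integrable_mul (by fun_prop) ξ
  have i₁' : ∀ ξ, Integrable fun t =>
      c₁ t ξ * (η₀ (invTimeScale a δ k₁ * (t - t')) : ℂ) * γ t := fun ξ =>
    (((h₁.continuous ξ).mul (by fun_prop)).mul hγc).integrable_of_hasCompactSupport
      ((h₁.compact ξ).mul_right).mul_right
  have i₂ : ∀ ξ, Integrable fun t => c₂ t ξ * (η₀ (invTimeScale a δ k₂ * (t - t')) : ℂ) :=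
    fun ξ => h₂.integrable_mul (by fun_prop) ξ
  have b₁ := (h₁.bound t').smear hK hΛ' (fun ξ => measurable_enorm_timeFourier (i₁' ξ))
    fun ξ τ => hγ.enorm_timeFourier_mul_le hΛ' (i₁ ξ) τ
  have b₁' := b₁.smear hK hΛ0 (fun ξ => measurable_enorm_timeFourier (ig₁ ξ))
    fun ξ τ => hθ.enorm_timeFourier_mul_le hΛ0 (i₁' ξ) τ
  have w₁ := b₁.mixedNorm_smear_le hK hΛ0 (fun ξ => measurable_enorm_timeFourier (ig₁ ξ))
    fun ξ τ => hθ.enorm_timeFourier_mul_le hΛ0 (i₁' ξ) τ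
  have b₂ := (h₂.bound t').smear hK hΛ0 (fun ξ => measurable_enorm_timeFourier (ig₂ ξ))
    fun ξ τ => hη'.enorm_timeFourier_mul_le hΛ0 (i₂ ξ) τ
  have w₂ := (h₂.bound t').mixedNorm_smear_le hK hΛ0
    (fun ξ => measurable_enorm_timeFourier (ig₂ ξ))
    fun ξ τ => hη'.enorm_timeFourier_mul_le hΛ0 (i₂ ξ) τ
  have B₁ : ModBound a (ENNReal.ofReal (80 * K ^ 2) * A₁) _ := b₁'.mono (by
    rw [← mul_assoc, ← ENNReal.ofReal_mul (by positivity)]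
    refine mul_le_mul' (ENNReal.ofReal_le_ofReal ?_) le_rfl
    nlinarith [sq_nonneg K])
  have B₂ : ModBound a (ENNReal.ofReal (10 * K) * A₂) _ := b₂.mono (by gcongr; norm_num)
  have key := hη.resolventNorm_biConv_le (L := L) ha ha2 hk hk₁ hk₂ hL hΛ hε hε' B₁ B₂
    (fun ξ hξ => by
      funext τ
      have : (fun t => g₁ t ξ) = fun _ => 0 := by
        funext t; simp only [hg₁, h₁.support ξ hξ t, zero_mul]
      change ‖timeFourier (fun t => g₁ t ξ) τ‖ₑ = 0
      rw [this]; simp [timeFourier])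
    (fun ξ hξ => by
      funext τ
      have : (fun t => g₂ t ξ) = fun _ => 0 := by
        funext t; simp only [hg₂, h₂.support ξ hξ t, zero_mul]
      change ‖timeFourier (fun t => g₂ t ξ) τ‖ₑ = 0
      rw [this]; simp [timeFourier])
    (w₁.trans_eq (by
      rw [← mul_assoc, ← mul_assoc, ← ENNReal.ofReal_mul (by positivity),
        ← ENNReal.ofReal_mul (by positivity)]
      congr 2; ring))
    (w₂.trans_eq (by
      rw [← mul_assoc, ← ENNReal.ofReal_mul (by positivity)]
      congr 2; ring))
  refine (resolventNorm_mono fun ξ τ => ?_).trans key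
  by_cases hξ : ξ ∈ freqBlock k
  swap
  · rw [Set.indicator_of_notMem hξ, Set.indicator_of_notMem hξ]
  rw [Set.indicator_of_mem hξ, Set.indicator_of_mem hξ]
  have e : (fun t => coefConv k₁ c₁ c₂ t ξ * γ t * θ t) = fun t => coefConv k₁ g₁ g₂ t ξ := by
    funext t
    unfold coefConv
    rw [Finset.sum_mul, Finset.sum_mul]
    refine Finset.sum_congr rfl fun ξ₁ _ => ?_
    by_cases ht : 1 / Λ < |t - t'|
    · simp only [hg₁, hg₂, hθs t ht, mul_zero, zero_mul]
    · rw [not_lt] at ht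
      have e3 : η₀ (Λ * (t - t')) = 1 := by
        apply hη.eq_one
        rw [abs_mul, abs_of_pos hΛ0, ← le_div_iff₀' hΛ0]
        exact ht
      simp only [hg₁, hg₂, hone hΛ₁ ht, hone hΛ₂ ht, e3, Complex.ofReal_one, mul_one]
      ring
  rw [e]
  exact enorm_timeFourier_sum_le cg₁ ig₁ (fun ξ => norm_modBound_integrable (g := fun ξ t => g₁ t ξ)
    ig₁ (ENNReal.mul_ne_top ENNReal.ofReal_ne_top hA₁) B₁ ξ) cg₂ ig₂ sg₁ ξ τ

end Window

/-! ### Summation over time windows -/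

lemma IsModulationCutoff.resolventNorm_finsetSum_le {η₀ : ℝ → ℝ} (hη : IsModulationCutoff η₀)
    {a L : ℝ} {ι : Type*} (s : Finset ι) {f : ι → ℤ → ℝ → ℝ≥0∞} (hf : ∀ i ξ, Measurable (f i ξ)) :
    resolventNorm η₀ a L (fun ξ τ => ∑ i ∈ s, f i ξ τ) ≤ ∑ i ∈ s, resolventNorm η₀ a L (f i) := by
  have h := hη.resolventNorm_tsum_le (a := a) (L := L) (f := fun i : s => f i) fun i ξ => hf i ξ
  rw [Finset.tsum_subtype s fun i => resolventNorm η₀ a L (f i)] at h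
  refine le_of_eq_of_le ?_ h
  congr 1
  funext ξ τ
  exact (Finset.tsum_subtype s fun i => f i ξ τ).symm

lemma unitWindow_scaled_eq_zero {Λ t : ℝ} (hΛ : 0 < Λ) (m : ℤ)
    (ht : 1 / Λ < |t - (m + 1) / Λ|) : unitWindow (Λ * (t - m / Λ)) = 0 := by
  apply unitWindow_eq_zero
  have h1 : Λ * (t - m / Λ) = Λ * (t - (m + 1) / Λ) + 1 := by field_simp; ring
  rw [h1, Set.mem_Icc]
  rintro ⟨h2, h3⟩
  have : |Λ * (t - (m + 1) / Λ)| ≤ 1 := by rw [abs_le]; constructor <;> linarith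
  rw [abs_mul, abs_of_pos hΛ, ← le_div_iff₀' hΛ] at this
  linarith

section Interaction

variable {η₀ : ℝ → ℝ} {a δ : ℝ} {k k₁ k₂ : ℕ} {A₁ A₂ : ℝ≥0∞} {c₁ c₂ : ℝ → ℤ → ℂ}

lemma continuous_coefConv (h₁ : ∀ ξ, Continuous fun t => c₁ t ξ)
    (h₂ : ∀ ξ, Continuous fun t => c₂ t ξ) (ξ : ℤ) :
    Continuous fun t => coefConv k₁ c₁ c₂ t ξ :=
  continuous_finsetSum _ fun ξ₁ _ => (h₁ ξ₁).mul (h₂ _)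

/-- The interaction of two families on the time scale of the output: the output window is covered
by `O(Λ min(T, 2^{-(2-a+δ)k}))` windows of length `Λ⁻¹`. -/
lemma block_interaction (hη : IsModulationCutoff η₀) (ha : 1 ≤ a) (ha2 : a ≤ 2) (hk : 1 ≤ k)
    (hk₁ : 1 ≤ k₁) (hk₂ : 1 ≤ k₂) {Λ ε K T : ℝ} (hε : 0 < ε) (hε' : ε ≤ 1 / 2) (hK : 0 ≤ K)
    (hηb : IsBump K 1 fun t => (η₀ t : ℂ)) (hwb : IsBump K 1 fun t => (unitWindow t : ℂ))
    (h₁ : IsBlockFamily η₀ a δ k₁ A₁ c₁) (h₂ : IsBlockFamily η₀ a δ k₂ A₂ c₂) (hA₁ : A₁ ≠ ⊤)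
    (hL : 1 ≤ invTimeScale a δ k) (hΛ₀ : invTimeScale a δ k ≤ Λ)
    (hΛ₁ : invTimeScale a δ k₁ ≤ Λ) (hΛ₂ : invTimeScale a δ k₂ ≤ Λ) (hT : 0 < T)
    (hTΛ : 1 / T ≤ Λ) (hs : ∀ t, 5 / 4 * T < |t| → ∀ ξ, c₁ t ξ = 0) (tk : ℝ) :
    resolventNorm η₀ a (invTimeScale a δ k) ((freqBlock k).indicator fun ξ τ =>
        ‖timeFourier (fun t => coefConv k₁ c₁ c₂ t ξ *
          (η₀ (invTimeScale a δ k * (t - tk)) : ℂ)) τ‖ₑ)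
      ≤ ENNReal.ofReal (7 * (Λ * min T (1 / invTimeScale a δ k))) *
        (ENNReal.ofReal ((4 * geomConst (1 / 2) + 8 * geomConst ε) * Λ ^ (-(1 / 2) + ε) *
          resThreshold a (min k (min k₁ k₂)) (max k (max k₁ k₂)) ^ (-(1 / 2) : ℝ))
        * (blockCard k k₁ k₂ * (ENNReal.ofReal (80 * K ^ 2) * A₁ *
          (ENNReal.ofReal (10 * K) * A₂)))) := by
  set L := invTimeScale a δ k with hLdef
  have hL0 : 0 < L := by linarith
  have hΛ : 1 ≤ Λ := hL.trans hΛ₀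
  have hΛ0 : 0 < Λ := by linarith
  have hηc := hη.continuous
  set γ : ℝ → ℂ := fun t => (η₀ (L * (t - tk)) : ℂ) with hγdef
  have hγ : IsBump K L γ := hηb.comp_affine hL0 tk
  -- the product is supported in an interval of length `5/2 · r` about `p`, which meets at most
  -- `5/2 · Λ r + 4` windows of the partition; as `Λ r ≥ 1` this is at most `7 Λ r`
  set r := min T (1 / L) with hr
  have hr0 : 0 < r := lt_min hT (by positivity)
  have hΛr : 1 ≤ Λ * r := by
    rw [hr, mul_min_of_nonneg _ _ hΛ0.le]
    refine le_min ?_ ?_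
    · rwa [div_le_iff₀ hT] at hTΛ
    · rw [mul_one_div, one_le_div hL0]; exact hΛ₀
  obtain ⟨p, hp⟩ : ∃ p, ∀ t, 5 / 4 * r < |t - p| → ∀ ξ, coefConv k₁ c₁ c₂ t ξ * γ t = 0 := by
    rcases min_choice T (1 / L) with h | h
    · refine ⟨0, fun t ht ξ => ?_⟩
      rw [hr, h, sub_zero] at ht
      simp [coefConv, hs t ht]
    · refine ⟨tk, fun t ht ξ => ?_⟩
      rw [hr, h] at ht
      have : η₀ (L * (t - tk)) = 0 := by
        apply hη.eq_zero
        rw [abs_mul, abs_of_pos hL0]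
        rw [mul_one_div, div_lt_iff₀' hL0] at ht
        exact ht
      simp [hγdef, this]
  set u : ℤ := ⌊Λ * (p - 5 / 4 * r)⌋ - 1 with hu
  set v : ℤ := ⌈Λ * (p + 5 / 4 * r)⌉ with hv
  set θ : ℤ → ℝ → ℂ := fun m t => (unitWindow (Λ * (t - m / Λ)) : ℂ) with hθdef
  have hθ : ∀ m, IsBump K Λ (θ m) := fun m => hwb.comp_affine hΛ0 _
  set G : ℝ → ℤ → ℂ := coefConv k₁ c₁ c₂ with hG
  have cG : ∀ ξ, Continuous fun t => G t ξ := continuous_coefConv h₁.continuous h₂.continuous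
  have i : ∀ m ξ, Integrable fun t => G t ξ * γ t * θ m t := fun m ξ =>
    (((cG ξ).mul hγ.continuous).mul (hθ m).continuous).integrable_of_hasCompactSupport
      ((hθ m).compact.mul_left)
  have hpart : ∀ ξ t, G t ξ * γ t = ∑ m ∈ Finset.Icc u v, G t ξ * γ t * θ m t := by
    intro ξ t
    by_cases ht : 5 / 4 * r < |t - p|
    · simp only [hp t ht ξ, zero_mul, Finset.sum_const_zero]
    · rw [← Finset.mul_sum]
      have h1 : ∑ m ∈ Finset.Icc u v, θ m t = 1 := by
        have h2 := sum_unitWindow (x := Λ * t) (u := u) (v := v) (by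
          rw [hu]; push_cast
          have := Int.floor_le (Λ * (p - 5 / 4 * r))
          have h3 : Λ * (p - 5 / 4 * r) ≤ Λ * t := by
            gcongr; rw [not_lt, abs_le] at ht; linarith [ht.1]
          linarith) (by
          have := Int.le_ceil (Λ * (p + 5 / 4 * r))
          have h3 : Λ * t ≤ Λ * (p + 5 / 4 * r) := by
            gcongr; rw [not_lt, abs_le] at ht; linarith [ht.2]
          linarith)
        have h3 : ∀ m : ℤ, Λ * (t - m / Λ) = Λ * t - m := fun m => by field_simp
        simp only [hθdef, h3]
        exact_mod_cast h2
      rw [h1, mul_one]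
  have hle : ∀ ξ τ, (freqBlock k).indicator (fun ξ τ =>
      ‖timeFourier (fun t => G t ξ * γ t) τ‖ₑ) ξ τ
      ≤ ∑ m ∈ Finset.Icc u v, (freqBlock k).indicator (fun ξ τ =>
        ‖timeFourier (fun t => G t ξ * γ t * θ m t) τ‖ₑ) ξ τ := by
    intro ξ τ
    by_cases hξ : ξ ∈ freqBlock k
    · simp only [Set.indicator_of_mem hξ]
      have : timeFourier (fun t => G t ξ * γ t) τ
          = ∑ m ∈ Finset.Icc u v, timeFourier (fun t => G t ξ * γ t * θ m t) τ := by
        unfold timeFourier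
        rw [← integral_finsetSum _ fun m _ => integrable_cexp_mul (i m ξ) τ]
        refine integral_congr_ae (Filter.Eventually.of_forall fun t => ?_)
        simp only
        rw [← Finset.mul_sum, ← hpart]
      rw [this]
      exact enorm_sum_le _ _
    · simp only [Set.indicator_of_notMem hξ]
      exact zero_le
  refine (resolventNorm_mono hle).trans ((hη.resolventNorm_finsetSum_le _ fun m ξ =>
    measurable_block (fun ξ => measurable_enorm_timeFourier (i m ξ)) ξ).trans ?_)
  refine (Finset.sum_le_sum fun m _ => window_interaction hη ha ha2 hk hk₁ hk₂ hL hΛ hε hε' hK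
    hηb h₁ h₂ hA₁ hΛ₁ hΛ₂ hL0 hγ (hθ m) (t' := (m + 1) / Λ) fun t ht => ?_).trans ?_
  · simp only [hθdef, unitWindow_scaled_eq_zero hΛ0 m ht, Complex.ofReal_zero]
  · rw [Finset.sum_const, nsmul_eq_mul]
    refine mul_le_mul' ?_ le_rfl
    rw [← ENNReal.ofReal_natCast]
    apply ENNReal.ofReal_le_ofReal
    rw [Int.card_Icc]
    have hf := Int.lt_floor_add_one (Λ * (p - 5 / 4 * r))
    have hc := Int.ceil_lt_add_one (Λ * (p + 5 / 4 * r))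
    have huv : ((v + 1 - u : ℤ) : ℝ) ≤ 7 * (Λ * r) := by
      rw [hu, hv]; push_cast
      nlinarith
    have : (((v + 1 - u).toNat : ℤ) : ℝ) ≤ 7 * (Λ * r) := by
      rcases le_total 0 (v + 1 - u) with h | h
      · rw [Int.toNat_of_nonneg h]; exact huv
      · rw [Int.toNat_of_nonpos h]; push_cast; positivity
    exact_mod_cast this

end Interaction

/-! ### The size of one interaction -/

/-- Where the power of `T` comes from: the number of windows of length `Λ⁻¹` is limited both by the
time scale of the output and by `T`. -/
lemma scale_bound {L L' T ε θ : ℝ} (hL : 1 ≤ L) (hLL : L ≤ L') (hT : 0 < T)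
    (hε : 0 ≤ ε) (hθ : 0 ≤ θ) (hεθ : θ + ε ≤ 1 / 2) :
    (max L' (1 / T)) ^ (1 / 2 + ε) * min T (1 / L)
      ≤ T ^ θ * L' ^ (1 / 2 + ε) * L ^ (-(1 - θ)) := by
  have hL0 : 0 < L := by linarith
  have hL'0 : 0 < L' := by linarith
  rcases le_total (1 / T) L' with h | h
  · rw [max_eq_left h]
    -- interpolate between the two bounds for the minimum
    have h1 : min T (1 / L) ≤ T ^ θ * L ^ (-(1 - θ)) := by
      have hm : 0 < min T (1 / L) := lt_min hT (by positivity)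
      calc min T (1 / L) = (min T (1 / L)) ^ θ * (min T (1 / L)) ^ (1 - θ) := by
            rw [← Real.rpow_add hm]; simp
        _ ≤ T ^ θ * (1 / L) ^ (1 - θ) := by
            gcongr
            · exact min_le_left _ _
            · linarith
            · exact min_le_right _ _
        _ = _ := by rw [one_div, Real.inv_rpow hL0.le, Real.rpow_neg hL0.le]
    calc _ ≤ L' ^ (1 / 2 + ε) * (T ^ θ * L ^ (-(1 - θ))) := by gcongr
      _ = _ := by ring
  · rw [max_eq_right h]
    have h2 : L' ≤ T⁻¹ := by rwa [one_div] at h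
    calc (1 / T) ^ (1 / 2 + ε) * min T (1 / L) ≤ (1 / T) ^ (1 / 2 + ε) * T := by
          gcongr; exact min_le_left _ _
      _ = T ^ θ * T⁻¹ ^ (-(1 / 2 - ε - θ)) := by
          rw [Real.inv_rpow hT.le, ← Real.rpow_neg hT.le, neg_neg, ← Real.rpow_add hT, one_div,
            Real.inv_rpow hT.le, ← Real.rpow_neg hT.le]
          nth_rw 2 [← Real.rpow_one T]
          rw [← Real.rpow_add hT]
          congr 1; ring
      _ ≤ T ^ θ * L' ^ (-(1 / 2 - ε - θ)) := by
          gcongr 1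
          exact Real.rpow_le_rpow_of_nonpos hL'0 h2 (by linarith)
      _ = T ^ θ * (L' ^ (1 / 2 + ε) * L' ^ (-(1 - θ))) := by
          rw [← Real.rpow_add hL'0]; congr 2; ring
      _ ≤ T ^ θ * (L' ^ (1 / 2 + ε) * L ^ (-(1 - θ))) := by
          have := Real.rpow_le_rpow_of_nonpos hL0 hLL (by linarith : -(1 - θ) ≤ 0)
          gcongr
      _ = _ := by ring

lemma blockCard_eq (k k₁ k₂ : ℕ) :
    blockCard k k₁ k₂ = ENNReal.ofReal (((2 : ℝ) ^ (min k (min k₁ k₂) + 3)) ^ (1 / 2 : ℝ)) := by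
  rw [blockCard, ← ofReal_rpow_half (by positivity), ENNReal.ofReal_pow (by norm_num),
    ENNReal.ofReal_ofNat]

/-- The smallest frequency cancels between the resonance function and the number of frequencies. -/
lemma blockCard_mul_resThreshold_le (a : ℝ) (n N : ℕ) :
    ((2 : ℝ) ^ (n + 3)) ^ (1 / 2 : ℝ) * resThreshold a n N ^ (-(1 / 2) : ℝ)
      ≤ 20 * ((2 : ℝ) ^ N) ^ (-(a / 2)) := by
  have h1 : (0 : ℝ) < 2 ^ n := by positivity
  have h2 : (0 : ℝ) < 2 ^ N := by positivity
  have e1 : ((2 : ℝ) ^ (n + 3)) ^ (1 / 2 : ℝ) = (2 ^ n) ^ (1 / 2 : ℝ) * 8 ^ (1 / 2 : ℝ) := by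
    rw [pow_add, Real.mul_rpow h1.le (by norm_num)]; norm_num
  have e2 : resThreshold a n N ^ (-(1 / 2) : ℝ)
      = (2 ^ n) ^ (-(1 / 2) : ℝ) * (2 ^ N) ^ (-(a / 2)) * 48 ^ (1 / 2 : ℝ) := by
    unfold resThreshold
    rw [Real.div_rpow (by positivity) (by norm_num), Real.mul_rpow h1.le (by positivity),
      ← Real.rpow_mul h2.le, Real.rpow_neg (by norm_num : (0 : ℝ) ≤ 48), div_inv_eq_mul]
    congr 3; ring
  have e3 : ((2 : ℝ) ^ n) ^ (1 / 2 : ℝ) * (2 ^ n) ^ (-(1 / 2) : ℝ) = 1 := by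
    rw [← Real.rpow_add h1]; simp
  have e4 : (8 : ℝ) ^ (1 / 2 : ℝ) * 48 ^ (1 / 2 : ℝ) ≤ 20 := by
    rw [← Real.mul_rpow (by norm_num) (by norm_num), ← Real.sqrt_eq_rpow,
      Real.sqrt_le_left (by norm_num)]
    norm_num
  rw [e1, e2]
  calc _ = (((2 : ℝ) ^ n) ^ (1 / 2 : ℝ) * (2 ^ n) ^ (-(1 / 2) : ℝ))
        * ((8 : ℝ) ^ (1 / 2 : ℝ) * 48 ^ (1 / 2 : ℝ)) * (2 ^ N) ^ (-(a / 2)) := by ring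
    _ ≤ _ := by rw [e3, one_mul]; gcongr

/-- The constant of the estimate for one interaction. -/
noncomputable def interactionConst (K ϑ : ℝ) : ℝ :=
  2 * 7 * 20 * 800 * K ^ 3 * (4 * geomConst (1 / 2) + 8 * geomConst ϑ)

lemma interactionConst_nonneg {K ϑ : ℝ} (hK : 0 ≤ K) (hϑ : 0 < ϑ) : 0 ≤ interactionConst K ϑ := by
  have := (geomConst_pos (ε := 1 / 2) (by norm_num)).le
  have := (geomConst_pos hϑ).le
  unfold interactionConst; positivity

/-- The size of the interaction of the blocks `k₁, k₂` at the output block `k`, up to constants, the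
derivative included, where `N` is the largest of the three indices. -/
noncomputable def interactionSize (a δ ϑ : ℝ) (k N : ℕ) : ℝ :=
  (2 : ℝ) ^ (k * (1 - (2 - a + δ) * (1 - ϑ)) - N * (a / 2 - (2 - a + δ) * (1 / 2 + ϑ)))

/-- The powers of the time scales, of the resonance function and of the number of frequencies
combine to the size of an interaction. -/
lemma interaction_arith {a δ ϑ K T : ℝ} (hK : 0 ≤ K) (hϑ : 0 < ϑ) (hϑ' : ϑ ≤ 1 / 4)
    (hM : 0 ≤ 2 - a + δ) (hT : 0 < T) {k N : ℕ} (n : ℕ) (hkN : k ≤ N) :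
    2 ^ (k + 1) * (7 * (max (invTimeScale a δ N) (1 / T) * min T (1 / invTimeScale a δ k)) *
      ((4 * geomConst (1 / 2) + 8 * geomConst ϑ)
        * (max (invTimeScale a δ N) (1 / T)) ^ (-(1 / 2) + ϑ)
        * resThreshold a n N ^ (-(1 / 2) : ℝ) *
        (((2 : ℝ) ^ (n + 3)) ^ (1 / 2 : ℝ) * (80 * K ^ 2 * (10 * K)))))
      ≤ interactionConst K ϑ * T ^ ϑ * interactionSize a δ ϑ k N := by
  set L := invTimeScale a δ k with hL
  set L' := invTimeScale a δ N with hL'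
  set Λ := max L' (1 / T) with hΛ
  set g := 4 * geomConst (1 / 2) + 8 * geomConst ϑ with hg
  have hg0 : 0 ≤ g := by
    have := (geomConst_pos (ε := 1 / 2) (by norm_num)).le
    have := (geomConst_pos hϑ).le
    positivity
  have hL1 : 1 ≤ L := one_le_invTimeScale hM k
  have hLL : L ≤ L' := by
    rw [hL, hL']; unfold invTimeScale
    apply Real.rpow_le_rpow_of_exponent_le (by norm_num)
    have : (k : ℝ) ≤ N := by exact_mod_cast hkN
    gcongr
  have hΛ0 : 0 < Λ := lt_max_of_lt_left (by linarith)
  have hb := scale_bound hL1 hLL hT hϑ.le hϑ.le (by linarith)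
  have hc := blockCard_mul_resThreshold_le a n N
  have hΛe : Λ * Λ ^ (-(1 / 2) + ϑ) = Λ ^ (1 / 2 + ϑ) := by
    nth_rw 1 [← Real.rpow_one Λ]
    rw [← Real.rpow_add hΛ0]; congr 1; ring
  have hsize : (2 : ℝ) ^ k * (L' ^ (1 / 2 + ϑ) * L ^ (-(1 - ϑ))) * ((2 : ℝ) ^ N) ^ (-(a / 2))
      = interactionSize a δ ϑ k N := by
    rw [hL, hL', interactionSize]
    unfold invTimeScale
    rw [← Real.rpow_mul (by norm_num), ← Real.rpow_mul (by norm_num), ← Real.rpow_natCast 2 k,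
      ← Real.rpow_natCast 2 N, ← Real.rpow_mul (by norm_num), ← Real.rpow_add (by norm_num),
      ← Real.rpow_add (by norm_num), ← Real.rpow_add (by norm_num)]
    congr 1; ring
  have hR := resThreshold_pos a n N
  calc _ = 2 * 7 * 800 * K ^ 3 * g * 2 ^ k * ((Λ * Λ ^ (-(1 / 2) + ϑ)) * min T (1 / L))
        * (((2 : ℝ) ^ (n + 3)) ^ (1 / 2 : ℝ) * resThreshold a n N ^ (-(1 / 2) : ℝ)) := by ring
    _ ≤ 2 * 7 * 800 * K ^ 3 * g * 2 ^ k * (T ^ ϑ * L' ^ (1 / 2 + ϑ) * L ^ (-(1 - ϑ)))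
        * (20 * ((2 : ℝ) ^ N) ^ (-(a / 2))) := by
        rw [hΛe]
        have : 0 ≤ L' := by linarith
        gcongr
    _ = 2 * 7 * 20 * 800 * K ^ 3 * g * T ^ ϑ *
        ((2 : ℝ) ^ k * (L' ^ (1 / 2 + ϑ) * L ^ (-(1 - ϑ))) * ((2 : ℝ) ^ N) ^ (-(a / 2))) := by ring
    _ = _ := by rw [hsize, interactionConst]

/-- The estimate for one interaction, with `Λ` taken as the inverse of the shortest time scale
involved. The factor `2^{k+1}` accounts for the derivative. -/
lemma block_interaction_size {η₀ : ℝ → ℝ} {a δ : ℝ} {k k₁ k₂ : ℕ} {A₁ A₂ : ℝ≥0∞}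
    {c₁ c₂ : ℝ → ℤ → ℂ} (hη : IsModulationCutoff η₀) (ha : 1 ≤ a) (ha2 : a ≤ 2) (hk : 1 ≤ k)
    (hk₁ : 1 ≤ k₁) (hk₂ : 1 ≤ k₂) {ϑ K T : ℝ} (hϑ : 0 < ϑ) (hϑ' : ϑ ≤ 1 / 4) (hK : 0 ≤ K)
    (hM : 0 ≤ 2 - a + δ)
    (hηb : IsBump K 1 fun t => (η₀ t : ℂ)) (hwb : IsBump K 1 fun t => (unitWindow t : ℂ))
    (h₁ : IsBlockFamily η₀ a δ k₁ A₁ c₁) (h₂ : IsBlockFamily η₀ a δ k₂ A₂ c₂) (hA₁ : A₁ ≠ ⊤)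
    (hT : 0 < T) (hs : ∀ t, 5 / 4 * T < |t| → ∀ ξ, c₁ t ξ = 0) (tk : ℝ) :
    2 ^ (k + 1) * resolventNorm η₀ a (invTimeScale a δ k) ((freqBlock k).indicator fun ξ τ =>
        ‖timeFourier (fun t => coefConv k₁ c₁ c₂ t ξ *
          (η₀ (invTimeScale a δ k * (t - tk)) : ℂ)) τ‖ₑ)
      ≤ ENNReal.ofReal (interactionConst K ϑ * T ^ ϑ
          * interactionSize a δ ϑ k (max k (max k₁ k₂))) * (A₁ * A₂) := by
  set N := max k (max k₁ k₂) with hN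
  have mono : ∀ j : ℕ, j ≤ N → invTimeScale a δ j ≤ max (invTimeScale a δ N) (1 / T) := by
    intro j hj
    refine le_trans ?_ (le_max_left _ _)
    unfold invTimeScale
    apply Real.rpow_le_rpow_of_exponent_le (by norm_num)
    have : (j : ℝ) ≤ N := by exact_mod_cast hj
    gcongr
  have key := block_interaction (k := k) hη ha ha2 hk hk₁ hk₂ hϑ (by linarith : ϑ ≤ 1 / 2) hK hηb
    hwb h₁ h₂ hA₁ (one_le_invTimeScale hM k) (mono k (by omega)) (mono k₁ (by omega))
    (mono k₂ (by omega)) hT (le_max_right _ _) hs tk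
  refine (mul_le_mul' le_rfl key).trans ?_
  rw [blockCard_eq, ← hN]
  set n := min k (min k₁ k₂)
  have har := interaction_arith (K := K) (n := n) hK hϑ hϑ' hM hT (le_max_left k (max k₁ k₂))
  rw [← hN] at har
  have hg0 : 0 ≤ 4 * geomConst (1 / 2) + 8 * geomConst ϑ := by
    have := (geomConst_pos (ε := 1 / 2) (by norm_num)).le
    have := (geomConst_pos hϑ).le
    positivity
  have hR := resThreshold_pos a n N
  have hL := invTimeScale_pos a δ k
  have hL' := invTimeScale_pos a δ N
  have hΛ0 : 0 < max (invTimeScale a δ N) (1 / T) := lt_max_of_lt_left hL'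
  have hm0 : 0 < min T (1 / invTimeScale a δ k) := lt_min hT (by positivity)
  refine le_trans (le_of_eq ?_) (mul_le_mul' (ENNReal.ofReal_le_ofReal har) le_rfl)
  rw [show (2 : ℝ≥0∞) ^ (k + 1) = ENNReal.ofReal (2 ^ (k + 1)) by
    rw [ENNReal.ofReal_pow (by norm_num), ENNReal.ofReal_ofNat]]
  rw [ENNReal.ofReal_mul (p := 2 ^ (k + 1)) (by positivity),
    ENNReal.ofReal_mul (p := 7 * _) (by positivity),
    ENNReal.ofReal_mul (p := _ * resThreshold a n N ^ (-(1 / 2) : ℝ)) (by positivity),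
    ENNReal.ofReal_mul (p := ((2 : ℝ) ^ (n + 3)) ^ (1 / 2 : ℝ)) (by positivity),
    ENNReal.ofReal_mul (p := 80 * K ^ 2) (by positivity)]
  ring

/-! ### Fourier coefficients on the torus -/

lemma continuous_char (ξ : ℤ) :
    Continuous fun x : ℝ => Complex.exp (-(Complex.I * (x : ℂ) * (ξ : ℂ))) := by fun_prop

lemma intervalIntegrable_char {f : ℝ → ℂ} (hf : Continuous f) (ξ : ℤ) :
    IntervalIntegrable (fun x : ℝ => f x * Complex.exp (-(Complex.I * (x : ℂ) * (ξ : ℂ))))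
      volume 0 (2 * Real.pi) :=
  (hf.mul (continuous_char ξ)).intervalIntegrable _ _

lemma fourierT_sub {f g : ℝ → ℂ} (hf : Continuous f) (hg : Continuous g) (ξ : ℤ) :
    fourierT (fun x => f x - g x) ξ = fourierT f ξ - fourierT g ξ := by
  unfold fourierT
  rw [← intervalIntegral.integral_sub (intervalIntegrable_char hf ξ) (intervalIntegrable_char hg ξ)]
  simp_rw [sub_mul]

lemma fourierT_add {f g : ℝ → ℂ} (hf : Continuous f) (hg : Continuous g) (ξ : ℤ) :
    fourierT (fun x => f x + g x) ξ = fourierT f ξ + fourierT g ξ := by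
  unfold fourierT
  rw [← intervalIntegral.integral_add (intervalIntegrable_char hf ξ) (intervalIntegrable_char hg ξ)]
  simp_rw [add_mul]

lemma fourierT_mul_const (f : ℝ → ℂ) (c : ℂ) (ξ : ℤ) :
    fourierT (fun x => f x * c) ξ = fourierT f ξ * c := by
  unfold fourierT
  rw [← intervalIntegral.integral_mul_const]
  congr 1
  funext x
  ring

lemma integral_char (ξ η : ℤ) :
    ∫ x in (0 : ℝ)..(2 * Real.pi), Complex.exp (Complex.I * (x : ℂ) * (η : ℂ)) *
      Complex.exp (-(Complex.I * (x : ℂ) * (ξ : ℂ)))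
      = if η = ξ then ((2 * Real.pi : ℝ) : ℂ) else 0 := by
  have e : ∀ x : ℝ, Complex.exp (Complex.I * (x : ℂ) * (η : ℂ)) *
      Complex.exp (-(Complex.I * (x : ℂ) * (ξ : ℂ)))
      = Complex.exp ((Complex.I * ((η - ξ : ℤ) : ℂ)) * x) := by
    intro x
    rw [← Complex.exp_add]
    congr 1
    push_cast
    ring
  simp_rw [e]
  split_ifs with h
  · simp [h]
  · have hne : Complex.I * ((η - ξ : ℤ) : ℂ) ≠ 0 :=
      mul_ne_zero Complex.I_ne_zero (by exact_mod_cast sub_ne_zero.2 h)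
    rw [integral_exp_mul_complex hne]
    have h1 : Complex.exp (Complex.I * ((η - ξ : ℤ) : ℂ) * ((2 * Real.pi : ℝ) : ℂ)) = 1 := by
      rw [Complex.exp_eq_one_iff]
      exact ⟨η - ξ, by push_cast; ring⟩
    rw [h1]
    simp

/-- The trigonometric polynomial with Fourier coefficients `c ξ`, `ξ ∈ S`. -/
noncomputable def trigPoly (S : Finset ℤ) (c : ℤ → ℂ) (x : ℝ) : ℂ :=
  (1 / (2 * Real.pi) : ℂ) * ∑ ξ ∈ S, c ξ * Complex.exp (Complex.I * (x : ℂ) * (ξ : ℂ))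

lemma continuous_trigPoly (S : Finset ℤ) (c : ℤ → ℂ) : Continuous (trigPoly S c) := by
  unfold trigPoly; fun_prop

lemma periodic_trigPoly (S : Finset ℤ) (c : ℤ → ℂ) :
    Function.Periodic (trigPoly S c) (2 * Real.pi) := by
  intro x
  unfold trigPoly
  congr 1
  refine Finset.sum_congr rfl fun ξ _ => ?_
  congr 1
  rw [Complex.exp_eq_exp_iff_exists_int]
  exact ⟨ξ, by push_cast; ring⟩

lemma fourierT_trigPoly (S : Finset ℤ) (c : ℤ → ℂ) (ξ : ℤ) :
    fourierT (trigPoly S c) ξ = if ξ ∈ S then c ξ else 0 := by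
  have hpi : ((2 * Real.pi : ℝ) : ℂ) ≠ 0 := by exact_mod_cast (by positivity : (2 * Real.pi) ≠ 0)
  unfold fourierT trigPoly
  simp_rw [mul_assoc (1 / (2 * Real.pi) : ℂ), Finset.sum_mul, mul_assoc (c _)]
  rw [intervalIntegral.integral_const_mul, intervalIntegral.integral_finsetSum
    (fun η _ => Continuous.intervalIntegrable (by fun_prop) _ _)]
  simp_rw [intervalIntegral.integral_const_mul, integral_char]
  simp only [mul_ite, mul_zero, Finset.sum_ite_eq']
  split_ifs
  · push_cast at hpi ⊢
    field_simp
  · simp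

lemma fourierT_deriv {f : ℝ → ℂ} (hf : ContDiff ℝ ∞ f) (hp : Function.Periodic f (2 * Real.pi))
    (ξ : ℤ) : fourierT (deriv f) ξ = Complex.I * ξ * fourierT f ξ := by
  have hd : Continuous (deriv f) := hf.continuous_deriv (by simp)
  have hdiff : Differentiable ℝ f := hf.differentiable (by simp)
  have he : ∀ x : ℝ, HasDerivAt (fun x : ℝ => Complex.exp (-(Complex.I * (x : ℂ) * (ξ : ℂ))))
      (-(Complex.I * ξ) * Complex.exp (-(Complex.I * (x : ℂ) * (ξ : ℂ)))) x := by
    intro x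
    have h1 : HasDerivAt (fun x : ℝ => -(Complex.I * (x : ℂ) * (ξ : ℂ))) (-(Complex.I * ξ)) x := by
      have := (((hasDerivAt_id x).ofReal_comp.const_mul Complex.I).mul_const (ξ : ℂ)).neg
      simpa [Pi.neg_def] using this
    have := h1.cexp
    rwa [mul_comm] at this
  unfold fourierT
  have key := intervalIntegral.integral_deriv_mul_eq_sub (a := 0) (b := 2 * Real.pi)
    (u := f) (u' := deriv f) (fun x _ => (hdiff x).hasDerivAt) (fun x _ => he x)
    (hd.intervalIntegrable _ _) (Continuous.intervalIntegrable (by fun_prop) _ _)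
  have hb : f (2 * Real.pi) * Complex.exp (-(Complex.I * ((2 * Real.pi : ℝ) : ℂ) * (ξ : ℂ)))
      - f 0 * Complex.exp (-(Complex.I * ((0 : ℝ) : ℂ) * (ξ : ℂ))) = 0 := by
    have h1 : Complex.exp (-(Complex.I * ((2 * Real.pi : ℝ) : ℂ) * (ξ : ℂ))) = 1 := by
      rw [Complex.exp_eq_one_iff]
      exact ⟨-ξ, by push_cast; ring⟩
    have h2 : f (2 * Real.pi) = f 0 := by simpa using hp 0
    rw [h1, h2]; simp
  rw [hb, intervalIntegral.integral_add (intervalIntegrable_char hd ξ)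
    (Continuous.intervalIntegrable (by have := hf.continuous; fun_prop) _ _)] at key
  rw [eq_neg_of_add_eq_zero_left key, ← intervalIntegral.integral_neg,
    ← intervalIntegral.integral_const_mul]
  congr 1
  funext x
  ring

lemma IsHInfty.deriv {f : ℝ → ℂ} (hf : IsHInfty f) : IsHInfty (deriv f) :=
  ⟨((contDiff_infty_iff_deriv (𝕜 := ℝ)).1 hf.1).2, fun x => by
    rw [← deriv_comp_add_const, show (fun y => f (y + 2 * Real.pi)) = f from funext hf.2]⟩

lemma IsHInfty.mul {f g : ℝ → ℂ} (hf : IsHInfty f) (hg : IsHInfty g) :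
    IsHInfty fun x => f x * g x := ⟨hf.1.mul hg.1, hf.2.mul hg.2⟩

lemma IsHInfty.sub {f g : ℝ → ℂ} (hf : IsHInfty f) (hg : IsHInfty g) :
    IsHInfty fun x => f x - g x := ⟨hf.1.sub hg.1, hf.2.sub hg.2⟩

lemma norm_fourierT_le {f : ℝ → ℂ} {C : ℝ} (hC : ∀ x, ‖f x‖ ≤ C) (ξ : ℤ) :
    ‖fourierT f ξ‖ ≤ C * (2 * Real.pi) := by
  unfold fourierT
  have := intervalIntegral.norm_integral_le_of_norm_le_const (a := 0) (b := 2 * Real.pi)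
    (C := C) (f := fun x : ℝ => f x * Complex.exp (-(Complex.I * (x : ℂ) * (ξ : ℂ)))) (fun x _ => by
      have h := norm_cexp_neg_I_mul x ξ
      push_cast at h
      rw [norm_mul, h, mul_one]
      exact hC x)
  rwa [sub_zero, abs_of_pos (by positivity)] at this

lemma exists_norm_le_of_periodic {f : ℝ → ℂ} (hf : Continuous f)
    (hp : Function.Periodic f (2 * Real.pi)) : ∃ C, 0 ≤ C ∧ ∀ x, ‖f x‖ ≤ C := by
  obtain ⟨C, hC⟩ := (hp.isBounded_of_continuous (by positivity) hf).exists_norm_le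
  have h : ∀ x, ‖f x‖ ≤ C := fun x => hC _ ⟨x, rfl⟩
  exact ⟨C, (norm_nonneg _).trans (h 0), h⟩

/-- The Fourier coefficients of a smooth function decay rapidly: the multiplier `1 + ξ²` is
`1 - ∂ₓ²`. -/
lemma IsHInfty.decay (n : ℕ) : ∀ {f : ℝ → ℂ}, IsHInfty f →
    ∃ C : ℝ, 0 ≤ C ∧ ∀ ξ : ℤ, (1 + (ξ : ℝ) ^ 2) ^ n * ‖fourierT f ξ‖ ≤ C := by
  induction n with
  | zero =>
    intro f hf
    obtain ⟨C, hC0, hC⟩ := exists_norm_le_of_periodic hf.1.continuous hf.2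
    exact ⟨C * (2 * Real.pi), by positivity, fun ξ => by simpa using norm_fourierT_le hC ξ⟩
  | succ n ih =>
    intro f hf
    obtain ⟨C, hC0, hC⟩ := ih (hf.sub hf.deriv.deriv)
    refine ⟨C, hC0, fun ξ => ?_⟩
    have := hC ξ
    rw [fourierT_sub hf.1.continuous hf.deriv.deriv.1.continuous,
      fourierT_deriv hf.deriv.1 hf.deriv.2, fourierT_deriv hf.1 hf.2,
      show fourierT f ξ - Complex.I * ξ * (Complex.I * ξ * fourierT f ξ)
        = ((1 + (ξ : ℝ) ^ 2 : ℝ) : ℂ) * fourierT f ξ by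
          push_cast; linear_combination (-(ξ : ℂ) ^ 2 * fourierT f ξ) * Complex.I_sq,
      norm_mul, Complex.norm_real, Real.norm_of_nonneg (by positivity)] at this
    rw [pow_succ, mul_assoc]
    exact this

lemma summable_int_inv_sq : Summable fun ξ : ℤ => (1 + (ξ : ℝ) ^ 2)⁻¹ := by
  have h := (Real.summable_one_div_int_pow (p := 2)).2 (by norm_num)
  refine Summable.of_norm_bounded_eventually h ?_
  rw [Filter.eventually_cofinite]
  refine (Set.finite_singleton (0 : ℤ)).subset fun ξ hξ => ?_
  by_contra h0
  apply hξ
  have h0' : (0 : ℝ) < (ξ : ℝ) ^ 2 := by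
    have : (ξ : ℝ) ≠ 0 := by exact_mod_cast h0
    positivity
  rw [Real.norm_of_nonneg (by positivity), one_div]
  exact inv_anti₀ h0' (by linarith)

lemma IsHInfty.summable_norm {f : ℝ → ℂ} (hf : IsHInfty f) : Summable fun ξ => ‖fourierT f ξ‖ := by
  obtain ⟨C, h, hC⟩ := hf.decay 1
  refine Summable.of_nonneg_of_le (fun _ => norm_nonneg _) (fun ξ => ?_)
    (summable_int_inv_sq.mul_left C)
  have e := hC ξ
  rw [pow_one] at e
  rw [← div_eq_mul_inv, le_div_iff₀' (by positivity)]
  exact e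

/-- Fourier inversion on the torus. -/
lemma IsHInfty.hasSum {f : ℝ → ℂ} (hf : IsHInfty f) (x : ℝ) :
    HasSum (fun ξ : ℤ => fourierT f ξ * Complex.exp (Complex.I * (x : ℂ) * (ξ : ℂ)))
      (2 * Real.pi * f x) := by
  have : Fact (0 < 2 * Real.pi) := ⟨by positivity⟩
  have hpi : (Real.pi : ℂ) ≠ 0 := by exact_mod_cast Real.pi_ne_zero
  set F : C(AddCircle (2 * Real.pi), ℂ) := ⟨hf.2.lift, by
    exact continuous_coinduced_dom.2 hf.1.continuous⟩ with hF
  have hFx : ∀ y : ℝ, F (y : AddCircle (2 * Real.pi)) = f y := fun y => hf.2.lift_coe y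
  have hcoef : ∀ n : ℤ, fourierCoeff F n = (1 / (2 * Real.pi) : ℂ) * fourierT f n := by
    intro n
    rw [fourierCoeff_eq_intervalIntegral _ _ 0, zero_add, fourierT, Complex.real_smul]
    congr 1
    · push_cast; rfl
    · congr 1
      funext y
      rw [hFx, fourier_coe_apply, smul_eq_mul, mul_comm]
      congr 2
      push_cast
      field_simp
  have hs : Summable (fourierCoeff F) := by
    simp_rw [funext hcoef]
    exact hf.summable_norm.of_norm.mul_left _
  have h := (has_pointwise_sum_fourier_series_of_summable hs (x : AddCircle (2 * Real.pi))).mul_left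
    (2 * Real.pi : ℂ)
  rw [hFx] at h
  have e : (fun ξ : ℤ => fourierT f ξ * Complex.exp (Complex.I * (x : ℂ) * (ξ : ℂ)))
      = fun ξ => (2 * Real.pi : ℂ) *
        (fourierCoeff F ξ • fourier ξ (x : AddCircle (2 * Real.pi))) := by
    funext ξ
    rw [hcoef, fourier_coe_apply, smul_eq_mul]
    have : Complex.exp (2 * Real.pi * Complex.I * ξ * x / ((2 * Real.pi : ℝ) : ℂ))
        = Complex.exp (Complex.I * (x : ℂ) * (ξ : ℂ)) := by
      congr 1
      push_cast
      field_simp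
    rw [this]
    field_simp
  rw [e]
  exact h

/-- The Fourier coefficients of a product are given by convolution. -/
lemma IsHInfty.hasSum_conv {f g : ℝ → ℂ} (hf : IsHInfty f) (hg : IsHInfty g) (ξ : ℤ) :
    HasSum (fun η : ℤ => fourierT f η * fourierT g (ξ - η))
      (2 * Real.pi * fourierT (fun x => f x * g x) ξ) := by
  obtain ⟨C, hC0, hC⟩ := exists_norm_le_of_periodic hg.1.continuous hg.2
  have hgc := hg.1.continuous
  have key := intervalIntegral.hasSum_integral_of_dominated_convergence (μ := volume) (a := 0)
    (b := 2 * Real.pi) (F := fun (η : ℤ) (x : ℝ) =>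
      fourierT f η * Complex.exp (Complex.I * (x : ℂ) * (η : ℂ)) *
        (g x * Complex.exp (-(Complex.I * (x : ℂ) * (ξ : ℂ)))))
    (f := fun x => 2 * Real.pi * f x * (g x * Complex.exp (-(Complex.I * (x : ℂ) * (ξ : ℂ)))))
    (fun η _ => ‖fourierT f η‖ * C)
    (fun η => Continuous.aestronglyMeasurable (by fun_prop))
    (fun η => Filter.Eventually.of_forall fun x _ => by
      have h1 := norm_cexp_I_mul x η
      have h2 := norm_cexp_neg_I_mul x ξ
      push_cast at h1 h2
      rw [norm_mul, norm_mul, norm_mul, h1, h2, mul_one, mul_one]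
      gcongr
      exact hC x)
    (Filter.Eventually.of_forall fun x _ => hf.summable_norm.mul_right C)
    (by simp)
    (Filter.Eventually.of_forall fun x _ => (hf.hasSum x).mul_right _)
  have e1 : ∀ η : ℤ, ∫ x in (0 : ℝ)..(2 * Real.pi),
      fourierT f η * Complex.exp (Complex.I * (x : ℂ) * (η : ℂ)) *
        (g x * Complex.exp (-(Complex.I * (x : ℂ) * (ξ : ℂ))))
      = fourierT f η * fourierT g (ξ - η) := by
    intro η
    rw [fourierT, fourierT, ← intervalIntegral.integral_const_mul]
    congr 1
    funext x
    have : Complex.exp (Complex.I * (x : ℂ) * (η : ℂ)) *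
        Complex.exp (-(Complex.I * (x : ℂ) * (ξ : ℂ)))
        = Complex.exp (-(Complex.I * (x : ℂ) * ((ξ - η : ℤ) : ℂ))) := by
      rw [← Complex.exp_add]
      congr 1
      push_cast
      ring
    rw [← this]
    ring
  simp_rw [e1] at key
  have e2 : (2 * Real.pi * fourierT (fun x => f x * g x) ξ : ℂ) = ∫ x in (0 : ℝ)..(2 * Real.pi),
      2 * Real.pi * f x * (g x * Complex.exp (-(Complex.I * (x : ℂ) * (ξ : ℂ)))) := by
    unfold fourierT
    rw [← intervalIntegral.integral_const_mul]
    congr 1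
    funext x
    ring
  rw [e2]
  exact key

/-! ### Sobolev norms -/

/-- The weight `⟨ξ⟩^σ`. -/
noncomputable def sobolevWeight (σ : ℝ) (ξ : ℤ) : ℝ≥0∞ :=
  ENNReal.ofReal ((1 + (ξ : ℝ) ^ 2) ^ (σ / 2))

lemma sobolevNorm_eq (σ : ℝ) (f : ℝ → ℂ) :
    sobolevNorm σ f = l2Norm count fun ξ => sobolevWeight σ ξ * ‖fourierT f ξ‖ₑ := by
  rw [sobolevNorm, l2Norm_count]
  congr 1
  refine tsum_congr fun ξ => ?_
  have h0 : 0 ≤ 1 + (ξ : ℝ) ^ 2 := by positivity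
  rw [mul_pow, sobolevWeight, ← ENNReal.ofReal_pow (by positivity),
    ← Real.rpow_mul_natCast h0]
  norm_num

lemma sobolevWeight_mono {σ σ' : ℝ} (h : σ ≤ σ') (ξ : ℤ) :
    sobolevWeight σ ξ ≤ sobolevWeight σ' ξ := by
  unfold sobolevWeight
  apply ENNReal.ofReal_le_ofReal
  apply Real.rpow_le_rpow_of_exponent_le
  · nlinarith [sq_nonneg (ξ : ℝ)]
  · linarith

lemma sobolevNorm_mono {σ σ' : ℝ} (h : σ ≤ σ') (f : ℝ → ℂ) : sobolevNorm σ f ≤ sobolevNorm σ' f := by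
  rw [sobolevNorm_eq, sobolevNorm_eq]
  refine l2Norm_mono fun ξ => ?_
  gcongr
  exact sobolevWeight_mono h ξ

lemma sobolevNorm_add_le (σ : ℝ) {f g : ℝ → ℂ} (hf : Continuous f) (hg : Continuous g) :
    sobolevNorm σ (fun x => f x + g x) ≤ sobolevNorm σ f + sobolevNorm σ g := by
  simp_rw [sobolevNorm_eq]
  refine le_trans (l2Norm_mono fun ξ => ?_)
    (l2Norm_add_le (measurable_of_countable _) (measurable_of_countable _))
  rw [fourierT_add hf hg, ← mul_add]
  gcongr
  exact enorm_add_le _ _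

lemma sobolevNorm_deriv_le (σ : ℝ) {f : ℝ → ℂ} (hf : IsHInfty f) :
    sobolevNorm σ (deriv f) ≤ sobolevNorm (σ + 1) f := by
  rw [sobolevNorm_eq, sobolevNorm_eq]
  refine l2Norm_mono fun ξ => ?_
  rw [fourierT_deriv hf.1 hf.2, enorm_mul, ← mul_assoc]
  gcongr
  have h0 : 0 < 1 + (ξ : ℝ) ^ 2 := by positivity
  rw [sobolevWeight, sobolevWeight, ← ofReal_norm, ← ENNReal.ofReal_mul (by positivity)]
  apply ENNReal.ofReal_le_ofReal
  rw [add_div, Real.rpow_add h0, norm_mul, Complex.norm_I, one_mul, Complex.norm_intCast]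
  gcongr
  rw [← Real.sqrt_eq_rpow]
  apply Real.le_sqrt_of_sq_le
  rw [sq_abs]
  linarith

lemma IsHInfty.sobolevNorm_ne_top {f : ℝ → ℂ} (hf : IsHInfty f) (σ : ℝ) : sobolevNorm σ f ≠ ⊤ := by
  obtain ⟨n, hn⟩ := exists_nat_ge σ
  obtain ⟨C, hC0, hC⟩ := hf.decay n
  obtain ⟨C1, hC10, hC1⟩ := hf.decay 1
  unfold sobolevNorm
  refine ENNReal.rpow_ne_top_of_nonneg (by norm_num) ?_
  have hb : ∀ ξ : ℤ, ENNReal.ofReal ((1 + (ξ : ℝ) ^ 2) ^ σ) * ‖fourierT f ξ‖ₑ ^ 2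
      ≤ ENNReal.ofReal (C * C1 * (1 + (ξ : ℝ) ^ 2)⁻¹) := by
    intro ξ
    have h0 : 0 < 1 + (ξ : ℝ) ^ 2 := by positivity
    rw [← ofReal_norm, ← ENNReal.ofReal_pow (norm_nonneg _), ← ENNReal.ofReal_mul (by positivity)]
    apply ENNReal.ofReal_le_ofReal
    have h1 : (1 + (ξ : ℝ) ^ 2) ^ σ ≤ (1 + (ξ : ℝ) ^ 2) ^ n := by
      rw [← Real.rpow_natCast (1 + (ξ : ℝ) ^ 2) n]
      exact Real.rpow_le_rpow_of_exponent_le (by nlinarith [sq_nonneg (ξ : ℝ)]) hn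
    have h2 : ‖fourierT f ξ‖ ≤ C1 * (1 + (ξ : ℝ) ^ 2)⁻¹ := by
      rw [← div_eq_mul_inv, le_div_iff₀' h0]
      simpa using hC1 ξ
    calc _ ≤ ((1 + (ξ : ℝ) ^ 2) ^ n * ‖fourierT f ξ‖) * ‖fourierT f ξ‖ := by
          rw [sq ‖fourierT f ξ‖, ← mul_assoc]; gcongr
      _ ≤ C * (C1 * (1 + (ξ : ℝ) ^ 2)⁻¹) := by
          gcongr
          exact hC ξ
      _ = _ := by ring
  refine ne_top_of_le_ne_top ?_ (ENNReal.tsum_le_tsum hb)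
  rw [← ENNReal.ofReal_tsum_of_nonneg (fun ξ => by positivity)
    (summable_int_inv_sq.mul_left _)]
  exact ENNReal.ofReal_ne_top

/-- The constant of the product estimate in Sobolev spaces. -/
noncomputable def sobolevConst (σ : ℝ) : ℝ≥0∞ :=
  ENNReal.ofReal (2 ^ (σ / 2)) * l2Norm count (sobolevWeight (-1))

lemma sobolevConst_ne_top (σ : ℝ) : sobolevConst σ ≠ ⊤ := by
  refine ENNReal.mul_ne_top ENNReal.ofReal_ne_top ?_
  rw [l2Norm_count]
  refine ENNReal.rpow_ne_top_of_nonneg (by norm_num) ?_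
  have : ∀ ξ : ℤ, sobolevWeight (-1) ξ ^ 2 = ENNReal.ofReal ((1 + (ξ : ℝ) ^ 2)⁻¹) := by
    intro ξ
    have h0 : 0 < 1 + (ξ : ℝ) ^ 2 := by positivity
    rw [sobolevWeight, ← ENNReal.ofReal_pow (by positivity), ← Real.rpow_natCast,
      ← Real.rpow_mul h0.le]
    norm_num [Real.rpow_neg_one]
  simp_rw [this]
  rw [← ENNReal.ofReal_tsum_of_nonneg (fun ξ => by positivity) summable_int_inv_sq]
  exact ENNReal.ofReal_ne_top

/-- The Sobolev spaces form an algebra, up to the loss of one derivative on one factor. -/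
lemma sobolevNorm_mul_le {σ : ℝ} (hσ : 0 ≤ σ) {f g : ℝ → ℂ} (hf : IsHInfty f) (hg : IsHInfty g) :
    sobolevNorm σ (fun x => f x * g x)
      ≤ sobolevConst σ * (sobolevNorm (σ + 1) f * sobolevNorm σ g) := by
  set p : ℤ → ℝ≥0∞ := fun ξ => sobolevWeight σ ξ * ‖fourierT f ξ‖ₑ
  set q : ℤ → ℝ≥0∞ := fun ξ => sobolevWeight σ ξ * ‖fourierT g ξ‖ₑ
  have hpt : ∀ ξ, sobolevWeight σ ξ * ‖fourierT (fun x => f x * g x) ξ‖ₑ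
      ≤ ENNReal.ofReal (2 ^ (σ / 2)) * ∑' η, p η * q (ξ - η) := by
    intro ξ
    have h1 : ‖fourierT (fun x => f x * g x) ξ‖ₑ
        ≤ ∑' η, ‖fourierT f η‖ₑ * ‖fourierT g (ξ - η)‖ₑ := by
      have hs := hf.hasSum_conv hg ξ
      have h2 : ‖(2 * Real.pi : ℂ) * fourierT (fun x => f x * g x) ξ‖ₑ
          ≤ ∑' η, ‖fourierT f η * fourierT g (ξ - η)‖ₑ := by
        rw [← hs.tsum_eq]
        exact enorm_tsum_le_tsum_enorm
      simp_rw [enorm_mul (fourierT f _)] at h2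
      refine le_trans ?_ h2
      rw [enorm_mul]
      refine le_mul_of_one_le_left' ?_
      rw [← ofReal_norm, ENNReal.one_le_ofReal, norm_mul, Complex.norm_ofNat, Complex.norm_real,
        Real.norm_of_nonneg Real.pi_pos.le]
      linarith [Real.pi_gt_three]
    refine (mul_le_mul' le_rfl h1).trans ?_
    rw [← ENNReal.tsum_mul_left, ← ENNReal.tsum_mul_left]
    refine ENNReal.tsum_le_tsum fun η => ?_
    have hw : sobolevWeight σ ξ
        ≤ ENNReal.ofReal (2 ^ (σ / 2)) * (sobolevWeight σ η * sobolevWeight σ (ξ - η)) := by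
      unfold sobolevWeight
      rw [← ENNReal.ofReal_mul (by positivity), ← ENNReal.ofReal_mul (by positivity)]
      apply ENNReal.ofReal_le_ofReal
      rw [← Real.mul_rpow (by positivity) (by positivity), ← Real.mul_rpow (by norm_num)
        (by positivity)]
      gcongr
      push_cast
      nlinarith [sq_nonneg ((η : ℝ) - (ξ - η)), sq_nonneg ((η : ℝ) * (ξ - η))]
    calc _ ≤ (ENNReal.ofReal (2 ^ (σ / 2)) * (sobolevWeight σ η * sobolevWeight σ (ξ - η)))
          * (‖fourierT f η‖ₑ * ‖fourierT g (ξ - η)‖ₑ) := by gcongr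
      _ = _ := by simp only [p, q]; ring
  rw [sobolevNorm_eq]
  refine (l2Norm_mono hpt).trans ?_
  rw [l2Norm_const_mul _ (measurable_of_countable _), sobolevConst, mul_assoc]
  gcongr
  have hy := l2Norm_conv_le (μ := count) (measurable_of_countable p) (measurable_of_countable q)
  simp only [lintegral_count] at hy
  refine hy.trans ?_
  rw [← mul_assoc, sobolevNorm_eq, sobolevNorm_eq]
  gcongr
  have hcs := lintegral_mul_le_l2Norm (μ := count) (measurable_of_countable (sobolevWeight (-1)))
    (measurable_of_countable fun ξ => sobolevWeight (σ + 1) ξ * ‖fourierT f ξ‖ₑ)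
  rw [lintegral_count] at hcs
  refine le_trans (le_of_eq (tsum_congr fun ξ => ?_)) hcs
  have h0 : 0 < 1 + (ξ : ℝ) ^ 2 := by positivity
  have hw : sobolevWeight σ ξ = sobolevWeight (-1) ξ * sobolevWeight (σ + 1) ξ := by
    unfold sobolevWeight
    rw [← ENNReal.ofReal_mul (by positivity), ← Real.rpow_add h0]
    congr 2; ring
  simp only [p]
  rw [hw, mul_assoc]

/-- `∂ₓ(uv)` is again continuous in time with values in `H^∞`. -/
lemma IsCHInfty.dxMul {T : ℝ} {u v : ℝ → ℝ → ℂ} (hu : IsCHInfty T u) (hv : IsCHInfty T v) :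
    IsCHInfty T (dxMul u v) := by
  refine ⟨fun t ht => ((hu.1 t ht).mul (hv.1 t ht)).deriv, fun σ t₀ ht₀ => ?_⟩
  -- one derivative for `∂ₓ`, and nonnegative exponents for the product estimate
  set s := max σ 0 + 1 with hs
  have hs0 : 0 ≤ s := by positivity
  have Hu := hu.1 t₀ ht₀
  have Hv := hv.1 t₀ ht₀
  set Du : ℝ → ℝ≥0∞ := fun t => sobolevNorm (s + 1) (fun x => u t x - u t₀ x)
  set Dv : ℝ → ℝ≥0∞ := fun t => sobolevNorm (s + 1) (fun x => v t x - v t₀ x)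
  set U := sobolevNorm (s + 1) (u t₀)
  set V := sobolevNorm (s + 1) (v t₀)
  have hU : U ≠ ⊤ := Hu.sobolevNorm_ne_top _
  have hV : V ≠ ⊤ := Hv.sobolevNorm_ne_top _
  have tu : Filter.Tendsto Du (nhdsWithin t₀ (Set.Icc (-T) T)) (nhds 0) := hu.2 _ t₀ ht₀
  have tv : Filter.Tendsto Dv (nhdsWithin t₀ (Set.Icc (-T) T)) (nhds 0) := hv.2 _ t₀ ht₀
  have hlim : Filter.Tendsto (fun t => sobolevConst s * (Du t * (V + Dv t))
      + sobolevConst s * (U * Dv t)) (nhdsWithin t₀ (Set.Icc (-T) T)) (nhds 0) := by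
    have hc := sobolevConst_ne_top s
    have h1 : Filter.Tendsto (fun t => Du t * (V + Dv t)) (nhdsWithin t₀ (Set.Icc (-T) T))
        (nhds (0 * (V + 0))) :=
      ENNReal.Tendsto.mul tu (Or.inr (by simpa using hV)) (tendsto_const_nhds.add tv)
        (Or.inr ENNReal.zero_ne_top)
    have h2 : Filter.Tendsto (fun t => U * Dv t) (nhdsWithin t₀ (Set.Icc (-T) T))
        (nhds (U * 0)) := ENNReal.Tendsto.const_mul tv (Or.inr hU)
    have h3 := (ENNReal.Tendsto.const_mul h1 (Or.inr hc)).add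
      (ENNReal.Tendsto.const_mul h2 (Or.inr hc))
    simpa using h3
  refine tendsto_of_tendsto_of_tendsto_of_le_of_le' tendsto_const_nhds hlim
    (Filter.Eventually.of_forall fun _ => zero_le) ?_
  filter_upwards [self_mem_nhdsWithin] with t ht
  have Hut := hu.1 t ht
  have Hvt := hv.1 t ht
  have Hdu := Hut.sub Hu
  have Hdv := Hvt.sub Hv
  -- `u v - u₀ v₀ = (u - u₀) v + u₀ (v - v₀)`
  have hfun : (fun x => ShortTimeBO.dxMul u v t x - ShortTimeBO.dxMul u v t₀ x)
      = deriv (fun x => (u t x - u t₀ x) * v t x + u t₀ x * (v t x - v t₀ x)) := by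
    have e : (fun x => (u t x - u t₀ x) * v t x + u t₀ x * (v t x - v t₀ x))
        = (fun x => u t x * v t x) - fun x => u t₀ x * v t₀ x := by
      funext x; simp only [Pi.sub_apply]; ring
    rw [e]
    funext x
    rw [deriv_sub ((Hut.mul Hvt).1.differentiable (by simp) x)
      ((Hu.mul Hv).1.differentiable (by simp) x)]
    rfl
  rw [hfun]
  have P1 := Hdu.mul Hvt
  have P2 := Hu.mul Hdv
  have P : IsHInfty fun x => (u t x - u t₀ x) * v t x + u t₀ x * (v t x - v t₀ x) :=
    ⟨P1.1.add P2.1, P1.2.add P2.2⟩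
  have hvt : sobolevNorm (s + 1) (v t) ≤ V + Dv t := by
    have : v t = fun x => v t₀ x + (v t x - v t₀ x) := by funext x; ring
    rw [this]
    refine (sobolevNorm_add_le _ Hv.1.continuous Hdv.1.continuous).trans_eq ?_
    simp only [Dv, V]
  calc _ ≤ sobolevNorm (max σ 0) (deriv fun x =>
        (u t x - u t₀ x) * v t x + u t₀ x * (v t x - v t₀ x)) := sobolevNorm_mono (le_max_left _ _) _
    _ ≤ sobolevNorm s fun x => (u t x - u t₀ x) * v t x + u t₀ x * (v t x - v t₀ x) :=
        sobolevNorm_deriv_le _ P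
    _ ≤ sobolevNorm s (fun x => (u t x - u t₀ x) * v t x)
        + sobolevNorm s (fun x => u t₀ x * (v t x - v t₀ x)) :=
        sobolevNorm_add_le _ P1.1.continuous P2.1.continuous
    _ ≤ sobolevConst s * (Du t * sobolevNorm s (v t))
        + sobolevConst s * (U * sobolevNorm s (fun x => v t x - v t₀ x)) :=
        add_le_add (sobolevNorm_mul_le hs0 Hdu Hvt) (sobolevNorm_mul_le hs0 Hu Hdv)
    _ ≤ _ := by
        have h1 : s ≤ s + 1 := by linarith
        gcongr
        · exact (sobolevNorm_mono h1 _).trans hvt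
        · exact sobolevNorm_mono h1 _

/-! ### The Littlewood-Paley decomposition -/

namespace IsSpaceCutoff

variable {ρ : ℝ → ℝ} (hρ : IsSpaceCutoff ρ)

include hρ

lemma apply_abs (x : ℝ) : ρ |x| = ρ x := by
  rcases abs_choice x with h | h <;> rw [h]
  exact hρ.even x

lemma eq_zero {x : ℝ} (hx : 2 ≤ |x|) : ρ x = 0 := by
  by_contra h
  have := hρ.support_subset h
  rw [Metric.mem_ball, dist_zero_right, Real.norm_eq_abs] at this
  linarith

lemma le_of_abs_le {x y : ℝ} (h : |x| ≤ |y|) : ρ y ≤ ρ x := by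
  rw [← hρ.apply_abs x, ← hρ.apply_abs y]
  exact hρ.antitone (abs_nonneg x) (abs_nonneg y) h

lemma le_one (x : ℝ) : ρ x ≤ 1 := by
  rw [← hρ.eq_one 0 (by simp)]
  exact hρ.le_of_abs_le (by simp)

lemma lpSymbol_nonneg (k : ℕ) (ξ : ℤ) : 0 ≤ lpSymbol ρ k ξ := by
  match k with
  | 0 => rw [lpSymbol]; split_ifs <;> norm_num
  | 1 => rw [lpSymbol]; split_ifs; exacts [le_rfl, hρ.nonneg _]
  | k + 2 =>
    rw [lpSymbol, sub_nonneg]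
    apply hρ.le_of_abs_le
    have hp : (0 : ℝ) < 2 ^ (k + 1) := by positivity
    have hp2 : (0 : ℝ) < 2 ^ (k + 2) := by positivity
    rw [abs_div, abs_div, abs_of_pos hp, abs_of_pos hp2]
    exact div_le_div_of_nonneg_left (abs_nonneg _) hp
      (pow_le_pow_right₀ one_le_two (by omega))

lemma lpSymbol_le_one (k : ℕ) (ξ : ℤ) : lpSymbol ρ k ξ ≤ 1 := by
  match k with
  | 0 => rw [lpSymbol]; split_ifs <;> norm_num
  | 1 => rw [lpSymbol]; split_ifs; exacts [zero_le_one, hρ.le_one _]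
  | k + 2 =>
    rw [lpSymbol]
    linarith [hρ.le_one ((ξ : ℝ) / 2 ^ (k + 2)), hρ.nonneg ((ξ : ℝ) / 2 ^ (k + 1))]

lemma lpSymbol_eq_zero {k : ℕ} {ξ : ℤ} (h : ξ ∉ freqBlock k) : lpSymbol ρ k ξ = 0 := by
  match k with
  | 0 =>
    have : ξ ≠ 0 := h
    simp [lpSymbol, this]
  | 1 =>
    rw [lpSymbol]
    split_ifs with h0
    · rfl
    · apply hρ.eq_zero
      have h1 : 1 ≤ |ξ| := Int.one_le_abs h0
      have h2 : ¬ |ξ| ≤ 2 ^ 2 := fun h2 => h ⟨by simpa using h1, h2⟩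
      have h3 : (4 : ℝ) ≤ |(ξ : ℝ)| := by
        rw [← Int.cast_abs]; exact_mod_cast (not_le.1 h2).le
      rw [abs_div, abs_two, le_div_iff₀ two_pos]
      linarith
  | k + 2 =>
    rw [lpSymbol]
    have hp : (0 : ℝ) < 2 ^ (k + 1) := by positivity
    have hp' : (2 : ℝ) ^ (k + 2) = 2 * 2 ^ (k + 1) := by ring
    have hp2 : (0 : ℝ) < 2 ^ (k + 2) := by positivity
    by_cases h1 : 2 ^ (k + 1) ≤ |ξ|
    · have h2 : ¬ |ξ| ≤ 2 ^ (k + 1 + 2) := fun h2 => h ⟨h1, h2⟩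
      have h3 : (2 : ℝ) ^ (k + 3) ≤ |(ξ : ℝ)| := by
        rw [← Int.cast_abs]; exact_mod_cast (not_le.1 h2).le
      have h4 : (2 : ℝ) ^ (k + 3) = 4 * 2 ^ (k + 1) := by ring
      rw [hρ.eq_zero, hρ.eq_zero, sub_zero]
      · rw [abs_div, abs_of_pos hp, le_div_iff₀ hp]; linarith
      · rw [abs_div, abs_of_pos hp2, le_div_iff₀ hp2]; linarith
    · have h3 : |(ξ : ℝ)| ≤ 2 ^ (k + 1) := by
        rw [← Int.cast_abs]; exact_mod_cast (not_le.1 h1).le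
      rw [hρ.eq_one, hρ.eq_one, sub_self]
      · rw [abs_div, abs_of_pos hp, div_le_one hp]; exact h3
      · rw [abs_div, abs_of_pos hp2, div_le_one hp2]; linarith

lemma sum_lpSymbol (n : ℕ) (ξ : ℤ) :
    ∑ k ∈ Finset.range (n + 2), lpSymbol ρ k ξ = ρ ((ξ : ℝ) / 2 ^ (n + 1)) := by
  induction n with
  | zero =>
    rw [Finset.sum_range_succ, Finset.sum_range_succ, Finset.sum_range_zero]
    by_cases h : ξ = 0
    · simp [lpSymbol, h, hρ.eq_one 0]
    · simp [lpSymbol, h]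
  | succ n ih =>
    rw [Finset.sum_range_succ, ih]
    simp only [lpSymbol]
    ring

lemma hasSum_lpSymbol (ξ : ℤ) : HasSum (fun k => lpSymbol ρ k ξ) 1 := by
  rw [hasSum_iff_tendsto_nat_of_nonneg fun k => hρ.lpSymbol_nonneg k ξ,
    ← Filter.tendsto_add_atTop_iff_nat 2]
  refine tendsto_const_nhds.congr' ?_
  obtain ⟨N, hN⟩ := pow_unbounded_of_one_lt |(ξ : ℝ)| one_lt_two
  filter_upwards [Filter.eventually_ge_atTop N] with n hn
  rw [hρ.sum_lpSymbol, hρ.eq_one]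
  have hp : (0 : ℝ) < 2 ^ (n + 1) := by positivity
  rw [abs_div, abs_of_pos hp, div_le_one hp]
  exact hN.le.trans (pow_le_pow_right₀ one_le_two (by omega))

lemma lpProj_eq_trigPoly (k : ℕ) (f : ℝ → ℂ) :
    lpProj ρ k f = trigPoly (blockFinset k) fun ξ => lpSymbol ρ k ξ * fourierT f ξ := by
  funext x
  unfold lpProj trigPoly
  congr 1
  refine tsum_eq_sum fun ξ hξ => ?_
  rw [mem_blockFinset] at hξ
  rw [hρ.lpSymbol_eq_zero hξ]
  simp

lemma fourierT_lpProj (k : ℕ) (f : ℝ → ℂ) (ξ : ℤ) :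
    fourierT (lpProj ρ k f) ξ = lpSymbol ρ k ξ * fourierT f ξ := by
  rw [hρ.lpProj_eq_trigPoly, fourierT_trigPoly]
  split_ifs with h
  · rfl
  · rw [mem_blockFinset] at h
    simp [hρ.lpSymbol_eq_zero h]

end IsSpaceCutoff

/-! ### Extensions as families of Fourier coefficients -/

lemma localizedFourier_eq (η₀ : ℝ → ℝ) (a δ : ℝ) (k : ℕ) (tk : ℝ) (w : ℝ → ℝ → ℂ) (τ : ℝ) (ξ : ℤ) :
    localizedFourier η₀ a δ k tk w τ ξ
      = timeFourier (fun t => fourierT (w t) ξ * (η₀ (invTimeScale a δ k * (t - tk)) : ℂ)) τ := by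
  unfold localizedFourier spaceTimeFourier timeFourier
  simp_rw [fourierT_mul_const]

lemma sobolevNorm_zero_eq (f : ℝ → ℂ) :
    sobolevNorm 0 f = l2Norm count fun ξ => ‖fourierT f ξ‖ₑ := by
  simp [sobolevNorm_eq, sobolevWeight]

namespace IsC0Ek

variable {k : ℕ} {w : ℝ → ℝ → ℂ} (hw : IsC0Ek k w)

include hw

lemma continuous_fourierT (ξ : ℤ) : Continuous fun t => fourierT (w t) ξ := by
  rw [continuous_iff_continuousAt]
  intro t₀
  have h := hw.2.1 t₀ trivial
  rw [nhdsWithin_univ] at h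
  rw [ContinuousAt, tendsto_iff_edist_tendsto_0]
  refine tendsto_of_tendsto_of_tendsto_of_le_of_le tendsto_const_nhds h (fun _ => zero_le)
    fun t => ?_
  simp only [sobolevNorm_zero_eq]
  rw [edist_eq_enorm_sub, ← fourierT_sub (hw.1 t).1 (hw.1 t₀).1]
  exact le_l2Norm_count (fun ξ => ‖fourierT (fun x => w t x - w t₀ x) ξ‖ₑ) ξ

lemma hasCompactSupport_fourierT (ξ : ℤ) : HasCompactSupport fun t => fourierT (w t) ξ :=
  HasCompactSupport.intro (isCompact_Icc (a := (-4 : ℝ)) (b := 4)) fun t ht => by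
    simp [hw.2.2 t ht, fourierT]

/-- An element of `C₀(ℝ, E_k)` yields a family controlled by its norm. -/
lemma isBlockFamily {η₀ : ℝ → ℝ} (hη : IsModulationCutoff η₀) (a δ : ℝ) :
    IsBlockFamily η₀ a δ k (2 * fkNorm η₀ a δ k w) fun t ξ => fourierT (w t) ξ where
  continuous := hw.continuous_fourierT
  compact := hw.hasCompactSupport_fourierT
  support ξ hξ t := (hw.1 t).2.2 ξ hξ
  bound t' := by
    have hc := hη.continuous
    have hm : ∀ ξ : ℤ, Measurable fun τ => ‖timeFourier (fun t => fourierT (w t) ξ *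
        (η₀ (invTimeScale a δ k * (t - t')) : ℂ)) τ‖ₑ := fun ξ =>
      measurable_enorm_timeFourier <|
        ((hw.continuous_fourierT ξ).mul (by fun_prop)).integrable_of_hasCompactSupport
          ((hw.hasCompactSupport_fourierT ξ).mul_right)
    refine (hη.modBound_modNorm (a := a) hm).mono ?_
    gcongr
    refine le_trans (le_of_eq ?_)
      (le_iSup (fun tk => xNorm η₀ a (localizedFourier η₀ a δ k tk w)) t')
    rw [xNorm_eq_modNorm]
    simp_rw [localizedFourier_eq]

end IsC0Ek

lemma IsBlockFamily.zero {η₀ : ℝ → ℝ} (a δ : ℝ) (k : ℕ) (A : ℝ≥0∞) :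
    IsBlockFamily η₀ a δ k A fun _ _ => 0 where
  continuous _ := continuous_const
  compact _ := HasCompactSupport.zero
  support _ _ _ := rfl
  bound t' := by
    have h : (fun (ξ : ℤ) (τ : ℝ) => ‖timeFourier (fun t => (0 : ℂ) *
        (η₀ (invTimeScale a δ k * (t - t')) : ℂ)) τ‖ₑ) = fun _ _ => 0 := by
      funext ξ τ; simp [timeFourier]
    rw [h]
    refine ⟨fun _ => measurable_const, ?_, fun R _ => ?_⟩
    · simp [l2Norm]
    · have h' : highMod a R (fun _ _ => 0) = fun _ _ => 0 := by
        funext ξ τ; simp [highMod]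
      rw [h']; simp [mixedNorm, l2Norm]

section Extension

variable {ρ η₀ : ℝ → ℝ} (hρ : IsSpaceCutoff ρ) (hη : IsModulationCutoff η₀) {a δ T : ℝ}
  {u : ℝ → ℝ → ℂ}

include hρ hη

/-- A near-optimal extension of `P_k u`. If the norm vanishes there is no extension of comparable
norm, but then `P_k u` vanishes on the time interval and the zero extension is used. -/
lemma exists_isBlockFamily {k : ℕ} (hu : fkNormT η₀ a δ T k (fun t => lpProj ρ k (u t)) ≠ ⊤) :
    ∃ c : ℝ → ℤ → ℂ,
      IsBlockFamily η₀ a δ k (4 * fkNormT η₀ a δ T k (fun t => lpProj ρ k (u t))) c ∧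
      ∀ t ∈ Set.Icc (-T) T, ∀ ξ, c t ξ = lpSymbol ρ k ξ * fourierT (u t) ξ := by
  set F := fkNormT η₀ a δ T k (fun t => lpProj ρ k (u t)) with hF
  have hext : ∀ B, F < B → ∃ w, IsC0Ek k w ∧ (∀ t ∈ Set.Icc (-T) T, ∀ ξ,
      fourierT (w t) ξ = lpSymbol ρ k ξ * fourierT (u t) ξ) ∧ fkNorm η₀ a δ k w < B := by
    intro B hB
    rw [hF, fkNormT] at hB
    simp only [iInf_lt_iff] at hB
    obtain ⟨w, hw, hwu, hlt⟩ := hB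
    refine ⟨w, hw, fun t ht ξ => ?_, hlt⟩
    rw [hwu t ht, hρ.fourierT_lpProj]
  by_cases h0 : F = 0
  · refine ⟨fun _ _ => 0, IsBlockFamily.zero a δ k _, fun t ht ξ => ?_⟩
    symm
    rw [← enorm_eq_zero, ← nonpos_iff_eq_zero]
    refine ENNReal.le_of_forall_pos_le_add fun ε hε _ => ?_
    obtain ⟨w, hw, hwu, hlt⟩ := hext (ε / 2) (by
      rw [h0]; exact ENNReal.div_pos (by exact_mod_cast hε.ne') (by simp))
    rw [zero_add, ← hwu t ht ξ]
    calc _ ≤ 2 * fkNorm η₀ a δ k w :=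
          (le_l2Norm_count (fun ξ => ‖fourierT (w t) ξ‖ₑ) ξ).trans
            ((hw.isBlockFamily hη a δ).l2Norm_le hη t)
      _ ≤ 2 * (ε / 2) := by gcongr
      _ = ε := ENNReal.mul_div_cancel (by simp) (by simp)
  · obtain ⟨w, hw, hwu, hlt⟩ := hext (2 * F) (by
      rw [two_mul]; exact ENNReal.lt_add_right hu h0)
    refine ⟨fun t ξ => fourierT (w t) ξ, ?_, hwu⟩
    have h := hw.isBlockFamily hη a δ
    refine ⟨h.continuous, h.compact, h.support, fun t' => (h.bound t').mono ?_⟩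
    calc 2 * fkNorm η₀ a δ k w ≤ 2 * (2 * F) := by gcongr
      _ = 4 * F := by rw [← mul_assoc]; norm_num

/-- Families representing all blocks of a function with mean zero, cut off to the time scale `T`.
The block of frequency zero is represented by the zero family. -/
lemma exists_isBlockFamily_localized (hT : 0 < T)
    (hu : ∀ k, fkNormT η₀ a δ T k (fun t => lpProj ρ k (u t)) ≠ ⊤) (hm : HasVanishingMean T u)
    {K : ℝ} (hK : 0 ≤ K) (hηb : IsBump K 1 fun t => (η₀ t : ℂ)) :
    ∃ c : ℕ → ℝ → ℤ → ℂ,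
      (∀ k, IsBlockFamily η₀ a δ k
        (ENNReal.ofReal (32 * K) * fkNormT η₀ a δ T k (fun t => lpProj ρ k (u t))) (c k)) ∧
      (∀ k, ∀ t ∈ Set.Icc (-T) T, ∀ ξ, c k t ξ = lpSymbol ρ k ξ * fourierT (u t) ξ) ∧
      (∀ k t, 5 / 4 * T < |t| → ∀ ξ, c k t ξ = 0) ∧ ∀ t ξ, c 0 t ξ = 0 := by
  choose c hc hcu using fun k => exists_isBlockFamily hρ hη (hu k)
  have hT' : 0 < 1 / T := by positivity
  have hb := hηb.comp_affine hT' 0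
  simp only [sub_zero] at hb
  refine ⟨fun k t ξ => if k = 0 then 0 else c k t ξ * (η₀ (1 / T * t) : ℂ), fun k => ?_,
    fun k t ht ξ => ?_, fun k t ht ξ => ?_, fun t ξ => if_pos rfl⟩
  · by_cases h : k = 0
    · simp only [h, if_true]
      exact IsBlockFamily.zero a δ 0 _
    · simp only [h, if_false]
      have := (hc k).mul_bump hη hK hT' hb
      rw [← mul_assoc, ← ENNReal.ofReal_ofNat 4, ← ENNReal.ofReal_mul (by positivity)] at this
      convert this using 3
      ring
  · dsimp only
    split_ifs with h
    · by_cases hξ : ξ = 0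
      · have h0 : fourierT (u t) 0 = 0 := by
          unfold fourierT
          simpa using hm t ht
        rw [hξ, h0, mul_zero]
      · simp [h, lpSymbol, hξ]
    · have : η₀ (1 / T * t) = 1 := by
        apply hη.eq_one
        rw [abs_mul, abs_of_pos hT', one_div_mul_eq_div, div_le_one hT]
        exact abs_le.2 ht
      rw [hcu k t ht, this, Complex.ofReal_one, mul_one]
  · have : η₀ (1 / T * t) = 0 := by
      apply hη.eq_zero
      rw [abs_mul, abs_of_pos hT', one_div_mul_eq_div, lt_div_iff₀ hT]
      exact ht
    simp only [this, Complex.ofReal_zero, mul_zero, ite_self]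

end Extension

/-! ### The extension of the product -/

/-- The triples of blocks for which a product of functions in `E_{k₁}` and `E_{k₂}`, both without
mean, may have a nonzero component in `E_k`: the two largest indices are comparable. -/
abbrev Interacts (k : ℕ) (p : ℕ × ℕ) : Prop :=
  1 ≤ p.1 ∧ 1 ≤ p.2 ∧ k ≤ max p.1 p.2 + 3 ∧ p.1 ≤ max k p.2 + 3 ∧ p.2 ≤ max k p.1 + 3

lemma abs_le_of_mem_freqBlock {k : ℕ} {ξ : ℤ} (h : ξ ∈ freqBlock k) : |ξ| ≤ 2 ^ (k + 1) := by
  have := freqBlock_subset_Icc k h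
  rw [Finset.coe_Icc, Set.mem_Icc] at this
  exact abs_le.2 this

lemma block_le_max_add {k k₁ k₂ : ℕ} {ξ ξ₁ ξ₂ : ℤ} (h : ξ ∈ freqBlock k) (h₁ : ξ₁ ∈ freqBlock k₁)
    (h₂ : ξ₂ ∈ freqBlock k₂) (hle : |ξ| ≤ |ξ₁| + |ξ₂|) : k ≤ max k₁ k₂ + 3 := by
  cases k with
  | zero => omega
  | succ k =>
    by_contra! hk
    have e1 := abs_le_of_mem_freqBlock h₁
    have e2 := abs_le_of_mem_freqBlock h₂
    have e3 : (2 : ℤ) ^ (k₁ + 1) ≤ 2 ^ (max k₁ k₂ + 1) :=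
      pow_le_pow_right₀ (by norm_num) (by omega)
    have e4 : (2 : ℤ) ^ (k₂ + 1) ≤ 2 ^ (max k₁ k₂ + 1) :=
      pow_le_pow_right₀ (by norm_num) (by omega)
    have e5 : (2 : ℤ) ^ (max k₁ k₂ + 3) ≤ 2 ^ k := pow_le_pow_right₀ (by norm_num) (by omega)
    have e6 : (2 : ℤ) ^ (max k₁ k₂ + 3) = 4 * 2 ^ (max k₁ k₂ + 1) := by ring
    have e7 : (0 : ℤ) < 2 ^ (max k₁ k₂ + 1) := by positivity
    have e8 := h.1
    omega

/-- Comparability of the two largest indices leaves `O(k + 1)` diagonals. -/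
lemma tsum_interacts_le (A B : ℕ → ℝ≥0∞) (k : ℕ) :
    ∑' p : ℕ × ℕ, (if Interacts k p then A p.1 * B p.2 else 0)
      ≤ ((2 * k + 7 : ℕ) : ℝ≥0∞) * (l2Norm count A * l2Norm count B) := by
  set N : ℝ≥0∞ := ((2 * k + 7 : ℕ) : ℝ≥0∞)
  -- interacting indices differ by at most `k + 3`; apply Cauchy-Schwarz to the sum over these pairs
  set near : ℕ → ℕ → Prop := fun i j => i ≤ j + k + 3 ∧ j ≤ i + k + 3
  have hcard : ∀ i, ∑' j, (if near i j then (1 : ℝ≥0∞) else 0) ≤ N := by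
    intro i
    rw [tsum_eq_sum (s := Finset.Icc (i - (k + 3)) (i + (k + 3))) fun j hj => if_neg fun h => hj (by
      rw [Finset.mem_Icc]; obtain ⟨h1, h2⟩ := h; omega)]
    refine (Finset.sum_le_sum (g := fun _ => (1 : ℝ≥0∞)) fun j _ => by
      split_ifs; exacts [le_rfl, zero_le]).trans ?_
    rw [Finset.sum_const, nsmul_eq_mul, mul_one, Nat.card_Icc]
    simp only [N]
    exact_mod_cast (by omega : i + (k + 3) + 1 - (i - (k + 3)) ≤ 2 * k + 7)
  have hcs := lintegral_mul_le_l2Norm (μ := (count : Measure (ℕ × ℕ)))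
    (f := fun p => if near p.1 p.2 then A p.1 else 0)
    (g := fun p => if near p.1 p.2 then B p.2 else 0)
    (measurable_of_countable _) (measurable_of_countable _)
  rw [lintegral_count] at hcs
  have hA : l2Norm count (fun p : ℕ × ℕ => if near p.1 p.2 then A p.1 else 0) ^ 2
      ≤ N * l2Norm count A ^ 2 := by
    rw [l2Norm_sq, l2Norm_sq, lintegral_count, lintegral_count, ENNReal.tsum_prod',
      ← ENNReal.tsum_mul_left]
    refine ENNReal.tsum_le_tsum fun i => ?_
    calc _ = (∑' j, if near i j then (1 : ℝ≥0∞) else 0) * A i ^ 2 := by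
          rw [← ENNReal.tsum_mul_right]
          refine tsum_congr fun j => ?_
          split_ifs <;> simp
      _ ≤ _ := mul_le_mul' (hcard i) le_rfl
  have hB : l2Norm count (fun p : ℕ × ℕ => if near p.1 p.2 then B p.2 else 0) ^ 2
      ≤ N * l2Norm count B ^ 2 := by
    rw [l2Norm_sq, l2Norm_sq, lintegral_count, lintegral_count, ENNReal.tsum_prod',
      ENNReal.tsum_comm, ← ENNReal.tsum_mul_left]
    refine ENNReal.tsum_le_tsum fun j => ?_
    calc _ = (∑' i, if near j i then (1 : ℝ≥0∞) else 0) * B j ^ 2 := by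
          rw [← ENNReal.tsum_mul_right]
          refine tsum_congr fun i => ?_
          simp only [near, and_comm]
          split_ifs <;> simp
      _ ≤ _ := mul_le_mul' (hcard j) le_rfl
  calc _ ≤ ∑' p : ℕ × ℕ, (if near p.1 p.2 then A p.1 else 0) *
        (if near p.1 p.2 then B p.2 else 0) := by
        refine ENNReal.tsum_le_tsum fun p => ?_
        split_ifs with h1 h2
        · exact le_rfl
        · exact absurd ⟨by omega, by omega⟩ h2
        · exact zero_le
        · exact zero_le
    _ ≤ _ := hcs
    _ ≤ N * (l2Norm count A * l2Norm count B) := by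
        refine le_of_sq_le_sq ?_
        rw [mul_pow, mul_pow, mul_pow]
        refine (mul_le_mul' hA hB).trans_eq ?_
        ring

lemma tsum_interacts_ne_top {A B : ℕ → ℝ≥0∞} (hA : l2Norm count A ≠ ⊤)
    (hB : l2Norm count B ≠ ⊤) (k : ℕ) :
    ∑' p : ℕ × ℕ, (if Interacts k p then A p.1 * B p.2 else 0) ≠ ⊤ :=
  ne_top_of_le_ne_top (ENNReal.mul_ne_top (ENNReal.natCast_ne_top _) (ENNReal.mul_ne_top hA hB))
    (tsum_interacts_le A B k)

section Output

variable {ρ η₀ : ℝ → ℝ} {a δ T : ℝ} {A B : ℕ → ℝ≥0∞} {c₁ c₂ : ℕ → ℝ → ℤ → ℂ}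

/-- The coefficients of `P_k ∂ₓ(uv)` in terms of those of the blocks of `u` and `v`. -/
noncomputable def outCoef (ρ : ℝ → ℝ) (c₁ c₂ : ℕ → ℝ → ℤ → ℂ) (k : ℕ) (t : ℝ) (ξ : ℤ) : ℂ :=
  lpSymbol ρ k ξ * (Complex.I * ξ / (2 * Real.pi)) *
    ∑' p : ℕ × ℕ, coefConv p.1 (c₁ p.1) (c₂ p.2) t ξ

lemma outCoef_eq_zero (hρ : IsSpaceCutoff ρ) {k : ℕ} {ξ : ℤ} (hξ : ξ ∉ freqBlock k) (t : ℝ) :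
    outCoef ρ c₁ c₂ k t ξ = 0 := by
  simp [outCoef, hρ.lpSymbol_eq_zero hξ]

lemma enorm_coefConv_le {k₁ k₂ : ℕ} {A₁ A₂ : ℝ≥0∞} {c₁ c₂ : ℝ → ℤ → ℂ}
    (hη : IsModulationCutoff η₀) (h₁ : IsBlockFamily η₀ a δ k₁ A₁ c₁)
    (h₂ : IsBlockFamily η₀ a δ k₂ A₂ c₂) (t : ℝ) (ξ : ℤ) :
    ‖coefConv k₁ c₁ c₂ t ξ‖ₑ ≤ A₁ * A₂ := by
  calc ‖coefConv k₁ c₁ c₂ t ξ‖ₑ ≤ ∑ ξ₁ ∈ blockFinset k₁, ‖c₁ t ξ₁‖ₑ * ‖c₂ t (ξ - ξ₁)‖ₑ := by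
        refine (enorm_sum_le _ _).trans_eq (Finset.sum_congr rfl fun _ _ => enorm_mul _ _)
    _ ≤ ∑' ξ₁, ‖c₁ t ξ₁‖ₑ * ‖c₂ t (ξ - ξ₁)‖ₑ := ENNReal.sum_le_tsum _
    _ ≤ _ := conv_count_le_l2Norm (fun ξ => ‖c₁ t ξ‖ₑ) (fun ξ => ‖c₂ t ξ‖ₑ) ξ
    _ ≤ _ := mul_le_mul' (h₁.l2Norm_le hη t) (h₂.l2Norm_le hη t)

variable (h₁ : ∀ k, IsBlockFamily η₀ a δ k (A k) (c₁ k))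
  (h₂ : ∀ k, IsBlockFamily η₀ a δ k (B k) (c₂ k))
  (z₁ : ∀ t ξ, c₁ 0 t ξ = 0) (z₂ : ∀ t ξ, c₂ 0 t ξ = 0)

include h₁ h₂ z₁ z₂

/-- Blocks that do not interact have no common output frequency. -/
lemma coefConv_eq_zero {k : ℕ} {p : ℕ × ℕ} (hp : ¬ Interacts k p) {ξ : ℤ} (hξ : ξ ∈ freqBlock k)
    (t : ℝ) : coefConv p.1 (c₁ p.1) (c₂ p.2) t ξ = 0 := by
  refine Finset.sum_eq_zero fun ξ₁ _ => ?_
  by_contra h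
  obtain ⟨e1, e2⟩ := mul_ne_zero_iff.1 h
  have m1 : ξ₁ ∈ freqBlock p.1 := by by_contra m; exact e1 ((h₁ p.1).support _ m t)
  have m2 : ξ - ξ₁ ∈ freqBlock p.2 := by by_contra m; exact e2 ((h₂ p.2).support _ m t)
  refine hp ⟨?_, ?_, block_le_max_add hξ m1 m2 ?_, block_le_max_add m1 hξ m2 ?_,
    block_le_max_add m2 hξ m1 ?_⟩
  · by_contra h0
    rw [show p.1 = 0 by omega] at e1
    exact e1 (z₁ t ξ₁)
  · by_contra h0
    rw [show p.2 = 0 by omega] at e2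
    exact e2 (z₂ t _)
  · simpa using abs_add_le ξ₁ (ξ - ξ₁)
  · simpa using abs_sub ξ (ξ - ξ₁)
  · exact abs_sub ξ ξ₁

variable (hη : IsModulationCutoff η₀)

include hη

lemma enorm_coefConv_le_ite {k : ℕ} {ξ : ℤ} (hξ : ξ ∈ freqBlock k) (p : ℕ × ℕ) (t : ℝ) :
    ‖coefConv p.1 (c₁ p.1) (c₂ p.2) t ξ‖ₑ ≤ if Interacts k p then A p.1 * B p.2 else 0 := by
  split_ifs with h
  · exact enorm_coefConv_le hη (h₁ p.1) (h₂ p.2) t ξ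
  · rw [coefConv_eq_zero h₁ h₂ z₁ z₂ h hξ, enorm_zero]

variable (hA : l2Norm count A ≠ ⊤) (hB : l2Norm count B ≠ ⊤)

include hA hB

lemma continuous_outCoef (hρ : IsSpaceCutoff ρ) (k : ℕ) (ξ : ℤ) :
    Continuous fun t => outCoef ρ c₁ c₂ k t ξ := by
  by_cases hξ : ξ ∈ freqBlock k
  · have hfin := tsum_interacts_ne_top hA hB k
    refine continuous_const.mul (continuous_tsum (fun p => continuous_coefConv
      (h₁ p.1).continuous (h₂ p.2).continuous ξ) (ENNReal.summable_toReal hfin) fun p t => ?_)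
    rw [← toReal_enorm]
    exact ENNReal.toReal_mono (ENNReal.ne_top_of_tsum_ne_top hfin p)
      (enorm_coefConv_le_ite h₁ h₂ z₁ z₂ hη hξ p t)
  · simp_rw [outCoef_eq_zero hρ hξ]
    exact continuous_const

end Output

section Extension

variable {ρ η₀ : ℝ → ℝ} {a δ T : ℝ} {A B : ℕ → ℝ≥0∞} {c₁ c₂ : ℕ → ℝ → ℤ → ℂ}

/-- Summation over the blocks of both factors recovers the Fourier coefficients of the product. -/
lemma tsum_coefConv_eq (hρ : IsSpaceCutoff ρ) {f g : ℝ → ℂ} (hf : IsHInfty f) (hg : IsHInfty g)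
    {t : ℝ} (h₁ : ∀ k ξ, c₁ k t ξ = lpSymbol ρ k ξ * fourierT f ξ)
    (h₂ : ∀ k ξ, c₂ k t ξ = lpSymbol ρ k ξ * fourierT g ξ) (ξ : ℤ) :
    ∑' p : ℕ × ℕ, coefConv p.1 (c₁ p.1) (c₂ p.2) t ξ
      = 2 * Real.pi * fourierT (fun x => f x * g x) ξ := by
  set h : ℤ → ℂ := fun ξ₁ => fourierT f ξ₁ * fourierT g (ξ - ξ₁) with hh
  have hs : HasSum h (2 * Real.pi * fourierT (fun x => f x * g x) ξ) := hf.hasSum_conv hg ξ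
  have hw : ∀ ξ₁, HasSum (fun p : ℕ × ℕ => lpSymbol ρ p.1 ξ₁ * lpSymbol ρ p.2 (ξ - ξ₁)) 1 := by
    intro ξ₁
    have e := (hρ.hasSum_lpSymbol ξ₁).mul (hρ.hasSum_lpSymbol (ξ - ξ₁))
      ((hρ.hasSum_lpSymbol ξ₁).summable.mul_of_nonneg (hρ.hasSum_lpSymbol (ξ - ξ₁)).summable
        (fun k => hρ.lpSymbol_nonneg k _) (fun k => hρ.lpSymbol_nonneg k _))
    rwa [one_mul] at e
  have hw0 : ∀ ξ₁ (p : ℕ × ℕ), 0 ≤ lpSymbol ρ p.1 ξ₁ * lpSymbol ρ p.2 (ξ - ξ₁) := fun ξ₁ p =>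
    mul_nonneg (hρ.lpSymbol_nonneg _ _) (hρ.lpSymbol_nonneg _ _)
  set F : ℤ → ℕ × ℕ → ℂ := fun ξ₁ p =>
    ((lpSymbol ρ p.1 ξ₁ * lpSymbol ρ p.2 (ξ - ξ₁) : ℝ) : ℂ) * h ξ₁ with hF
  -- absolute convergence, the symbols being nonnegative with sum one, allows the sums to be exchanged
  have hFs : Summable (Function.uncurry F) := by
    have hn : ∀ ξ₁ p, ‖F ξ₁ p‖ = lpSymbol ρ p.1 ξ₁ * lpSymbol ρ p.2 (ξ - ξ₁) * ‖h ξ₁‖ := by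
      intro ξ₁ p
      rw [hF, norm_mul, Complex.norm_real, Real.norm_of_nonneg (hw0 ξ₁ p)]
    refine Summable.of_norm ?_
    rw [summable_prod_of_nonneg fun _ => norm_nonneg _]
    simp only [Function.uncurry_apply_pair, hn]
    refine ⟨fun ξ₁ => (hw ξ₁).summable.mul_right _, ?_⟩
    simp only [tsum_mul_right, (hw _).tsum_eq, one_mul]
    exact hs.summable.norm
  have e1 : ∀ p : ℕ × ℕ, coefConv p.1 (c₁ p.1) (c₂ p.2) t ξ = ∑' ξ₁, F ξ₁ p := by
    intro p
    rw [tsum_eq_sum (s := blockFinset p.1)]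
    · refine Finset.sum_congr rfl fun ξ₁ _ => ?_
      rw [h₁, h₂, hF]
      push_cast
      ring
    · intro ξ₁ hξ₁
      rw [mem_blockFinset] at hξ₁
      simp [hF, hρ.lpSymbol_eq_zero hξ₁]
  have e2 : ∀ ξ₁, ∑' p, F ξ₁ p = h ξ₁ := by
    intro ξ₁
    rw [hF, tsum_mul_right, ← Complex.ofReal_tsum, (hw ξ₁).tsum_eq, Complex.ofReal_one, one_mul]
  simp_rw [e1]
  rw [hFs.tsum_comm]
  simp_rw [e2]
  exact hs.tsum_eq

/-- The extension of `P_k ∂ₓ(uv)` assembled from extensions of the blocks of `u` and `v`. -/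
noncomputable def outExt (ρ : ℝ → ℝ) (c₁ c₂ : ℕ → ℝ → ℤ → ℂ) (k : ℕ) (t : ℝ) : ℝ → ℂ :=
  trigPoly (blockFinset k) (outCoef ρ c₁ c₂ k t)

lemma fourierT_outExt (hρ : IsSpaceCutoff ρ) (k : ℕ) (t : ℝ) (ξ : ℤ) :
    fourierT (outExt ρ c₁ c₂ k t) ξ = outCoef ρ c₁ c₂ k t ξ := by
  rw [outExt, fourierT_trigPoly]
  split_ifs with h
  · rfl
  · rw [mem_blockFinset] at h
    rw [outCoef_eq_zero hρ h]

lemma outExt_eq (hρ : IsSpaceCutoff ρ) {u v : ℝ → ℝ → ℂ} {t : ℝ} (hu : IsHInfty (u t))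
    (hv : IsHInfty (v t)) (h₁ : ∀ k ξ, c₁ k t ξ = lpSymbol ρ k ξ * fourierT (u t) ξ)
    (h₂ : ∀ k ξ, c₂ k t ξ = lpSymbol ρ k ξ * fourierT (v t) ξ) (k : ℕ) :
    outExt ρ c₁ c₂ k t = lpProj ρ k (dxMul u v t) := by
  rw [hρ.lpProj_eq_trigPoly, outExt]
  congr 1
  funext ξ
  have hp := hu.mul hv
  have e : fourierT (dxMul u v t) ξ = Complex.I * ξ * fourierT (fun x => u t x * v t x) ξ :=
    fourierT_deriv hp.1 hp.2 ξ
  have hpi : (Real.pi : ℂ) ≠ 0 := by exact_mod_cast Real.pi_ne_zero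
  rw [e, outCoef, tsum_coefConv_eq hρ hu hv h₁ h₂]
  field_simp

variable (h₁ : ∀ k, IsBlockFamily η₀ a δ k (A k) (c₁ k))
  (h₂ : ∀ k, IsBlockFamily η₀ a δ k (B k) (c₂ k))
  (z₁ : ∀ t ξ, c₁ 0 t ξ = 0) (z₂ : ∀ t ξ, c₂ 0 t ξ = 0) (hη : IsModulationCutoff η₀)
  (hA : l2Norm count A ≠ ⊤) (hB : l2Norm count B ≠ ⊤)

include h₁ h₂ z₁ z₂ hη hA hB

/-- The extension is continuous in time as a uniformly convergent sum, and it vanishes outside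
`[-4, 4]` since one factor is cut off to the time scale `T ≤ 1`. -/
lemma isC0Ek_outExt (hρ : IsSpaceCutoff ρ) (hT' : T ≤ 1)
    (hs : ∀ k t, 5 / 4 * T < |t| → ∀ ξ, c₁ k t ξ = 0) (k : ℕ) :
    IsC0Ek k (outExt ρ c₁ c₂ k) := by
  refine ⟨fun t => ⟨continuous_trigPoly _ _, periodic_trigPoly _ _, fun ξ hξ => ?_⟩, ?_,
    fun t ht => ?_⟩
  · rw [fourierT_outExt hρ, outCoef_eq_zero hρ hξ]
  · intro t₀ _
    rw [nhdsWithin_univ]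
    have hc := continuous_outCoef h₁ h₂ z₁ z₂ hη hA hB hρ k
    have e : ∀ t, sobolevNorm 0 (fun x => outExt ρ c₁ c₂ k t x - outExt ρ c₁ c₂ k t₀ x)
        = (∑ ξ ∈ blockFinset k, ‖outCoef ρ c₁ c₂ k t ξ - outCoef ρ c₁ c₂ k t₀ ξ‖ₑ ^ 2)
          ^ (1 / 2 : ℝ) := by
      intro t
      rw [sobolevNorm_zero_eq, l2Norm_count]
      have e' : ∀ ξ, fourierT (fun x => outExt ρ c₁ c₂ k t x - outExt ρ c₁ c₂ k t₀ x) ξ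
          = outCoef ρ c₁ c₂ k t ξ - outCoef ρ c₁ c₂ k t₀ ξ := by
        intro ξ
        rw [fourierT_sub (f := outExt ρ c₁ c₂ k t) (g := outExt ρ c₁ c₂ k t₀)
          (continuous_trigPoly _ _) (continuous_trigPoly _ _), fourierT_outExt hρ, fourierT_outExt hρ]
      simp_rw [e']
      rw [tsum_eq_sum (s := blockFinset k)]
      intro ξ hξ
      rw [mem_blockFinset] at hξ
      simp [outCoef_eq_zero hρ hξ]
    simp_rw [e]
    have hcont : Continuous fun t => (∑ ξ ∈ blockFinset k,
        ‖outCoef ρ c₁ c₂ k t ξ - outCoef ρ c₁ c₂ k t₀ ξ‖ₑ ^ 2) ^ (1 / 2 : ℝ) := by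
      refine ENNReal.continuous_rpow_const.comp (continuous_finsetSum _ fun ξ _ => ?_)
      exact (ENNReal.continuous_pow 2).comp ((hc ξ).sub continuous_const).enorm
    have := hcont.tendsto t₀
    simpa using this
  · have h0 : ∀ ξ, outCoef ρ c₁ c₂ k t ξ = 0 := by
      intro ξ
      have ht4 : 5 / 4 * T < |t| := by
        by_contra! h
        exact ht (abs_le.1 (by linarith))
      simp [outCoef, coefConv, hs _ t ht4]
    funext x
    simp [outExt, trigPoly, h0]

/-- The Fourier transform of the localized extension, block by block. -/
lemma enorm_localizedFourier_outExt_le (hρ : IsSpaceCutoff ρ)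
    (hs : ∀ k t, 5 / 4 * T < |t| → ∀ ξ, c₁ k t ξ = 0) (k : ℕ) (tk : ℝ) (ξ : ℤ) (τ : ℝ) :
    ‖localizedFourier η₀ a δ k tk (outExt ρ c₁ c₂ k) τ ξ‖ₑ
      ≤ 2 ^ (k + 1) * ∑' p : ℕ × ℕ, (freqBlock k).indicator (fun ξ τ =>
        ‖timeFourier (fun t => coefConv p.1 (c₁ p.1) (c₂ p.2) t ξ *
          (η₀ (invTimeScale a δ k * (t - tk)) : ℂ)) τ‖ₑ) ξ τ := by
  rw [localizedFourier_eq]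
  simp_rw [fourierT_outExt hρ]
  by_cases hξ : ξ ∈ freqBlock k
  swap
  · simp [outCoef_eq_zero hρ hξ, timeFourier]
  simp only [Set.indicator_of_mem hξ]
  set m : ℂ := lpSymbol ρ k ξ * (Complex.I * ξ / (2 * Real.pi)) with hm
  set γ : ℝ → ℂ := fun t => (η₀ (invTimeScale a δ k * (t - tk)) : ℂ) with hγ
  have hηc := hη.continuous
  have hγc : Continuous γ := by fun_prop
  set G : ℕ × ℕ → ℝ → ℂ := fun p t => coefConv p.1 (c₁ p.1) (c₂ p.2) t ξ * γ t with hG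
  have hGc : ∀ p, Continuous (G p) := fun p =>
    (continuous_coefConv (h₁ p.1).continuous (h₂ p.2).continuous ξ).mul hγc
  have hmle : ‖m‖ₑ ≤ 2 ^ (k + 1) := by
    have h : ‖m‖ ≤ 2 ^ (k + 1) := by
      have h3 : |(ξ : ℝ)| ≤ 2 ^ (k + 1) := by
        rw [← Int.cast_abs]; exact_mod_cast abs_le_of_mem_freqBlock hξ
      rw [hm, norm_mul, norm_div, norm_mul, norm_mul, Complex.norm_real, Complex.norm_I, one_mul,
        Complex.norm_intCast, Complex.norm_ofNat, Complex.norm_real,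
        Real.norm_of_nonneg Real.pi_pos.le, Real.norm_of_nonneg (hρ.lpSymbol_nonneg k ξ)]
      calc lpSymbol ρ k ξ * (|(ξ : ℝ)| / (2 * Real.pi)) ≤ 1 * (2 ^ (k + 1) / 1) := by
            gcongr
            · exact hρ.lpSymbol_le_one k ξ
            · linarith [Real.pi_gt_three]
        _ = _ := by ring
    rw [← ofReal_norm]
    refine (ENNReal.ofReal_le_ofReal h).trans_eq ?_
    rw [ENNReal.ofReal_pow (by norm_num), ENNReal.ofReal_ofNat]
  have hfin := tsum_interacts_ne_top hA hB k
  have hGle : ∀ p t, ‖G p t‖ₑ ≤ (Set.Icc (-(5 / 4 * T)) (5 / 4 * T)).indicator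
      (fun _ => if Interacts k p then A p.1 * B p.2 else 0) t := by
    intro p t
    by_cases ht : t ∈ Set.Icc (-(5 / 4 * T)) (5 / 4 * T)
    · rw [Set.indicator_of_mem ht, hG, enorm_mul]
      refine (mul_le_mul' (enorm_coefConv_le_ite h₁ h₂ z₁ z₂ hη hξ p t)
        (?_ : ‖γ t‖ₑ ≤ 1)).trans_eq (mul_one _)
      rw [← ofReal_norm, ENNReal.ofReal_le_one, hγ, Complex.norm_real,
        Real.norm_of_nonneg (hη.mem_unit _).1]
      exact (hη.mem_unit _).2
    · have : 5 / 4 * T < |t| := by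
        by_contra! h; exact ht (abs_le.1 h)
      simp [hG, coefConv, hs _ t this]
  -- the sum over the pairs of blocks may be exchanged with the integral in time
  have hsum : ∑' p, ∫⁻ t, ‖G p t‖ₑ ≠ ⊤ := by
    refine ne_top_of_le_ne_top (ENNReal.mul_ne_top hfin
      (measure_Icc_lt_top (μ := volume) (a := -(5 / 4 * T)) (b := 5 / 4 * T)).ne) ?_
    rw [← ENNReal.tsum_mul_right]
    refine ENNReal.tsum_le_tsum fun p => (lintegral_mono (hGle p)).trans ?_
    rw [lintegral_indicator measurableSet_Icc, setLIntegral_const]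
  have e : timeFourier (fun t => outCoef ρ c₁ c₂ k t ξ * γ t) τ
      = m * ∑' p, timeFourier (G p) τ := by
    have e1 : ∀ t : ℝ, Complex.exp (-(Complex.I * (t : ℂ) * (τ : ℂ))) *
        (outCoef ρ c₁ c₂ k t ξ * γ t)
        = m * ∑' p, Complex.exp (-(Complex.I * (t : ℂ) * (τ : ℂ))) * G p t := by
      intro t
      rw [tsum_mul_left, hG, tsum_mul_right, outCoef]
      ring
    unfold timeFourier
    simp_rw [e1]
    rw [integral_const_mul, integral_tsum]
    · intro p
      have := hGc p
      exact Continuous.aestronglyMeasurable (by fun_prop)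
    · simp only [enorm_mul, enorm_cexp_neg_I_mul, one_mul]
      exact hsum
  rw [e, enorm_mul]
  exact mul_le_mul' hmle enorm_tsum_le_tsum_enorm

/-- The short-time norm of `P_k ∂ₓ(uv)` is bounded by the sum of the interactions of the blocks. -/
lemma nkNormT_dxMul_le (hρ : IsSpaceCutoff ρ) (ha : 1 ≤ a) (ha2 : a ≤ 2) {k : ℕ} (hk : 1 ≤ k)
    {ϑ K : ℝ} (hϑ : 0 < ϑ) (hϑ' : ϑ ≤ 1 / 4) (hK : 0 ≤ K) (hM : 0 ≤ 2 - a + δ)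
    (hηb : IsBump K 1 fun t => (η₀ t : ℂ)) (hwb : IsBump K 1 fun t => (unitWindow t : ℂ))
    (hT : 0 < T) (hT' : T ≤ 1) (hs : ∀ k t, 5 / 4 * T < |t| → ∀ ξ, c₁ k t ξ = 0)
    {u v : ℝ → ℝ → ℂ} (hu : ∀ t ∈ Set.Icc (-T) T, IsHInfty (u t))
    (hv : ∀ t ∈ Set.Icc (-T) T, IsHInfty (v t))
    (hc₁ : ∀ k, ∀ t ∈ Set.Icc (-T) T, ∀ ξ, c₁ k t ξ = lpSymbol ρ k ξ * fourierT (u t) ξ)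
    (hc₂ : ∀ k, ∀ t ∈ Set.Icc (-T) T, ∀ ξ, c₂ k t ξ = lpSymbol ρ k ξ * fourierT (v t) ξ) :
    nkNormT η₀ a δ T k (fun t => lpProj ρ k (dxMul u v t))
      ≤ ∑' p : ℕ × ℕ, if Interacts k p then
          ENNReal.ofReal (interactionConst K ϑ * T ^ ϑ
            * interactionSize a δ ϑ k (max k (max p.1 p.2))) * (A p.1 * B p.2) else 0 := by
  refine (iInf₂_le _ (isC0Ek_outExt h₁ h₂ z₁ z₂ hη hA hB hρ hT' hs k)).trans
    ((iInf_le _ fun t ht => outExt_eq hρ (hu t ht) (hv t ht) (fun k => hc₁ k t ht)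
      (fun k => hc₂ k t ht) k).trans ?_)
  refine iSup_le fun tk => ?_
  have hηc := hη.continuous
  set H : ℕ × ℕ → ℤ → ℝ → ℝ≥0∞ := fun p => (freqBlock k).indicator fun ξ τ =>
    ‖timeFourier (fun t => coefConv p.1 (c₁ p.1) (c₂ p.2) t ξ *
      (η₀ (invTimeScale a δ k * (t - tk)) : ℂ)) τ‖ₑ with hH
  have hcs : ∀ p : ℕ × ℕ, ∀ ξ, HasCompactSupport fun t => coefConv p.1 (c₁ p.1) (c₂ p.2) t ξ :=
    fun p ξ => HasCompactSupport.intro (isCompact_Icc (a := -(5 / 4 * T)) (b := 5 / 4 * T))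
      fun t ht => by
        have : 5 / 4 * T < |t| := by
          by_contra! h; exact ht (abs_le.1 h)
        simp [coefConv, hs _ t this]
  have hHm : ∀ p ξ, Measurable (H p ξ) := fun p ξ => measurable_block (fun ξ =>
    measurable_enorm_timeFourier (((continuous_coefConv (h₁ p.1).continuous (h₂ p.2).continuous
      ξ).mul (by fun_prop)).integrable_of_hasCompactSupport (hcs p ξ).mul_right)) ξ
  have hAt : ∀ k, A k ≠ ⊤ := fun k => ne_top_of_le_ne_top hA (le_l2Norm_count A k)
  rw [xNorm_eq_modNorm]
  simp_rw [enorm_mul]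
  calc _ ≤ resolventNorm η₀ a (invTimeScale a δ k) (fun ξ τ => 2 ^ (k + 1) * ∑' p, H p ξ τ) :=
        resolventNorm_mono (enorm_localizedFourier_outExt_le h₁ h₂ z₁ z₂ hη hA hB hρ hs k tk)
    _ = 2 ^ (k + 1) * resolventNorm η₀ a (invTimeScale a δ k) (fun ξ τ => ∑' p, H p ξ τ) :=
        hη.resolventNorm_const_mul _ fun ξ => Measurable.tsum fun p => hHm p ξ
    _ ≤ 2 ^ (k + 1) * ∑' p, resolventNorm η₀ a (invTimeScale a δ k) (H p) :=
        mul_le_mul' le_rfl (hη.resolventNorm_tsum_le hHm)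
    _ ≤ _ := by
        rw [← ENNReal.tsum_mul_left]
        refine ENNReal.tsum_le_tsum fun p => ?_
        split_ifs with hp
        · exact block_interaction_size hη ha ha2 hk hp.1 hp.2.1 hϑ hϑ' hK hM hηb hwb (h₁ p.1)
            (h₂ p.2) (hAt _) hT (hs _) tk
        · have h0 : H p = fun _ _ => 0 := by
            funext ξ τ
            by_cases hξ : ξ ∈ freqBlock k
            · simp [hH, hξ, coefConv_eq_zero h₁ h₂ z₁ z₂ hp hξ, timeFourier]
            · simp [hH, hξ]
          rw [h0]
          have := hη.resolventNorm_const_mul (a := a) (L := invTimeScale a δ k) 0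
            (f := fun _ _ => 0) fun _ => measurable_const
          simp only [zero_mul] at this
          rw [this, mul_zero]

end Extension

/-- A derivative has no mean, so its block at frequency zero vanishes. -/
lemma nkNormT_dxMul_zero {ρ : ℝ → ℝ} (hρ : IsSpaceCutoff ρ) (η₀ : ℝ → ℝ) (a δ : ℝ) {T : ℝ}
    {u v : ℝ → ℝ → ℂ} (hu : ∀ t ∈ Set.Icc (-T) T, IsHInfty (u t))
    (hv : ∀ t ∈ Set.Icc (-T) T, IsHInfty (v t)) :
    nkNormT η₀ a δ T 0 (fun t => lpProj ρ 0 (dxMul u v t)) = 0 := by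
  rw [← nonpos_iff_eq_zero]
  have h0 : ∀ ξ, fourierT (fun _ => 0) ξ = 0 := fun ξ => by simp [fourierT]
  refine (iInf₂_le (fun _ _ => 0) ⟨fun t => ⟨continuous_const, fun _ => rfl, fun ξ _ => h0 ξ⟩,
    fun t₀ _ => ?_, fun _ _ => rfl⟩).trans ((iInf_le _ fun t ht => ?_).trans ?_)
  · change (fun _ => 0) = lpProj ρ 0 (dxMul u v t)
    rw [hρ.lpProj_eq_trigPoly]
    have hp := (hu t ht).mul (hv t ht)
    funext x
    symm
    unfold trigPoly
    rw [Finset.sum_eq_zero, mul_zero]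
    intro ξ hξ
    have hξ0 : ξ = 0 := mem_blockFinset.1 hξ
    have e : fourierT (dxMul u v t) ξ = Complex.I * ξ * fourierT (fun x => u t x * v t x) ξ :=
      fourierT_deriv hp.1 hp.2 ξ
    simp only [e]
    rw [hξ0]
    simp
  · refine iSup_le fun tk => ?_
    simp [xNorm, localizedFourier, spaceTimeFourier, h0]
  · simp [sobolevNorm, h0]

/-! ### Summation over the blocks -/

lemma two_rpow_ne_top (x : ℝ) : (2 : ℝ≥0∞) ^ x ≠ ⊤ := by
  simp [ENNReal.rpow_eq_top_iff]

lemma two_rpow_add (x y : ℝ) : (2 : ℝ≥0∞) ^ (x + y) = 2 ^ x * 2 ^ y :=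
  ENNReal.rpow_add _ _ (by simp) (by simp)

lemma two_rpow_two_mul (k : ℕ) (s : ℝ) (x : ℝ≥0∞) :
    (2 : ℝ≥0∞) ^ (2 * (k : ℝ) * s) * x ^ 2 = ((2 : ℝ≥0∞) ^ ((k : ℝ) * s) * x) ^ 2 := by
  rw [mul_pow, sq ((2 : ℝ≥0∞) ^ ((k : ℝ) * s)), ← two_rpow_add]
  congr 2; ring

lemma fNorm_eq (ρ η₀ : ℝ → ℝ) (a δ T s : ℝ) (u : ℝ → ℝ → ℂ) :
    fNorm ρ η₀ a δ T s u = l2Norm count fun k : ℕ =>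
      (2 : ℝ≥0∞) ^ ((k : ℝ) * s) * fkNormT η₀ a δ T k (fun t => lpProj ρ k (u t)) := by
  simp only [fNorm, l2Norm_count, two_rpow_two_mul]

lemma nNorm_eq (ρ η₀ : ℝ → ℝ) (a δ T s : ℝ) (u : ℝ → ℝ → ℂ) :
    nNorm ρ η₀ a δ T s u = l2Norm count fun k : ℕ =>
      (2 : ℝ≥0∞) ^ ((k : ℝ) * s) * nkNormT η₀ a δ T k (fun t => lpProj ρ k (u t)) := by
  simp only [nNorm, l2Norm_count, two_rpow_two_mul]

/-- The square sum of the number of diagonals against an exponential gain. -/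
noncomputable def diagonalConst (κ : ℝ) : ℝ≥0∞ :=
  l2Norm count fun k : ℕ => (2 : ℝ≥0∞) ^ (-(κ * k)) * ((2 * k + 7 : ℕ) : ℝ≥0∞)

lemma diagonalConst_ne_top {κ : ℝ} (hκ : 0 < κ) : diagonalConst κ ≠ ⊤ := by
  rw [diagonalConst, l2Norm_count]
  refine ENNReal.rpow_ne_top_of_nonneg (by norm_num) ?_
  set q : ℝ := (2 : ℝ) ^ (-(2 * κ)) with hq
  have hq1 : ‖q‖ < 1 := by
    rw [Real.norm_of_nonneg (by positivity)]
    exact two_rpow_neg_lt_one (by positivity)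
  have e : ∀ k : ℕ, ((2 : ℝ≥0∞) ^ (-(κ * k)) * ((2 * k + 7 : ℕ) : ℝ≥0∞)) ^ 2
      = ENNReal.ofReal (4 * ((k : ℝ) ^ 2 * q ^ k) + 28 * ((k : ℝ) ^ 1 * q ^ k)
        + 49 * ((k : ℝ) ^ 0 * q ^ k)) := by
    intro k
    have h1 : (2 : ℝ≥0∞) ^ (-(κ * k)) = ENNReal.ofReal ((2 : ℝ) ^ (-(κ * k))) := by
      rw [← ENNReal.ofReal_rpow_of_pos (by norm_num), ENNReal.ofReal_ofNat]
    have h2 : q ^ k = ((2 : ℝ) ^ (-(κ * k))) ^ 2 := by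
      rw [hq, ← Real.rpow_mul_natCast (by norm_num), ← Real.rpow_mul_natCast (by norm_num)]
      congr 1; push_cast; ring
    rw [h1, ← ENNReal.ofReal_natCast, ← ENNReal.ofReal_mul (by positivity),
      ← ENNReal.ofReal_pow (by positivity), h2]
    congr 1; push_cast; ring
  simp_rw [e]
  rw [← ENNReal.ofReal_tsum_of_nonneg (fun k => by positivity)]
  · exact ENNReal.ofReal_ne_top
  · exact (((summable_pow_mul_geometric_of_norm_lt_one 2 hq1).mul_left 4).add
      ((summable_pow_mul_geometric_of_norm_lt_one 1 hq1).mul_left 28)).add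
      ((summable_pow_mul_geometric_of_norm_lt_one 0 hq1).mul_left 49)

/-- The bilinear estimate with weights `2^{kr}`, `2^{kr₁}`, `2^{kr₂}`, whenever the size of the
interactions outweighs them with an exponential gain `2^{-κk}` in the output frequency, up to a
factor `2^b`. -/
lemma exists_nNorm_dxMul_le {a δ ϑ : ℝ} (ha : 1 ≤ a) (ha2 : a ≤ 2) (hM : 0 ≤ 2 - a + δ)
    (hϑ : 0 < ϑ) (hϑ' : ϑ ≤ 1 / 4) {r r₁ r₂ κ b : ℝ} (hκ : 0 < κ)
    (hker : ∀ k k₁ k₂ : ℕ, Interacts k (k₁, k₂) →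
      k * r + (k * (1 - (2 - a + δ) * (1 - ϑ))
        - (max k (max k₁ k₂) : ℕ) * (a / 2 - (2 - a + δ) * (1 / 2 + ϑ)))
        ≤ b + -(κ * k) + (k₁ * r₁ + k₂ * r₂))
    {ρ η₀ : ℝ → ℝ} (hρ : IsSpaceCutoff ρ) (hη : IsModulationCutoff η₀) :
    ∃ C : NNReal, ∀ T : ℝ, 0 < T → T ≤ 1 → ∀ u v : ℝ → ℝ → ℂ,
      MemF ρ η₀ a δ T 0 u → MemF ρ η₀ a δ T 0 v →
      HasVanishingMean T u → HasVanishingMean T v →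
      nNorm ρ η₀ a δ T r (dxMul u v) ≤
        C * ENNReal.ofReal (T ^ ϑ) * fNorm ρ η₀ a δ T r₁ u * fNorm ρ η₀ a δ T r₂ v := by
  obtain ⟨K, hK, hηb, hwb⟩ := hη.exists_bumps
  set D := ENNReal.ofReal (interactionConst K ϑ)
  set A₀ := ENNReal.ofReal (32 * K)
  have hC : D * A₀ ^ 2 * (2 : ℝ≥0∞) ^ b * diagonalConst κ ≠ ⊤ :=
    ENNReal.mul_ne_top (ENNReal.mul_ne_top (ENNReal.mul_ne_top ENNReal.ofReal_ne_top
      (ENNReal.pow_ne_top ENNReal.ofReal_ne_top)) (two_rpow_ne_top b)) (diagonalConst_ne_top hκ)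
  refine ⟨(D * A₀ ^ 2 * (2 : ℝ≥0∞) ^ b * diagonalConst κ).toNNReal,
    fun T hT hT' u v hu hv hmu hmv => ?_⟩
  rw [ENNReal.coe_toNNReal hC]
  set F : ℕ → ℝ≥0∞ := fun k => fkNormT η₀ a δ T k (fun t => lpProj ρ k (u t)) with hF
  set G : ℕ → ℝ≥0∞ := fun k => fkNormT η₀ a δ T k (fun t => lpProj ρ k (v t)) with hG
  have hFl : l2Norm count F ≠ ⊤ := by
    have := hu.2.ne
    rw [fNorm_eq] at this
    simpa using this
  have hGl : l2Norm count G ≠ ⊤ := by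
    have := hv.2.ne
    rw [fNorm_eq] at this
    simpa using this
  have hl : ∀ {F : ℕ → ℝ≥0∞}, l2Norm count F ≠ ⊤ → l2Norm count (fun k => A₀ * F k) ≠ ⊤ := by
    intro F hF
    rw [l2Norm_const_mul _ (measurable_of_countable _)]
    exact ENNReal.mul_ne_top ENNReal.ofReal_ne_top hF
  obtain ⟨c₁, h₁, hc₁, hs₁, z₁⟩ := exists_isBlockFamily_localized hρ hη hT
    (fun k => ne_top_of_le_ne_top hFl (le_l2Norm_count F k)) hmu hK hηb
  obtain ⟨c₂, h₂, hc₂, -, z₂⟩ := exists_isBlockFamily_localized hρ hη hT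
    (fun k => ne_top_of_le_ne_top hGl (le_l2Norm_count G k)) hmv hK hηb
  replace h₁ : ∀ k, IsBlockFamily η₀ a δ k (A₀ * F k) (c₁ k) := h₁
  replace h₂ : ∀ k, IsBlockFamily η₀ a δ k (A₀ * G k) (c₂ k) := h₂
  set X := fNorm ρ η₀ a δ T r₁ u with hX
  set Y := fNorm ρ η₀ a δ T r₂ v with hY
  rw [nNorm_eq]
  have hk : ∀ k : ℕ, (2 : ℝ≥0∞) ^ ((k : ℝ) * r) *
        nkNormT η₀ a δ T k (fun t => lpProj ρ k (dxMul u v t))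
      ≤ (D * ENNReal.ofReal (T ^ ϑ) * A₀ ^ 2 * (2 : ℝ≥0∞) ^ b * (X * Y)) *
        ((2 : ℝ≥0∞) ^ (-(κ * k)) * ((2 * k + 7 : ℕ) : ℝ≥0∞)) := by
    intro k
    rcases Nat.eq_zero_or_pos k with h0 | h1
    · subst h0
      rw [nkNormT_dxMul_zero hρ η₀ a δ hu.1.1 hv.1.1, mul_zero]
      exact zero_le
    have hn := nkNormT_dxMul_le h₁ h₂ z₁ z₂ hη (hl hFl) (hl hGl) hρ ha ha2 h1 hϑ hϑ' hK hM hηb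
      hwb hT hT' hs₁ hu.1.1 hv.1.1 hc₁ hc₂
    have hdiag := tsum_interacts_le (fun k => (2 : ℝ≥0∞) ^ ((k : ℝ) * r₁) * F k)
      (fun k => (2 : ℝ≥0∞) ^ ((k : ℝ) * r₂) * G k) k
    rw [← fNorm_eq, ← fNorm_eq] at hdiag
    refine (mul_le_mul' le_rfl hn).trans ?_
    calc _ ≤ (D * ENNReal.ofReal (T ^ ϑ) * A₀ ^ 2 * (2 : ℝ≥0∞) ^ b * (2 : ℝ≥0∞) ^ (-(κ * k))) *
          ∑' p : ℕ × ℕ, (if Interacts k p then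
            (2 : ℝ≥0∞) ^ ((p.1 : ℝ) * r₁) * F p.1 * ((2 : ℝ≥0∞) ^ ((p.2 : ℝ) * r₂) * G p.2)
            else 0) := by
          rw [← ENNReal.tsum_mul_left, ← ENNReal.tsum_mul_left]
          refine ENNReal.tsum_le_tsum fun p => ?_
          split_ifs with hp
          swap
          · simp
          have hC0 := interactionConst_nonneg hK hϑ
          set e := (k : ℝ) * (1 - (2 - a + δ) * (1 - ϑ))
            - (max k (max p.1 p.2) : ℕ) * (a / 2 - (2 - a + δ) * (1 / 2 + ϑ)) with he
          have hsize : ENNReal.ofReal (interactionSize a δ ϑ k (max k (max p.1 p.2)))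
              = (2 : ℝ≥0∞) ^ e := by
            rw [interactionSize, ← ENNReal.ofReal_rpow_of_pos two_pos, ENNReal.ofReal_ofNat]
          rw [ENNReal.ofReal_mul (by positivity), ENNReal.ofReal_mul hC0, hsize]
          have hpow : (2 : ℝ≥0∞) ^ ((k : ℝ) * r) * (2 : ℝ≥0∞) ^ e
              ≤ (2 : ℝ≥0∞) ^ b * (2 : ℝ≥0∞) ^ (-(κ * k)) *
                ((2 : ℝ≥0∞) ^ ((p.1 : ℝ) * r₁) * (2 : ℝ≥0∞) ^ ((p.2 : ℝ) * r₂)) := by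
            rw [← two_rpow_add, ← two_rpow_add, ← two_rpow_add, ← two_rpow_add]
            exact ENNReal.rpow_le_rpow_of_exponent_le (by norm_num) (hker k p.1 p.2 hp)
          calc _ = ((2 : ℝ≥0∞) ^ ((k : ℝ) * r) * (2 : ℝ≥0∞) ^ e) *
                (D * ENNReal.ofReal (T ^ ϑ) * A₀ ^ 2 * F p.1 * G p.2) := by ring
            _ ≤ _ := mul_le_mul' hpow le_rfl
            _ = _ := by ring
      _ ≤ (D * ENNReal.ofReal (T ^ ϑ) * A₀ ^ 2 * (2 : ℝ≥0∞) ^ b * (2 : ℝ≥0∞) ^ (-(κ * k))) *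
          (((2 * k + 7 : ℕ) : ℝ≥0∞) * (X * Y)) := mul_le_mul' le_rfl hdiag
      _ = _ := by ring
  refine (l2Norm_mono hk).trans_eq ?_
  rw [l2Norm_const_mul _ (measurable_of_countable _), ← diagonalConst]
  ring

/-! ### The exponents -/

section Exponents

variable {a δ ϑ : ℝ}

/-- The exponents in the size `2^{kp - Nq}` of the interactions: the first inequality bounds
`p - q`, the second one bounds the decay `q` in the largest frequency from below. -/
lemma exponent_bounds (hδ : 0 < δ) (hδa : δ ≤ a - 1) (hϑ : ϑ = δ / 8) :
    (1 - (2 - a + δ) * (1 - ϑ)) - (a / 2 - (2 - a + δ) * (1 / 2 + ϑ)) ≤ -(δ / 4) ∧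
    a - 1 - δ / 2 - δ / 8 ≤ a / 2 - (2 - a + δ) * (1 / 2 + ϑ) := by
  subst hϑ
  constructor <;> nlinarith

variable {p q κ : ℝ} {k k₁ k₂ : ℕ}

/-- Without weights the output frequency can always be traded against the largest one. -/
lemma kernel_le (hq : 0 ≤ q) (hpq : p - q ≤ -κ) :
    k * 0 + (k * p - (max k (max k₁ k₂) : ℕ) * q) ≤ 0 + -(κ * k) + (k₁ * 0 + k₂ * 0 : ℝ) := by
  have hN : (k : ℝ) ≤ (max k (max k₁ k₂) : ℕ) := by exact_mod_cast le_max_left _ _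
  have hk : (0 : ℝ) ≤ k := k.cast_nonneg
  nlinarith

/-- If the factor with the negative weight has frequency well above the output, the other factor
has comparable frequency, and its weight supplies the missing decay. -/
lemma kernel_neg_half_le {s s' : ℝ} (hq : 0 ≤ q) (hpq : p - q ≤ -κ) (hs' : 0 ≤ s')
    (hs'2 : s' ≤ 1 / 2) (hs : s' ≤ s) (hqs : 0 ≤ q - 1 / 2 + s') (h : Interacts k (k₁, k₂)) :
    k * (-1 / 2) + (k * p - (max k (max k₁ k₂) : ℕ) * q)
      ≤ 3 / 2 + -(κ * k) + (k₁ * (-1 / 2) + k₂ * s : ℝ) := by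
  have hN : (k : ℝ) ≤ (max k (max k₁ k₂) : ℕ) := by exact_mod_cast le_max_left _ _
  have hN1 : (k₁ : ℝ) ≤ (max k (max k₁ k₂) : ℕ) := by
    exact_mod_cast (le_max_left _ _).trans (le_max_right _ _)
  have hk : (0 : ℝ) ≤ k := k.cast_nonneg
  have hk2 : (0 : ℝ) ≤ k₂ := k₂.cast_nonneg
  have hsk : (k₂ : ℝ) * s' ≤ k₂ * s := by gcongr
  have h1 : (k : ℝ) * (p - q) ≤ k * -κ := by gcongr
  by_cases hc : k₁ ≤ k + 3
  · have hc' : (k₁ : ℝ) ≤ k + 3 := by exact_mod_cast hc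
    have h2 : (k : ℝ) * q ≤ (max k (max k₁ k₂) : ℕ) * q := by gcongr
    have h3 : 0 ≤ (k₂ : ℝ) * s' := by positivity
    linarith
  · have hc1 : (k : ℝ) ≤ k₁ := by exact_mod_cast (by omega : k ≤ k₁)
    have hc2 : (k₁ : ℝ) ≤ k₂ + 3 := by
      have := h.2.2.2.1
      exact_mod_cast (by simp only at this; omega : k₁ ≤ k₂ + 3)
    have h2 : (k₁ : ℝ) * q ≤ (max k (max k₁ k₂) : ℕ) * q := by gcongr
    have h3 : (k₁ : ℝ) * s' ≤ (k₂ + 3) * s' := by gcongr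
    have h4 : (k : ℝ) * (q - 1 / 2 + s') ≤ k₁ * (q - 1 / 2 + s') := by gcongr
    have h5 : 0 ≤ (k : ℝ) * s' := by positivity
    linarith

end Exponents

end ShortTimeBO

theorem mainTheorem2 :
    (∀ a s : ℝ, 1 < a → a ≤ 3 / 2 → 3 / 2 - a < s →
      ∃ δ θ : ℝ, 0 < δ ∧ 0 < θ ∧
        ∀ ρ η₀ : ℝ → ℝ, ShortTimeBO.IsSpaceCutoff ρ → ShortTimeBO.IsModulationCutoff η₀ →
          ∃ C : NNReal, ∀ T : ℝ, 0 < T → T ≤ 1 → ∀ u v : ℝ → ℝ → ℂ,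
            ShortTimeBO.MemF ρ η₀ a δ T 0 u → ShortTimeBO.MemF ρ η₀ a δ T 0 v →
            ShortTimeBO.HasVanishingMean T u → ShortTimeBO.HasVanishingMean T v →
              ShortTimeBO.MemN ρ η₀ a δ T 0 (ShortTimeBO.dxMul u v) ∧
              ShortTimeBO.nNorm ρ η₀ a δ T 0 (ShortTimeBO.dxMul u v) ≤
                (C : ENNReal) * ENNReal.ofReal (T ^ θ) *
                  ShortTimeBO.fNorm ρ η₀ a δ T 0 u * ShortTimeBO.fNorm ρ η₀ a δ T 0 v ∧
              ShortTimeBO.nNorm ρ η₀ a δ T (-1 / 2) (ShortTimeBO.dxMul u v) ≤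
                (C : ENNReal) * ENNReal.ofReal (T ^ θ) *
                  ShortTimeBO.fNorm ρ η₀ a δ T (-1 / 2) u * ShortTimeBO.fNorm ρ η₀ a δ T s v) ∧
    (∀ a : ℝ, 3 / 2 < a → a < 2 →
      ∃ δ θ : ℝ, 0 < δ ∧ 0 < θ ∧
        ∀ ρ η₀ : ℝ → ℝ, ShortTimeBO.IsSpaceCutoff ρ → ShortTimeBO.IsModulationCutoff η₀ →
          ∃ C : NNReal, ∀ T : ℝ, 0 < T → T ≤ 1 → ∀ u v : ℝ → ℝ → ℂ,
            ShortTimeBO.MemF ρ η₀ a δ T 0 u → ShortTimeBO.MemF ρ η₀ a δ T 0 v →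
            ShortTimeBO.HasVanishingMean T u → ShortTimeBO.HasVanishingMean T v →
              ShortTimeBO.MemN ρ η₀ a δ T 0 (ShortTimeBO.dxMul u v) ∧
              ShortTimeBO.nNorm ρ η₀ a δ T 0 (ShortTimeBO.dxMul u v) ≤
                (C : ENNReal) * ENNReal.ofReal (T ^ θ) *
                  ShortTimeBO.fNorm ρ η₀ a δ T 0 u * ShortTimeBO.fNorm ρ η₀ a δ T 0 v ∧
              ShortTimeBO.nNorm ρ η₀ a δ T (-1 / 2) (ShortTimeBO.dxMul u v) ≤
                (C : ENNReal) * ENNReal.ofReal (T ^ θ) *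
                  ShortTimeBO.fNorm ρ η₀ a δ T 0 u *
                    ShortTimeBO.fNorm ρ η₀ a δ T (-1 / 2) v) := by
  -- A common constant for the two estimates; membership in `N^{0,δ}` follows from the first one.
  have combine : ∀ {a δ ϑ r₁ r₂ : ℝ} {ρ η₀ : ℝ → ℝ},
      (∃ C : NNReal, ∀ T : ℝ, 0 < T → T ≤ 1 → ∀ u v : ℝ → ℝ → ℂ,
        ShortTimeBO.MemF ρ η₀ a δ T 0 u → ShortTimeBO.MemF ρ η₀ a δ T 0 v →
        ShortTimeBO.HasVanishingMean T u → ShortTimeBO.HasVanishingMean T v →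
        ShortTimeBO.nNorm ρ η₀ a δ T 0 (ShortTimeBO.dxMul u v) ≤ C * ENNReal.ofReal (T ^ ϑ) *
          ShortTimeBO.fNorm ρ η₀ a δ T 0 u * ShortTimeBO.fNorm ρ η₀ a δ T 0 v) →
      (∃ C : NNReal, ∀ T : ℝ, 0 < T → T ≤ 1 → ∀ u v : ℝ → ℝ → ℂ,
        ShortTimeBO.MemF ρ η₀ a δ T 0 u → ShortTimeBO.MemF ρ η₀ a δ T 0 v →
        ShortTimeBO.HasVanishingMean T u → ShortTimeBO.HasVanishingMean T v →
        ShortTimeBO.nNorm ρ η₀ a δ T (-1 / 2) (ShortTimeBO.dxMul u v) ≤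
          C * ENNReal.ofReal (T ^ ϑ) *
          ShortTimeBO.fNorm ρ η₀ a δ T r₁ u * ShortTimeBO.fNorm ρ η₀ a δ T r₂ v) →
      ∃ C : NNReal, ∀ T : ℝ, 0 < T → T ≤ 1 → ∀ u v : ℝ → ℝ → ℂ,
        ShortTimeBO.MemF ρ η₀ a δ T 0 u → ShortTimeBO.MemF ρ η₀ a δ T 0 v →
        ShortTimeBO.HasVanishingMean T u → ShortTimeBO.HasVanishingMean T v →
        ShortTimeBO.MemN ρ η₀ a δ T 0 (ShortTimeBO.dxMul u v) ∧
        ShortTimeBO.nNorm ρ η₀ a δ T 0 (ShortTimeBO.dxMul u v) ≤ C * ENNReal.ofReal (T ^ ϑ) *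
          ShortTimeBO.fNorm ρ η₀ a δ T 0 u * ShortTimeBO.fNorm ρ η₀ a δ T 0 v ∧
        ShortTimeBO.nNorm ρ η₀ a δ T (-1 / 2) (ShortTimeBO.dxMul u v) ≤
          C * ENNReal.ofReal (T ^ ϑ) *
          ShortTimeBO.fNorm ρ η₀ a δ T r₁ u * ShortTimeBO.fNorm ρ η₀ a δ T r₂ v := by
    rintro a δ ϑ r₁ r₂ ρ η₀ ⟨C₁, h₁⟩ ⟨C₂, h₂⟩
    refine ⟨max C₁ C₂, fun T hT hT' u v hu hv hmu hmv => ⟨⟨hu.1.dxMul hv.1, ?_⟩, ?_, ?_⟩⟩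
    · refine (h₁ T hT hT' u v hu hv hmu hmv).trans_lt ?_
      exact ENNReal.mul_lt_top (ENNReal.mul_lt_top (ENNReal.mul_lt_top ENNReal.coe_lt_top
        ENNReal.ofReal_lt_top) hu.2) hv.2
    · refine (h₁ T hT hT' u v hu hv hmu hmv).trans ?_
      gcongr
      exact le_max_left _ _
    · refine (h₂ T hT hT' u v hu hv hmu hmv).trans ?_
      gcongr
      exact le_max_right _ _
  constructor
  · intro a s ha ha2 hs
    -- `δ ≤ a - 1` keeps the time scales `2^{-(2-a+δ)k}` above the reciprocal frequency, and
    -- `δ ≤ a - 3/2 + s'` makes the weight `s'` supply the decay missing to half a derivative. Weights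
    -- above `1/2` are not needed, and `θ = δ/8` is a small loss in the exponents.
    set s' := min s (1 / 2) with hs'
    have hs'1 : 3 / 2 - a < s' := lt_min hs (by linarith)
    set δ := min (a - 1) (a - 3 / 2 + s') with hδ
    have hδ0 : 0 < δ := lt_min (by linarith) (by linarith)
    have hδa : δ ≤ a - 1 := min_le_left _ _
    have hδs : δ ≤ a - 3 / 2 + s' := min_le_right _ _
    obtain ⟨hpq, hq⟩ := ShortTimeBO.exponent_bounds (a := a) hδ0 hδa rfl
    refine ⟨δ, δ / 8, hδ0, by linarith, fun ρ η₀ hρ hη => combine ?_ ?_⟩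
    · exact ShortTimeBO.exists_nNorm_dxMul_le ha.le (by linarith) (by linarith) (by linarith)
        (by linarith) (by linarith : 0 < δ / 4)
        (fun k k₁ k₂ _ => ShortTimeBO.kernel_le (by linarith) hpq) hρ hη
    · exact ShortTimeBO.exists_nNorm_dxMul_le ha.le (by linarith) (by linarith) (by linarith)
        (by linarith) (by linarith : 0 < δ / 4)
        (fun k k₁ k₂ h => ShortTimeBO.kernel_neg_half_le (by linarith) hpq (by linarith)
          (min_le_right _ _) (min_le_left _ _) (by linarith) h) hρ hη
  · intro a ha ha2
    -- the same choice with `s' = 0`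
    set δ := min (a - 1) (a - 3 / 2) with hδ
    have hδ0 : 0 < δ := lt_min (by linarith) (by linarith)
    have hδa : δ ≤ a - 1 := min_le_left _ _
    have hδs : δ ≤ a - 3 / 2 := min_le_right _ _
    obtain ⟨hpq, hq⟩ := ShortTimeBO.exponent_bounds (a := a) hδ0 hδa rfl
    refine ⟨δ, δ / 8, hδ0, by linarith, fun ρ η₀ hρ hη => combine ?_ ?_⟩
    · exact ShortTimeBO.exists_nNorm_dxMul_le (by linarith) ha2.le (by linarith) (by linarith)
        (by linarith) (by linarith : 0 < δ / 4)
        (fun k k₁ k₂ _ => ShortTimeBO.kernel_le (by linarith) hpq) hρ hη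
    · refine ShortTimeBO.exists_nNorm_dxMul_le (by linarith) ha2.le (by linarith) (by linarith)
        (by linarith) (by linarith : 0 < δ / 4) (fun k k₁ k₂ h => ?_) hρ hη (b := 3 / 2)
      -- Here the weight is on the second factor, so the roles of the factors are exchanged.
      have h' : ShortTimeBO.Interacts k (k₂, k₁) :=
        ⟨h.2.1, h.1, by simpa only [max_comm k₂ k₁] using h.2.2.1, h.2.2.2.2, h.2.2.2.1⟩
      have := ShortTimeBO.kernel_neg_half_le (s := 0) (s' := 0) (by linarith) hpq le_rfl
        (by norm_num) le_rfl (by linarith) h'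
      rw [max_comm k₁ k₂]
      linarith
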